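/- A camera is a matrix $A\in\mathbb{R}^{3\times 4}$ of rank three, and its focus is the point of $\mathbb{P}^3_{\mathbb{R}}$ spanned by the kernel of $A$. Let $\mathcal{A}=(A_1,\dots,A_n)$ be an arrangement of $n\ge 4$ cameras with pairwise distinct foci, and work in the ring $\mathbb{C}[p_1,\dots,p_n]$, where $p_i=(x_i,y_i,z_i)$. Let $M_{\mathcal{A}}$ be the multiview ideal, that is, the ideal of all polynomials that vanish on the set of points $(A_1\mathbf{q},\dots,A_n\mathbf{q})\in(\mathbb{P}^2_{\mathbb{C}})^n$, where $\mathbf{q}$ runs over the points of $\mathbb{P}^3_{\mathbb{R}}$ other than the foci (a polynomial vanishes at a point of $(\mathbb{P}^2_{\mathbb{C}})^n$ if it vanishes at all choices of homogeneous coordinates of the point, scaled independently in each factor). For $2\le k\le n$ and a $k$-element set $\sigma=\{\sigma_1,\dots,\sigma_k\}\subseteq\{1,\dots,n\}$, let $$\mathcal{A}_\sigma(p)=\begin{pmatrix}A_{\sigma_1}&p_{\sigma_1}& & \\ \vdots& &\ddots& \\ A_{\sigma_k}& & &p_{\sigma_k}\end{pmatrix}$$ be the $3k\times(4+k)$ matrix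 in which each $p_{\sigma_i}$ is written as a column and blank entries are zero, and let the $k$-focal ideal $H^k_{\mathcal{A}}$ be the ideal generated by the $(4+k)\times(4+k)$ minors of all the matrices $\mathcal{A}_\sigma(p)$ with $|\sigma|=k$; $H^2_{\mathcal{A}}$ is the bifocal ideal. Let $\mathfrak{m}=\bigcap_{i=1}^n\langle x_i,y_i,z_i\rangle$ be the multigraded irrelevant ideal, and let $I:\mathfrak{m}=\{f: fg\in I\text{ for all }g\in\mathfrak{m}\}$ denote the colon ideal. Then the following are equivalent: (a) the foci of $\mathcal{A}$ are noncoplanar, i.e. no plane of $\mathbb{P}^3_{\mathbb{R}}$ contains all of them; (b) $H^n_{\mathcal{A}}\subseteq H^2_{\mathcal{A}}$; (c) $M_{\mathcal{A}}=H^2_{\mathcal{A}}:\mathfrak{m}$. -/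

import Mathlib

open scoped LinearAlgebra.Projectivization

noncomputable section

namespace Multiview

/-- A (general projective) camera: a real `3 × 4` matrix of rank three. -/
structure Camera where
  mat : Matrix (Fin 3) (Fin 4) ℝ
  rank_mat : mat.rank = 3

lemma Camera.finrank_ker (A : Camera) :
    Module.finrank ℝ (LinearMap.ker A.mat.mulVecLin) = 1 := by
  have h := LinearMap.finrank_range_add_finrank_ker A.mat.mulVecLin
  have h' : Module.finrank ℝ (LinearMap.range A.mat.mulVecLin) = 3 := A.rank_mat
  simp only [h', Module.finrank_fin_fun] at h
  omega

/-- The focal point of a camera: the unique point of real projective 3-space given by the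
one-dimensional kernel of the camera matrix. -/
def Camera.focus (A : Camera) : ℙ ℝ (Fin 4 → ℝ) :=
  Projectivization.mk'' (LinearMap.ker A.mat.mulVecLin) A.finrank_ker

/-- The foci of the arrangement lie on a common plane of projective 3-space; `v` is the normal
vector of the plane. -/
def IsCoplanar {n : ℕ} (A : Fin n → Camera) : Prop :=
  ∃ v : ℙ ℝ (Fin 4 → ℝ), ∀ i, Projectivization.orthogonal v (A i).focus

/-- The ring `ℂ[p₁, …, pₙ]`, `pᵢ = (xᵢ, yᵢ, zᵢ)`: the variables `(i, 0)`, `(i, 1)`, `(i, 2)` are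
`xᵢ`, `yᵢ`, `zᵢ`. -/
abbrev PolyRing (n : ℕ) : Type := MvPolynomial (Fin n × Fin 3) ℂ

/-- The image of the world point `q` in the camera `A`, as a vector of homogeneous coordinates. -/
def Camera.image (A : Camera) (q : Fin 4 → ℝ) : Fin 3 → ℂ :=
  fun j => ((A.mat.mulVec q j : ℝ) : ℂ)

/-- The joint image `φ_A(ℙ³_ℝ)`, as a subset of `(ℙ²_ℂ)ⁿ`: the tuples of images of the real world
points that are not a focal point of any of the cameras. -/
def jointImage {n : ℕ} (A : Fin n → Camera) : Set (Fin n → ℙ ℂ (Fin 3 → ℂ)) :=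
  {P | ∃ q : Fin 4 → ℝ, q ≠ 0 ∧
    ∀ i, ∃ h : (A i).image q ≠ 0, P i = Projectivization.mk ℂ ((A i).image q) h}

/-- The vanishing ideal of a subset `S` of `(ℙ²_ℂ)ⁿ`: the polynomials that vanish at every choice
of homogeneous coordinates, one vector for each factor, of every point of `S`. -/
def vanishingIdeal {n : ℕ} (S : Set (Fin n → ℙ ℂ (Fin 3 → ℂ))) : Ideal (PolyRing n) where
  carrier := {f | ∀ P ∈ S, ∀ u : Fin n → Fin 3 → ℂ,
    (∀ i, ∃ h : u i ≠ 0, Projectivization.mk ℂ (u i) h = P i) →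
      MvPolynomial.eval (fun v => u v.1 v.2) f = 0}
  add_mem' hf hg P hP u hu := by
    rw [map_add, hf P hP u hu, hg P hP u hu, add_zero]
  zero_mem' _ _ _ _ := map_zero _
  smul_mem' c f hf P hP u hu := by
    rw [smul_eq_mul, map_mul, hf P hP u hu, mul_zero]

/-- The multiview ideal `M_A`. -/
def multiviewIdeal {n : ℕ} (A : Fin n → Camera) : Ideal (PolyRing n) :=
  vanishingIdeal (jointImage A)

/-- The ideal generated by the `k × k` minors of a matrix. (Rows and columns may be chosen in any
order, which only affects the signs of the minors.) -/
def minors {R α β : Type*} [CommRing R] (k : ℕ) (M : Matrix α β R) : Ideal R :=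
  Ideal.span {d | ∃ (r : Fin k ↪ α) (c : Fin k ↪ β), d = (M.submatrix r c).det}

/-- The partially symbolic matrix `A_σ(p)` of size `3k × (4 + k)`, `k = |σ|`: its block row at
`i ∈ σ` is the matrix of camera `i`, followed by `pᵢ` in the column of `i` and zeros elsewhere. -/
def symbolicMatrix {n : ℕ} (A : Fin n → Camera) (σ : Finset (Fin n)) :
    Matrix (σ × Fin 3) (Fin 4 ⊕ σ) (PolyRing n) :=
  Matrix.of fun r c => match c with
    | Sum.inl j => MvPolynomial.C (((A r.1).mat r.2 j : ℝ) : ℂ)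
    | Sum.inr i => if i = r.1 then MvPolynomial.X ((r.1 : Fin n), r.2) else 0

/-- The `k`-focal ideal `H_A^k`: the sum, over all `k`-element sets `σ` of cameras, of the ideals
of maximal minors of `A_σ(p)`. -/
def focalIdeal {n : ℕ} (A : Fin n → Camera) (k : ℕ) : Ideal (PolyRing n) :=
  ⨆ σ ∈ Finset.powersetCard k (Finset.univ : Finset (Fin n)), minors (4 + k) (symbolicMatrix A σ)

/-- The multigraded irrelevant ideal: the intersection of the ideals `⟨xᵢ, yᵢ, zᵢ⟩`. -/
def irrelevantIdeal (n : ℕ) : Ideal (PolyRing n) :=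
  ⨅ i : Fin n, Ideal.span (Set.range fun j : Fin 3 => MvPolynomial.X (i, j))

end Multiview

end

noncomputable section

namespace Multiview

open MvPolynomial Matrix

/-! Write H for the bifocal ideal. A form that is linear in each `p_i` pulls back along q ↦ (A_i q)
to a form of degree n on world space passing through all the foci, and every such form arises this
way (`PointSystem.exists_ML_eq`). The core of the proof is exactness (`PointSystem.Exact`): when the
foci are noncoplanar, a multilinear form with zero pullback already lies in H
(`PointSystem.exact_of_det_ne_zero`).

The tool for exactness is exchange: modulo H, two linear forms vanishing at the foci of cameras i
and j may be swapped between these cameras. Four independent foci are moved to the coordinate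
points, products of coordinate forms become words, and permitted exchanges connect any two words
with the same pullback (`Word.normalize_eq`). For one more camera, coordinates are chosen so that
its focus is the fourth coordinate point. A relation is then a syzygy of three variables, hence of
Koszul type; once its coefficients are corrected by interpolation to vanish at the old foci, it
splits into exchanges modulo relations among the old cameras (`Exact.insert_of_normalized`).

Exactness gives (b), because the n-focals are multilinear and vanish on the image. For (c), take
three general forms for each camera. Determinants yield multilinear relations with prescribed
leading monomials (`exists_relation`); after multiplication by one form from each camera they
rewrite every monomial, modulo H, in terms of standard monomials (`exists_standard_monomial`), and
these are linearly independent as functions on the scaled images (`eq_zero_of_isStandard`). So a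
general product of forms multiplies every element of the multiview ideal into H, and linearity in
each factor extends this to all products, hence to the irrelevant ideal (`prod_mul_mem_of_sep`). The
reverse inclusion of the colon ideal in the multiview ideal holds for every arrangement.

Conversely, if a plane contains all foci, rays in that plane meet pairwise, so the bifocals vanish
at the corresponding image points; but the rays can be chosen without a common point, so that some
n-focal does not vanish (`exists_zero_of_isCoplanar`). No `p_i` is zero at this point, so it refutes
both (b) and (c). -/

/-! ### Homogeneous polynomials in four variables -/

/-- Set the variable `j` to zero. -/
def killVar {τ : Type*} [DecidableEq τ] (j : τ) : MvPolynomial τ ℂ →ₐ[ℂ] MvPolynomial τ ℂ :=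
  aeval fun k => if k = j then 0 else X k

lemma killVar_X {τ : Type*} [DecidableEq τ] (j k : τ) :
    killVar j (X k) = if k = j then 0 else X k := by
  simp [killVar]

lemma X_dvd_sub_killVar {τ : Type*} [DecidableEq τ] (j : τ) (p : MvPolynomial τ ℂ) :
    X j ∣ p - killVar j p := by
  induction p using MvPolynomial.induction_on with
  | C a => simp [killVar]
  | add p q hp hq =>
    have := dvd_add hp hq
    rwa [show p - killVar j p + (q - killVar j q) = p + q - killVar j (p + q) by
      rw [map_add]; ring] at this
  | mul_X p k hp =>
    rw [map_mul, killVar_X]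
    split_ifs with h
    · subst h; simp
    · rw [← sub_mul]; exact dvd_mul_of_dvd_left hp _

lemma isHomogeneous_killVar {τ : Type*} [DecidableEq τ] (j : τ) {p : MvPolynomial τ ℂ} {n : ℕ}
    (hp : p.IsHomogeneous n) : (killVar j p).IsHomogeneous n := by
  have := hp.aeval (fun k => if k = j then (0 : MvPolynomial τ ℂ) else X k) (n := 1)
    (fun k => by split_ifs; exacts [isHomogeneous_zero _ _ _, isHomogeneous_X _ _])
  simpa [killVar] using this

lemma isHomogeneous_of_X_mul {τ : Type*} {j : τ} {d : MvPolynomial τ ℂ} {n : ℕ}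
    (h : (X j * d).IsHomogeneous (n + 1)) : d.IsHomogeneous n := by
  classical
  intro m hm
  have h1 : coeff (Finsupp.single j 1 + m) (X j * d) ≠ 0 := by rwa [coeff_X_mul]
  have := h h1
  rw [map_add, Finsupp.weight_single] at this
  simp at this
  omega

lemma exists_eq_X_mul_add_killVar {τ : Type*} [DecidableEq τ] (j : τ) {p : MvPolynomial τ ℂ}
    {n : ℕ} (hp : p.IsHomogeneous (n + 1)) :
    ∃ d : MvPolynomial τ ℂ, d.IsHomogeneous n ∧ p = X j * d + killVar j p := by
  obtain ⟨d, hd⟩ := X_dvd_sub_killVar j p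
  refine ⟨d, isHomogeneous_of_X_mul (j := j) ?_, by rw [← hd]; ring⟩
  rw [← hd]
  exact hp.sub (isHomogeneous_killVar j hp)

/-- Exactness of the Koszul complex of three variables, with control of degrees. -/
lemma koszul_exact {n : ℕ} {a b c : MvPolynomial (Fin 4) ℂ} (ha : a.IsHomogeneous (n + 1))
    (hb : b.IsHomogeneous (n + 1)) (h : X 0 * a + X 1 * b + X 2 * c = 0) :
    ∃ h₀ h₁ h₂ : MvPolynomial (Fin 4) ℂ,
      h₀.IsHomogeneous n ∧ h₁.IsHomogeneous n ∧ h₂.IsHomogeneous n ∧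
      a = X 1 * h₂ - X 2 * h₁ ∧ b = X 2 * h₀ - X 0 * h₂ ∧ c = X 0 * h₁ - X 1 * h₀ := by
  obtain ⟨k, hk, hak⟩ := exists_eq_X_mul_add_killVar 2 ha
  obtain ⟨h₂, hh₂, hah⟩ := exists_eq_X_mul_add_killVar 1 (isHomogeneous_killVar 2 ha)
  obtain ⟨g, hg, hbg⟩ := exists_eq_X_mul_add_killVar 2 hb
  have e2 : X 0 * killVar 2 a + X 1 * killVar 2 b = 0 := by
    have := congrArg (killVar (2 : Fin 4)) h
    simpa [killVar_X] using this
  have e1 : killVar 1 (killVar 2 a) = 0 := by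
    have := congrArg (killVar (1 : Fin 4)) e2
    simpa [killVar_X] using this
  rw [e1, add_zero] at hah
  have e3 : killVar 2 b = - (X 0 * h₂) := by
    have : X 1 * (X 0 * h₂ + killVar 2 b) = 0 := by rw [← e2, hah]; ring
    rw [mul_eq_zero] at this
    rcases this with h' | h'
    · exact absurd h' (X_ne_zero _)
    · linear_combination h'
  refine ⟨g, -k, h₂, hg, hk.neg, hh₂, ?_, ?_, ?_⟩
  · rw [hak, hah]; ring
  · conv_lhs => rw [hbg, e3]
    ring
  · have : X 2 * (X 0 * k + X 1 * g + c) = 0 := by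
      rw [← h]
      conv_rhs => rw [hak, hah, hbg, e3]
      ring
    rw [mul_eq_zero] at this
    rcases this with h' | h'
    · exact absurd h' (X_ne_zero _)
    · linear_combination h'

lemma eval_smul_of_isHomogeneous {τ : Type*} {p : MvPolynomial τ ℂ} {n : ℕ}
    (hp : p.IsHomogeneous n) (c : ℂ) (x : τ → ℂ) : eval (c • x) p = c ^ n * eval x p := by
  rw [eval_eq, eval_eq, Finset.mul_sum]
  refine Finset.sum_congr rfl fun d hd => ?_
  rw [hp.degree_eq_sum_deg_support hd, ← Finset.prod_pow_eq_pow_sum, mul_left_comm,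
    ← Finset.prod_mul_distrib]
  simp [mul_pow]

/-- Killing the first three variables leaves a multiple of a power of the last one, and its
coefficient is the value of the form at the last coordinate point. -/
lemma exists_eq_sum_X_mul {n : ℕ} {g : MvPolynomial (Fin 4) ℂ} (hg : g.IsHomogeneous (n + 1))
    (h0 : eval (Pi.single 3 1) g = 0) :
    ∃ a : Fin 3 → MvPolynomial (Fin 4) ℂ, (∀ j, (a j).IsHomogeneous n) ∧
      g = ∑ j : Fin 3, X j.castSucc * a j := by
  have hg0 := isHomogeneous_killVar 0 hg
  have hg1 := isHomogeneous_killVar 1 hg0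
  have hg2 := isHomogeneous_killVar 2 hg1
  obtain ⟨a, ha, hga⟩ := exists_eq_X_mul_add_killVar 0 hg
  obtain ⟨b, hb, hgb⟩ := exists_eq_X_mul_add_killVar 1 hg0
  obtain ⟨c, hc, hgc⟩ := exists_eq_X_mul_add_killVar 2 hg1
  have key : ∀ p : MvPolynomial (Fin 4) ℂ, killVar 2 (killVar 1 (killVar 0 p)) =
      aeval (fun k : Fin 4 => (Pi.single 3 (X 3) : Fin 4 → MvPolynomial (Fin 4) ℂ) k) p := by
    intro p
    rw [← AlgHom.comp_apply, ← AlgHom.comp_apply]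
    congr 1
    ext k
    fin_cases k <;> simp [killVar_X]
  have hz : killVar 2 (killVar 1 (killVar 0 g)) = 0 := by
    refine hg2.eq_zero_of_forall_eval_eq_zero fun x => ?_
    rw [key]
    have : eval x (aeval (fun k : Fin 4 =>
        (Pi.single 3 (X 3) : Fin 4 → MvPolynomial (Fin 4) ℂ) k) g) =
        eval (x 3 • (Pi.single 3 1 : Fin 4 → ℂ)) g := by
      rw [MvPolynomial.aeval_def, ← MvPolynomial.coe_eval₂Hom, ← RingHom.comp_apply]
      congr 1
      ext k
      · simp
      · fin_cases k <;> simp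
    rw [this, eval_smul_of_isHomogeneous hg, h0, mul_zero]
  refine ⟨![a, b, c], ?_, ?_⟩
  · intro j; fin_cases j <;> assumption
  · rw [hz, add_zero] at hgc
    rw [hgc] at hgb
    rw [hgb] at hga
    conv_lhs => rw [hga]
    simp [Fin.sum_univ_three]
    ring

/-! ### Linear forms and linear substitutions -/

/-- The linear form with coefficient vector `w`. -/
def lin : (Fin 4 → ℂ) →ₗ[ℂ] MvPolynomial (Fin 4) ℂ where
  toFun w := ∑ k, C (w k) * X k
  map_add' w w' := by simp [add_mul, Finset.sum_add_distrib]
  map_smul' c w := by simp [Finset.mul_sum, mul_assoc, smul_eq_C_mul]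

lemma lin_apply (w : Fin 4 → ℂ) : lin w = ∑ k, C (w k) * X k := rfl

@[simp] lemma eval_lin (w x : Fin 4 → ℂ) : eval x (lin w) = w ⬝ᵥ x := by
  simp [lin_apply, dotProduct]

lemma isHomogeneous_lin (w : Fin 4 → ℂ) : (lin w).IsHomogeneous 1 :=
  IsHomogeneous.sum _ _ _ fun k _ => isHomogeneous_C_mul_X _ k

@[simp] lemma lin_single (k : Fin 4) : lin (Pi.single k 1) = X k := by
  rw [lin_apply, Finset.sum_eq_single k]
  · simp
  · intro b _ hb; simp [hb]
  · simp

/-- The linear substitution replacing the variable `k` by the linear form in row `k`. -/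
def linSubst (G : Matrix (Fin 4) (Fin 4) ℂ) : MvPolynomial (Fin 4) ℂ →ₐ[ℂ] MvPolynomial (Fin 4) ℂ :=
  aeval fun k => lin (G k)

@[simp] lemma linSubst_X (G : Matrix (Fin 4) (Fin 4) ℂ) (k : Fin 4) :
    linSubst G (X k) = lin (G k) := by
  simp [linSubst]

lemma linSubst_lin (G : Matrix (Fin 4) (Fin 4) ℂ) (w : Fin 4 → ℂ) :
    linSubst G (lin w) = lin (w ᵥ* G) := by
  rw [lin_apply, map_sum, vecMul_eq_sum, map_sum]
  refine Finset.sum_congr rfl fun k _ => ?_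
  rw [map_mul, linSubst_X, map_smul, smul_eq_C_mul]
  congr 1
  exact (linSubst G).commutes (w k)

lemma linSubst_linSubst (G H : Matrix (Fin 4) (Fin 4) ℂ) (p : MvPolynomial (Fin 4) ℂ) :
    linSubst H (linSubst G p) = linSubst (G * H) p := by
  have : (linSubst H).comp (linSubst G) = linSubst (G * H) := by
    refine MvPolynomial.algHom_ext fun k => ?_
    rw [AlgHom.comp_apply, linSubst_X, linSubst_X, linSubst_lin]
    rfl
  rw [← this, AlgHom.comp_apply]

lemma linSubst_one (p : MvPolynomial (Fin 4) ℂ) : linSubst 1 p = p := by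
  have : linSubst 1 = AlgHom.id ℂ _ := by
    refine MvPolynomial.algHom_ext fun k => ?_
    rw [linSubst_X, AlgHom.id_apply, ← lin_single]
    congr 1
    ext j
    simp [Matrix.one_apply, Pi.single_apply, eq_comm]
  rw [this, AlgHom.id_apply]

lemma eval_linSubst (G : Matrix (Fin 4) (Fin 4) ℂ) (x : Fin 4 → ℂ) (p : MvPolynomial (Fin 4) ℂ) :
    eval x (linSubst G p) = eval (G *ᵥ x) p := by
  rw [linSubst, aeval_def, ← coe_eval₂Hom, ← RingHom.comp_apply]
  congr 1
  ext k
  · simp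
  · simp [mulVec]

lemma isHomogeneous_linSubst (G : Matrix (Fin 4) (Fin 4) ℂ) {p : MvPolynomial (Fin 4) ℂ} {n : ℕ}
    (hp : p.IsHomogeneous n) : (linSubst G p).IsHomogeneous n := by
  have := hp.aeval (fun k => lin (G k)) (n := 1) (fun k => isHomogeneous_lin _)
  simpa [linSubst] using this

/-- A form vanishing at a point is a combination of three linear forms vanishing there only. -/
lemma exists_eq_sum_lin_mul {n : ℕ} {g : MvPolynomial (Fin 4) ℂ} (hg : g.IsHomogeneous (n + 1))
    {v : Fin 4 → ℂ} (hv : v ≠ 0) (h0 : eval v g = 0) :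
    ∃ (w : Fin 3 → Fin 4 → ℂ) (a : Fin 3 → MvPolynomial (Fin 4) ℂ),
      (∀ j, w j ⬝ᵥ v = 0) ∧
      (∀ q, (∃ w', w' ⬝ᵥ v = 0 ∧ w' ⬝ᵥ q ≠ 0) → ∃ j, w j ⬝ᵥ q ≠ 0) ∧
      (∀ j, (a j).IsHomogeneous n) ∧ g = ∑ j, lin (w j) * a j := by
  obtain ⟨E, hE⟩ := SeparatingDual.exists_continuousLinearEquiv_apply_eq (R := ℂ) hv
    (y := (Pi.single 3 1 : Fin 4 → ℂ)) (by simp)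
  set G := LinearMap.toMatrix' (E : (Fin 4 → ℂ) →ₗ[ℂ] (Fin 4 → ℂ)) with hG
  set H := LinearMap.toMatrix' (E.symm : (Fin 4 → ℂ) →ₗ[ℂ] (Fin 4 → ℂ)) with hH
  have hGv : ∀ x, G *ᵥ x = E x := fun x => by
    rw [hG, ← Matrix.toLin'_apply, Matrix.toLin'_toMatrix']; rfl
  have hHv : ∀ x, H *ᵥ x = E.symm x := fun x => by
    rw [hH, ← Matrix.toLin'_apply, Matrix.toLin'_toMatrix']; rfl
  have hHG : H * G = 1 := by
    refine Matrix.ext_of_mulVec_single fun i => ?_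
    rw [← Matrix.mulVec_mulVec, hGv, hHv, one_mulVec, ContinuousLinearEquiv.symm_apply_apply]
  have h1 : eval (Pi.single 3 1) (linSubst H g) = 0 := by
    rw [eval_linSubst, hHv, ← hE, ContinuousLinearEquiv.symm_apply_apply, h0]
  obtain ⟨a, ha, hga⟩ := exists_eq_sum_X_mul (isHomogeneous_linSubst H hg) h1
  have hrow : ∀ (k : Fin 4) (q : Fin 4 → ℂ), G k ⬝ᵥ q = E q k := fun k q => by
    rw [← hGv]; rfl
  refine ⟨fun j => G j.castSucc, fun j => linSubst G (a j), fun j => ?_, ?_,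
    fun j => isHomogeneous_linSubst G (ha j), ?_⟩
  · rw [hrow, hE]; fin_cases j <;> simp
  · rintro q ⟨w', h, h'⟩
    by_contra hcon
    push Not at hcon
    have hEq : E q = E q 3 • Pi.single 3 1 := by
      ext k
      refine Fin.lastCases ?_ (fun j => ?_) k
      · simp [show Fin.last 3 = 3 from rfl]
      · have := hcon j
        rw [hrow] at this
        rw [this]
        fin_cases j <;> simp
    have hq : q = E q 3 • v := E.injective (by rw [map_smul, hE, ← hEq])
    rw [hq, dotProduct_smul, h, smul_zero] at h'
    exact h' rfl
  · have := congrArg (linSubst G) hga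
    rw [linSubst_linSubst, hHG, linSubst_one] at this
    rw [this]
    simp

/-! ### Interpolation at distinct points -/

section Interpolation

variable {ι : Type*} (f : ι → Fin 4 → ℂ)

/-- Take one plane through each point that misses `x`, and multiply their equations. -/
lemma exists_prod_lin {σ : Finset ι} {x : Fin 4 → ℂ}
    (hsep : ∀ j ∈ σ, ∃ w, w ⬝ᵥ f j = 0 ∧ w ⬝ᵥ x ≠ 0) :
    ∃ δ : MvPolynomial (Fin 4) ℂ, δ.IsHomogeneous σ.card ∧ eval x δ ≠ 0 ∧
      ∀ j ∈ σ, eval (f j) δ = 0 := by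
  choose! w hw hw' using hsep
  refine ⟨∏ j ∈ σ, lin (w j), ?_, ?_, fun j hj => ?_⟩
  · have := IsHomogeneous.prod σ (fun j => lin (w j)) (fun _ => 1) fun j _ => isHomogeneous_lin _
    simpa using this
  · rw [map_prod]
    exact Finset.prod_ne_zero_iff.2 fun j hj => by simpa using hw' j hj
  · rw [map_prod]
    exact Finset.prod_eq_zero hj (by simpa using hw j hj)

/-- Lagrange interpolation. The degree `m` is left free: products of planes give |σ| - 1, but four
independent foci allow one degree less. -/
lemma exists_interpolation {σ : Finset ι} {m : ℕ}
    (hδ : ∀ i ∈ σ, ∃ δ : MvPolynomial (Fin 4) ℂ, δ.IsHomogeneous m ∧ eval (f i) δ ≠ 0 ∧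
      ∀ j ∈ σ, j ≠ i → eval (f j) δ = 0) (c : ι → ℂ) :
    ∃ e : MvPolynomial (Fin 4) ℂ, e.IsHomogeneous m ∧ ∀ i ∈ σ, eval (f i) e = c i := by
  choose! δ h1 h2 h3 using hδ
  refine ⟨∑ i ∈ σ, C (c i / eval (f i) (δ i)) * δ i,
    IsHomogeneous.sum _ _ _ fun i hi => (h1 i hi).C_mul _, fun i hi => ?_⟩
  rw [map_sum, Finset.sum_eq_single i]
  · simp [h2 i hi]
  · intro j hj hji
    simp [h3 j hj i hi hji.symm]
  · exact fun h => absurd hi h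

end Interpolation

/-- A vector orthogonal to `p ≠ 0` is a cross product with `p`. -/
lemma exists_cross_eq {p v : Fin 3 → ℂ} (hp : ∃ j, p j ≠ 0) (h : ∑ j, p j * v j = 0) :
    ∃ a : Fin 3 → ℂ, v 0 = p 1 * a 2 - p 2 * a 1 ∧ v 1 = p 2 * a 0 - p 0 * a 2 ∧
      v 2 = p 0 * a 1 - p 1 * a 0 := by
  rw [Fin.sum_univ_three] at h
  obtain ⟨j, hj⟩ := hp
  fin_cases j
  · have hj : p 0 ≠ 0 := hj
    refine ⟨![0, v 2 / p 0, -(v 1 / p 0)], ?_, ?_, ?_⟩ <;> simp <;> field_simp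
    linear_combination h
  · have hj : p 1 ≠ 0 := hj
    refine ⟨![-(v 2 / p 1), 0, v 0 / p 1], ?_, ?_, ?_⟩ <;> simp <;> field_simp
    linear_combination h
  · have hj : p 2 ≠ 0 := hj
    refine ⟨![v 1 / p 2, -(v 0 / p 2), 0], ?_, ?_, ?_⟩ <;> simp <;> field_simp
    linear_combination h

/-- A vector with vanishing cross product with `p ≠ 0` is a multiple of `p`. -/
lemma exists_smul_eq_of_cross_eq_zero {p v : Fin 3 → ℂ} (hp : ∃ j, p j ≠ 0)
    (h0 : p 1 * v 2 - p 2 * v 1 = 0) (h1 : p 2 * v 0 - p 0 * v 2 = 0)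
    (h2 : p 0 * v 1 - p 1 * v 0 = 0) : ∃ c : ℂ, ∀ j, v j = c * p j := by
  obtain ⟨j, hj⟩ := hp
  refine ⟨v j / p j, fun k => ?_⟩
  rw [div_mul_eq_mul_div, eq_div_iff hj]
  fin_cases j <;> fin_cases k <;> simp only [Fin.zero_eta, Fin.mk_one, Fin.reduceFinMk] <;> grind

/-! ### Multilinear relations modulo exchange relations -/

/-- An abstract arrangement of cameras with foci `f i`: `P i w` is the linear form in the `i`-th
image coordinates whose value at the image of a world point is given by the linear form `w`,
`Ψ` evaluates at the images of the generic world point, and `J` is an ideal containing the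
two-view relations. -/
structure PointSystem (ι R : Type*) [CommRing R] [Algebra ℂ R] where
  f : ι → Fin 4 → ℂ
  J : Ideal R
  P : ι → (Fin 4 → ℂ) →ₗ[ℂ] R
  Ψ : R →ₐ[ℂ] MvPolynomial (Fin 4) ℂ
  Ψ_P : ∀ i w, w ⬝ᵥ f i = 0 → Ψ (P i w) = lin w
  swap : ∀ i j, i ≠ j → ∀ w w', w ⬝ᵥ f i = 0 → w ⬝ᵥ f j = 0 → w' ⬝ᵥ f i = 0 → w' ⬝ᵥ f j = 0 →
    P i w * P j w' - P i w' * P j w ∈ J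

namespace PointSystem

variable {ι R : Type*} [CommRing R] [Algebra ℂ R]

/-- Multilinear elements: the span of the products of one linear form for each camera in `σ`. -/
def ML (S : PointSystem ι R) (σ : Finset ι) : Submodule ℂ R :=
  Submodule.span ℂ {x | ∃ w : ι → Fin 4 → ℂ, (∀ i ∈ σ, w i ⬝ᵥ S.f i = 0) ∧
    x = ∏ i ∈ σ, S.P i (w i)}

/-- Two foci are distinct points: some linear form vanishes at one and not at the other. -/
def Sep (S : PointSystem ι R) (σ : Finset ι) : Prop :=
  ∀ i ∈ σ, ∀ j ∈ σ, i ≠ j → ∃ w, w ⬝ᵥ S.f j = 0 ∧ w ⬝ᵥ S.f i ≠ 0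

/-- Multilinear elements that vanish at the images of all world points lie in `J`. -/
def Exact (S : PointSystem ι R) (σ : Finset ι) : Prop :=
  ∀ F ∈ S.ML σ, S.Ψ F = 0 → F ∈ S.J

lemma Sep.mono {S : PointSystem ι R} {σ τ : Finset ι} (h : S.Sep τ) (hστ : σ ⊆ τ) : S.Sep σ :=
  fun i hi j hj => h i (hστ hi) j (hστ hj)

/-- Change of world coordinates. -/
def change (S : PointSystem ι R) (G H : Matrix (Fin 4) (Fin 4) ℂ) (hGH : G * H = 1) :
    PointSystem ι R where
  f i := G *ᵥ S.f i
  J := S.J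
  P i := S.P i ∘ₗ G.vecMulLinear
  Ψ := (linSubst H).comp S.Ψ
  Ψ_P i w hw := by
    rw [LinearMap.comp_apply, AlgHom.comp_apply, S.Ψ_P, vecMulLinear_apply, linSubst_lin,
      vecMul_vecMul, hGH, vecMul_one]
    rwa [vecMulLinear_apply, ← dotProduct_mulVec]
  swap i j hij w w' h1 h2 h3 h4 := by
    refine S.swap i j hij _ _ ?_ ?_ ?_ ?_ <;>
      rwa [vecMulLinear_apply, ← dotProduct_mulVec]

lemma ML_le_change (S : PointSystem ι R) {G H : Matrix (Fin 4) (Fin 4) ℂ} (hGH : G * H = 1)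
    (σ : Finset ι) : S.ML σ ≤ (S.change G H hGH).ML σ := by
  have hHG : H * G = 1 := mul_eq_one_comm.1 hGH
  refine Submodule.span_mono ?_
  rintro _ ⟨w, hw, rfl⟩
  refine ⟨fun i => w i ᵥ* H, fun i hi => ?_, Finset.prod_congr rfl fun i _ => ?_⟩
  · change (w i ᵥ* H) ⬝ᵥ (G *ᵥ S.f i) = 0
    rw [dotProduct_mulVec, vecMul_vecMul, hHG, vecMul_one, hw i hi]
  · change _ = S.P i ((w i ᵥ* H) ᵥ* G)
    rw [vecMul_vecMul, hHG, vecMul_one]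

lemma Exact.of_change {S : PointSystem ι R} {G H : Matrix (Fin 4) (Fin 4) ℂ} {hGH : G * H = 1}
    {σ : Finset ι} (h : (S.change G H hGH).Exact σ) : S.Exact σ := by
  intro F hF h0
  refine h F (S.ML_le_change hGH σ hF) ?_
  change linSubst H (S.Ψ F) = 0
  rw [h0, map_zero]

lemma Exact.change {S : PointSystem ι R} {G H : Matrix (Fin 4) (Fin 4) ℂ} (hGH : G * H = 1)
    {σ : Finset ι} (h : S.Exact σ) : (S.change G H hGH).Exact σ := by
  intro F hF h0
  have h1 : linSubst H (S.Ψ F) = 0 := h0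
  have h2 := congrArg (linSubst G) h1
  rw [linSubst_linSubst, mul_eq_one_comm.1 hGH, linSubst_one, map_zero] at h2
  refine h F (Submodule.span_mono ?_ hF) h2
  rintro _ ⟨w, hw, rfl⟩
  refine ⟨fun i => w i ᵥ* G, fun i hi => ?_, rfl⟩
  have : w i ⬝ᵥ (G *ᵥ S.f i) = 0 := hw i hi
  rwa [← dotProduct_mulVec]

lemma Sep.change {S : PointSystem ι R} {G H : Matrix (Fin 4) (Fin 4) ℂ} (hGH : G * H = 1)
    {σ : Finset ι} (h : S.Sep σ) : (S.change G H hGH).Sep σ := by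
  have hHG : H * G = 1 := mul_eq_one_comm.1 hGH
  intro i hi j hj hij
  obtain ⟨w, h1, h2⟩ := h i hi j hj hij
  have key : ∀ l, (w ᵥ* H) ⬝ᵥ (S.change G H hGH).f l = w ⬝ᵥ S.f l := fun l => by
    change (w ᵥ* H) ⬝ᵥ (G *ᵥ S.f l) = _
    rw [dotProduct_mulVec, vecMul_vecMul, hHG, vecMul_one]
  exact ⟨w ᵥ* H, by rw [key, h1], by rwa [key]⟩

variable [DecidableEq ι]

lemma mul_mem_ML (S : PointSystem ι R) {σ : Finset ι} {a : ι} (ha : a ∉ σ) {w : Fin 4 → ℂ}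
    (hw : w ⬝ᵥ S.f a = 0) {F : R} (hF : F ∈ S.ML σ) : S.P a w * F ∈ S.ML (insert a σ) := by
  induction hF using Submodule.span_induction with
  | mem x hx =>
    obtain ⟨w', hw', rfl⟩ := hx
    refine Submodule.subset_span ⟨Function.update w' a w, fun i hi => ?_, ?_⟩
    · rcases Finset.mem_insert.1 hi with rfl | hi'
      · simpa using hw
      · rw [Function.update_of_ne (ne_of_mem_of_not_mem hi' ha)]
        exact hw' i hi'
    · rw [Finset.prod_insert ha, Function.update_self]
      congr 1
      refine Finset.prod_congr rfl fun i hi => ?_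
      rw [Function.update_of_ne (by rintro rfl; exact ha hi)]
  | zero => simp
  | add x y _ _ hx hy => rw [mul_add]; exact add_mem hx hy
  | smul c x _ hx => rw [mul_smul_comm]; exact Submodule.smul_mem _ _ hx

/-- Forms of degree `|σ|` through all foci in `σ` come from multilinear elements. -/
theorem exists_ML_eq (S : PointSystem ι R) (σ : Finset ι) (hσ : S.Sep σ)
    (hne : ∀ i ∈ σ, S.f i ≠ 0) {g : MvPolynomial (Fin 4) ℂ} (hg : g.IsHomogeneous σ.card)
    (h0 : ∀ i ∈ σ, eval (S.f i) g = 0) : ∃ F ∈ S.ML σ, S.Ψ F = g := by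
  induction σ using Finset.induction_on generalizing g with
  | empty =>
    rw [Finset.card_empty, ← mem_homogeneousSubmodule, homogeneousSubmodule_zero,
      Submodule.mem_one] at hg
    obtain ⟨c, rfl⟩ := hg
    refine ⟨c • 1, Submodule.smul_mem _ _ (Submodule.subset_span ⟨0, by simp, by simp⟩), ?_⟩
    rw [map_smul, map_one, Algebra.algebraMap_eq_smul_one]
  | insert a σ ha ih =>
    have hσ' : S.Sep σ := hσ.mono (Finset.subset_insert _ _)
    rw [Finset.card_insert_of_notMem ha] at hg
    obtain ⟨w, b, hw, hw', hb, rfl⟩ := exists_eq_sum_lin_mul hg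
      (hne a (Finset.mem_insert_self _ _)) (h0 a (Finset.mem_insert_self _ _))
    have hwσ : ∀ i ∈ σ, ∃ j, w j ⬝ᵥ S.f i ≠ 0 := fun i hi => hw' _
      (hσ i (Finset.mem_insert_of_mem hi) a (Finset.mem_insert_self _ _)
        (by rintro rfl; exact ha hi))
    -- The form vanishes at `f i`, so the values of the `b j` there are orthogonal to the nonzero
    -- vector of values of the forms `w j`, and hence form a cross product with it.
    have hcross : ∀ i ∈ σ, ∃ v : Fin 3 → ℂ,
        eval (S.f i) (b 0) = (w 1 ⬝ᵥ S.f i) * v 2 - (w 2 ⬝ᵥ S.f i) * v 1 ∧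
        eval (S.f i) (b 1) = (w 2 ⬝ᵥ S.f i) * v 0 - (w 0 ⬝ᵥ S.f i) * v 2 ∧
        eval (S.f i) (b 2) = (w 0 ⬝ᵥ S.f i) * v 1 - (w 1 ⬝ᵥ S.f i) * v 0 := fun i hi =>
      exists_cross_eq (p := fun j => w j ⬝ᵥ S.f i) (v := fun j => eval (S.f i) (b j)) (hwσ i hi)
        (by simpa using h0 i (Finset.mem_insert_of_mem hi))
    choose! v hv0 hv1 hv2 using hcross
    -- The empty case is separate because the interpolation below has degree |σ| - 1.
    rcases σ.eq_empty_or_nonempty with rfl | hne'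
    · refine ⟨∑ j, S.P a (w j) * (coeff 0 (b j) • 1), Submodule.sum_mem _ fun j _ => ?_, ?_⟩
      · exact S.mul_mem_ML ha (hw j)
          (Submodule.smul_mem _ _ (Submodule.subset_span ⟨0, by simp, by simp⟩))
      · rw [map_sum]
        refine Finset.sum_congr rfl fun j _ => ?_
        have := hb j
        rw [Finset.card_empty, ← mem_homogeneousSubmodule, homogeneousSubmodule_zero,
          Submodule.mem_one] at this
        obtain ⟨c, hc⟩ := this
        rw [map_mul, S.Ψ_P _ _ (hw j), map_smul, map_one, ← hc]
        simp [smul_eq_C_mul, algebraMap_eq]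
    obtain ⟨m, hm⟩ : ∃ m, σ.card = m + 1 := ⟨σ.card - 1, by have := hne'.card_pos; omega⟩
    have hδ : ∀ i ∈ σ, ∃ δ : MvPolynomial (Fin 4) ℂ, δ.IsHomogeneous m ∧ eval (S.f i) δ ≠ 0 ∧
        ∀ j ∈ σ, j ≠ i → eval (S.f j) δ = 0 := fun i hi => by
      obtain ⟨δ, h1, h2, h3⟩ := exists_prod_lin S.f (σ := σ.erase i) (x := S.f i)
        (fun j hj => hσ' i hi j (Finset.mem_of_mem_erase hj) (Finset.ne_of_mem_erase hj).symm)
      refine ⟨δ, ?_, h2, fun j hj hji => h3 j (Finset.mem_erase.2 ⟨hji, hj⟩)⟩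
      rwa [Finset.card_erase_of_mem hi, hm] at h1
    choose e he hev using fun k : Fin 3 => exists_interpolation S.f hδ (fun i => v i k)
    -- With `e` interpolating the vectors `v i`, subtracting the cross product of the forms `lin (w
    -- j)` with `e` from `b` leaves the sum ∑ lin (w j) * b j unchanged and makes every coefficient
    -- vanish at all foci in `σ`, so induction applies to each coefficient.
    have hmul : ∀ j k, (lin (w j) * e k).IsHomogeneous σ.card := fun j k => by
      have := (isHomogeneous_lin (w j)).mul (he k)
      rwa [add_comm, ← hm] at this
    obtain ⟨F0, hF0, h0'⟩ := ih hσ' (fun i hi => hne i (Finset.mem_insert_of_mem hi))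
      (g := b 0 - (lin (w 1) * e 2 - lin (w 2) * e 1))
      ((hb 0).sub ((hmul _ _).sub (hmul _ _)))
      (fun i hi => by simp [hev _ i hi, hv0 i hi])
    obtain ⟨F1, hF1, h1'⟩ := ih hσ' (fun i hi => hne i (Finset.mem_insert_of_mem hi))
      (g := b 1 - (lin (w 2) * e 0 - lin (w 0) * e 2))
      ((hb 1).sub ((hmul _ _).sub (hmul _ _)))
      (fun i hi => by simp [hev _ i hi, hv1 i hi])
    obtain ⟨F2, hF2, h2'⟩ := ih hσ' (fun i hi => hne i (Finset.mem_insert_of_mem hi))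
      (g := b 2 - (lin (w 0) * e 1 - lin (w 1) * e 0))
      ((hb 2).sub ((hmul _ _).sub (hmul _ _)))
      (fun i hi => by simp [hev _ i hi, hv2 i hi])
    refine ⟨S.P a (w 0) * F0 + S.P a (w 1) * F1 + S.P a (w 2) * F2,
      add_mem (add_mem (S.mul_mem_ML ha (hw 0) hF0) (S.mul_mem_ML ha (hw 1) hF1))
        (S.mul_mem_ML ha (hw 2) hF2), ?_⟩
    simp only [map_add, map_mul, S.Ψ_P _ _ (hw _), h0', h1', h2', Fin.sum_univ_three]
    ring

end PointSystem

/-! ### Adding one camera to an exact system. -/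

namespace PointSystem

variable {ι R : Type*} [CommRing R] [Algebra ℂ R]

/-- The factor of camera `i` pulls back to a plane through its own focus. Together with the degree
statement below, this is the converse of `exists_ML_eq`. -/
lemma eval_eq_zero_of_mem_ML (S : PointSystem ι R) {σ : Finset ι} {F : R} (hF : F ∈ S.ML σ)
    {i : ι} (hi : i ∈ σ) : eval (S.f i) (S.Ψ F) = 0 := by
  induction hF using Submodule.span_induction with
  | mem x hx =>
    obtain ⟨w, hw, rfl⟩ := hx
    rw [map_prod, map_prod]
    exact Finset.prod_eq_zero hi (by rw [S.Ψ_P _ _ (hw i hi), eval_lin, hw i hi])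
  | zero => simp
  | add x y _ _ hx hy => rw [map_add, map_add, hx, hy, add_zero]
  | smul c x _ hx => rw [map_smul, smul_eval, hx, mul_zero]

lemma isHomogeneous_of_mem_ML (S : PointSystem ι R) {σ : Finset ι} {F : R} (hF : F ∈ S.ML σ) :
    (S.Ψ F).IsHomogeneous σ.card := by
  induction hF using Submodule.span_induction with
  | mem x hx =>
    obtain ⟨w, hw, rfl⟩ := hx
    rw [map_prod]
    have := IsHomogeneous.prod σ (fun j => S.Ψ (S.P j (w j))) (fun _ => 1) fun j hj => by
      rw [S.Ψ_P _ _ (hw j hj)]; exact isHomogeneous_lin _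
    simpa using this
  | zero => rw [map_zero]; exact isHomogeneous_zero _ _ _
  | add x y _ _ hx hy => rw [map_add]; exact hx.add hy
  | smul c x _ hx => rw [map_smul, smul_eq_C_mul]; exact hx.C_mul _

variable [DecidableEq ι]

/-- The linear forms vanishing at the last coordinate point are spanned by the first three
coordinates. -/
lemma exists_eq_of_mem_ML_insert (S : PointSystem ι R) {σ : Finset ι} {a : ι} (ha : a ∉ σ)
    (hfa : S.f a = Pi.single 3 1) {F : R} (hF : F ∈ S.ML (insert a σ)) :
    ∃ F' : Fin 3 → R, (∀ k, F' k ∈ S.ML σ) ∧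
      F = ∑ k : Fin 3, S.P a (Pi.single k.castSucc 1) * F' k := by
  induction hF using Submodule.span_induction with
  | mem x hx =>
    obtain ⟨w, hw, rfl⟩ := hx
    refine ⟨fun k => w a k.castSucc • ∏ i ∈ σ, S.P i (w i), fun k => Submodule.smul_mem _ _
      (Submodule.subset_span ⟨w, fun i hi => hw i (Finset.mem_insert_of_mem hi), rfl⟩), ?_⟩
    have h3 : w a 3 = 0 := by
      have := hw a (Finset.mem_insert_self _ _)
      rwa [hfa, dotProduct_single_one] at this
    have hwa : w a = ∑ k : Fin 3, w a k.castSucc • Pi.single k.castSucc 1 := by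
      ext j
      fin_cases j <;> simp [Fin.sum_univ_three, h3]
    rw [Finset.prod_insert ha]
    conv_lhs => rw [hwa, map_sum, Finset.sum_mul]
    refine Finset.sum_congr rfl fun k _ => ?_
    rw [map_smul, smul_mul_assoc, mul_smul_comm]
  | zero => exact ⟨0, fun k => zero_mem _, by simp⟩
  | add x y _ _ hx hy =>
    obtain ⟨F, hF, rfl⟩ := hx
    obtain ⟨F', hF', rfl⟩ := hy
    exact ⟨F + F', fun k => add_mem (hF k) (hF' k), by simp [mul_add, Finset.sum_add_distrib]⟩
  | smul c x _ hx =>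
    obtain ⟨F, hF, rfl⟩ := hx
    exact ⟨c • F, fun k => Submodule.smul_mem _ _ (hF k), by simp [Finset.smul_sum]⟩

/-- Exchange of two linear forms through the focus of a camera `j ∈ σ`. -/
lemma exchange_mem (S : PointSystem ι R) {σ : Finset ι} {a j : ι} (ha : a ∉ σ) (hj : j ∈ σ)
    (hsep : S.Sep σ) (hne : ∀ i ∈ σ, S.f i ≠ 0) (hex : S.Exact σ) {w w' : Fin 4 → ℂ}
    (hwa : w ⬝ᵥ S.f a = 0) (hwa' : w' ⬝ᵥ S.f a = 0) (hwj : w ⬝ᵥ S.f j = 0)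
    (hwj' : w' ⬝ᵥ S.f j = 0) {g : MvPolynomial (Fin 4) ℂ} (hg : g.IsHomogeneous (σ.card - 1))
    (h0 : ∀ i ∈ σ, eval (S.f i) g = 0) {F F' : R} (hF : F ∈ S.ML σ) (hF' : F' ∈ S.ML σ)
    (hΨ : S.Ψ F = lin w * g) (hΨ' : S.Ψ F' = lin w' * g) :
    S.P a w * F' - S.P a w' * F ∈ S.J := by
  have hcard : (σ.erase j).card = σ.card - 1 := Finset.card_erase_of_mem hj
  obtain ⟨G, hG, rfl⟩ := S.exists_ML_eq (σ.erase j) (hsep.mono (Finset.erase_subset _ _))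
    (fun i hi => hne i (Finset.mem_of_mem_erase hi)) (hcard ▸ hg)
    (fun i hi => h0 i (Finset.mem_of_mem_erase hi))
  -- Exactness on `σ` moves the linear factor into camera `j`, with the same cofactor `G` for both
  -- elements. What remains is a two-view exchange between `a` and `j`, multiplied by `G`.
  have key : ∀ (v : Fin 4 → ℂ) (E : R), v ⬝ᵥ S.f j = 0 → E ∈ S.ML σ →
      S.Ψ E = lin v * S.Ψ G → E - S.P j v * G ∈ S.J := fun v E hv hE hEv => by
    refine hex _ (sub_mem hE ?_) ?_
    · have := S.mul_mem_ML (Finset.notMem_erase j σ) hv hG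
      rwa [Finset.insert_erase hj] at this
    · rw [map_sub, map_mul, S.Ψ_P _ _ hv, hEv, sub_self]
  have h1 := S.J.mul_mem_left (S.P a w) (key w' F' hwj' hF' hΨ')
  have h2 := S.J.mul_mem_left (S.P a w') (key w F hwj hF hΨ)
  have h3 := S.J.mul_mem_left G (S.swap a j (by rintro rfl; exact ha hj) w w' hwa hwj hwa' hwj')
  have := add_mem (sub_mem h1 h2) h3
  convert this using 1
  ring

/-- Adding a camera, in coordinates where four of the foci are the coordinate points. -/
theorem Exact.insert_of_normalized {S : PointSystem ι R} {σ : Finset ι} {a : ι} (ha : a ∉ σ)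
    (hsep : S.Sep (insert a σ)) (hex : S.Exact σ) (hfa : S.f a = Pi.single 3 1)
    {j : Fin 3 → ι} (hj : ∀ k, j k ∈ σ) (hfj : ∀ k, S.f (j k) = Pi.single k.castSucc 1) :
    S.Exact (insert a σ) := by
  have hsep' : S.Sep σ := hsep.mono (Finset.subset_insert _ _)
  have hia : ∀ i ∈ σ, i ≠ a := fun i hi => ne_of_mem_of_not_mem hi ha
  have hne : ∀ i ∈ σ, S.f i ≠ 0 := fun i hi h => by
    obtain ⟨w, -, h2⟩ := hsep i (Finset.mem_insert_of_mem hi) a (Finset.mem_insert_self _ _)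
      (hia i hi)
    rw [h, dotProduct_zero] at h2
    exact h2 rfl
  have hjinj : Function.Injective j := fun k l hkl => by
    have h1 := hfj k
    rw [hkl, hfj l] at h1
    have := congrFun h1 k.castSucc
    by_contra hne
    rw [Pi.single_apply, if_neg (by simpa using hne)] at this
    simp at this
  -- distinguishing coordinates
  have hcoord : ∀ i ∈ σ, ∃ k : Fin 3, S.f i k.castSucc ≠ 0 := fun i hi => by
    obtain ⟨w, h1, h2⟩ := hsep i (Finset.mem_insert_of_mem hi) a (Finset.mem_insert_self _ _)
      (hia i hi)
    by_contra hcon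
    push Not at hcon
    rw [hfa, dotProduct_single_one] at h1
    refine h2 ?_
    rw [dotProduct, Fin.sum_univ_castSucc]
    simp [hcon, show Fin.last 3 = 3 from rfl, h1]
  obtain ⟨m, hm⟩ : ∃ m, σ.card = m + 3 := by
    have : (Finset.univ.map ⟨j, hjinj⟩).card ≤ σ.card := Finset.card_le_card fun x hx => by
      obtain ⟨k, -, rfl⟩ := Finset.mem_map.1 hx
      exact hj k
    rw [Finset.card_map, Finset.card_univ, Fintype.card_fin] at this
    exact ⟨σ.card - 3, by omega⟩
  -- interpolation in degree `|σ| - 2`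
  have hδ : ∀ i ∈ σ, ∃ δ : MvPolynomial (Fin 4) ℂ, δ.IsHomogeneous (m + 1) ∧
      eval (S.f i) δ ≠ 0 ∧ ∀ l ∈ σ, l ≠ i → eval (S.f l) δ = 0 := fun i hi => by
    obtain ⟨k, hk⟩ := hcoord i hi
    -- The degree saved by independence: the coordinate `k`, nonzero at `f i`, vanishes at both foci
    -- `j k₁` and `j k₂`, so one linear factor does the work of two.
    obtain ⟨k₁, k₂, h12, h1, h2⟩ : ∃ k₁ k₂ : Fin 3, k₁ ≠ k₂ ∧ k₁ ≠ k ∧ k₂ ≠ k := by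
      clear hk; revert k; decide
    have hji : ∀ l : Fin 3, l ≠ k → j l ≠ i := fun l hl h => by
      refine hk ?_
      rw [← h, hfj, Pi.single_apply, if_neg (by simpa using hl.symm)]
    set τ := ((σ.erase i).erase (j k₁)).erase (j k₂) with hτ
    have hc : τ.card = m := by
      rw [hτ, Finset.card_erase_of_mem, Finset.card_erase_of_mem, Finset.card_erase_of_mem hi, hm]
      · omega
      · exact Finset.mem_erase.2 ⟨hji _ h1, hj _⟩
      · exact Finset.mem_erase.2 ⟨fun h => h12 (hjinj h).symm,
          Finset.mem_erase.2 ⟨hji _ h2, hj _⟩⟩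
    obtain ⟨δ, d1, d2, d3⟩ := exists_prod_lin S.f (σ := τ) (x := S.f i) (fun l hl => by
      simp only [hτ, Finset.mem_erase] at hl
      exact hsep' i hi l hl.2.2.2 hl.2.2.1.symm)
    refine ⟨δ * X k.castSucc, ?_, ?_, fun l hl hli => ?_⟩
    · rw [hc] at d1
      exact d1.mul (isHomogeneous_X _ _)
    · rw [map_mul, eval_X]; exact mul_ne_zero d2 hk
    · rw [map_mul, eval_X]
      by_cases e1 : l = j k₁
      · rw [e1, hfj, Pi.single_apply, if_neg (by simpa using h1.symm), mul_zero]
      by_cases e2 : l = j k₂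
      · rw [e2, hfj, Pi.single_apply, if_neg (by simpa using h2.symm), mul_zero]
      rw [d3 l (by simp [hτ, e1, e2, hli, hl]), zero_mul]
  intro F hF hΨF
  obtain ⟨F', hF', rfl⟩ := S.exists_eq_of_mem_ML_insert ha hfa hF
  have hPa : ∀ k : Fin 3, S.Ψ (S.P a (Pi.single k.castSucc 1)) = X k.castSucc := fun k => by
    rw [S.Ψ_P, lin_single]
    rw [hfa, dotProduct_single_one, Pi.single_apply, if_neg]
    fin_cases k <;> simp
  have hhom : ∀ k, (S.Ψ (F' k)).IsHomogeneous (m + 2 + 1) := fun k => by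
    have := S.isHomogeneous_of_mem_ML (hF' k)
    rwa [hm] at this
  have hrel : X 0 * S.Ψ (F' 0) + X 1 * S.Ψ (F' 1) + X 2 * S.Ψ (F' 2) = 0 := by
    rw [map_sum, Fin.sum_univ_three] at hΨF
    simp only [map_mul, hPa] at hΨF
    exact hΨF
  obtain ⟨h₀, h₁, h₂, hh₀, hh₁, hh₂, ha0, ha1, ha2⟩ := koszul_exact (hhom 0) (hhom 1) hrel
  -- At an old focus the three coefficients vanish, so the Koszul potential has zero cross product
  -- with the first three coordinates of the focus and is proportional to them. Subtracting from the
  -- potential an interpolating form times (X 0, X 1, X 2) changes no coefficient and kills these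
  -- values.
  have hprop : ∀ i ∈ σ, ∃ c : ℂ, ∀ k : Fin 3, eval (S.f i) (![h₀, h₁, h₂] k) =
      c * S.f i k.castSucc := fun i hi => by
    have hv := fun k => S.eval_eq_zero_of_mem_ML (hF' k) hi
    refine exists_smul_eq_of_cross_eq_zero (p := fun k => S.f i k.castSucc)
      (v := fun k => eval (S.f i) (![h₀, h₁, h₂] k)) (hcoord i hi) ?_ ?_ ?_
    · have := hv 0; rw [ha0] at this; simpa using this
    · have := hv 1; rw [ha1] at this; simpa using this
    · have := hv 2; rw [ha2] at this; simpa using this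
  choose! c hc using hprop
  obtain ⟨e, he, hev⟩ := exists_interpolation S.f hδ c
  -- the corrected coefficients vanish at all foci
  obtain ⟨H, hHhom, hHz, hH0, hH1, hH2⟩ : ∃ H : Fin 3 → MvPolynomial (Fin 4) ℂ,
      (∀ k, (H k).IsHomogeneous (σ.card - 1)) ∧ (∀ k, ∀ i ∈ σ, eval (S.f i) (H k) = 0) ∧
      S.Ψ (F' 0) = X 1 * H 2 - X 2 * H 1 ∧ S.Ψ (F' 1) = X 2 * H 0 - X 0 * H 2 ∧
      S.Ψ (F' 2) = X 0 * H 1 - X 1 * H 0 := by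
    have hm1 : σ.card - 1 = m + 2 := by omega
    refine ⟨fun k => ![h₀, h₁, h₂] k - e * X k.castSucc, fun k => ?_, fun k i hi => ?_,
      ?_, ?_, ?_⟩
    · rw [hm1]
      refine IsHomogeneous.sub ?_ (he.mul (isHomogeneous_X _ _))
      fin_cases k <;> assumption
    · rw [map_sub, hc i hi, map_mul, hev i hi, eval_X, sub_self]
    · rw [ha0]; simp; ring
    · rw [ha1]; simp; ring
    · rw [ha2]; simp; ring
  have hlift : ∀ k l : Fin 3, ∃ E ∈ S.ML σ, S.Ψ E = X k.castSucc * H l := fun k l => by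
    refine S.exists_ML_eq σ hsep' hne ?_ fun i hi => by rw [map_mul, hHz l i hi, mul_zero]
    have := (isHomogeneous_X ℂ k.castSucc).mul (hHhom l)
    rwa [show 1 + (σ.card - 1) = σ.card by omega] at this
  choose E hE hEΨ using hlift
  -- For `k, l ≠ r` both coordinates vanish at the focus of `a` and at that of `j r`, the `r`-th
  -- coordinate point; hence camera `j r` mediates the exchange.
  have hexch : ∀ k l r : Fin 3, k ≠ r → l ≠ r →
      S.P a (Pi.single k.castSucc 1) * E l r - S.P a (Pi.single l.castSucc 1) * E k r ∈ S.J := by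
    intro k l r hk hl
    have h3 : ∀ k : Fin 3, (Pi.single k.castSucc 1 : Fin 4 → ℂ) ⬝ᵥ S.f a = 0 := fun k => by
      rw [hfa, dotProduct_single_one, Pi.single_apply, if_neg]
      fin_cases k <;> simp
    have hjr : ∀ k : Fin 3, k ≠ r → (Pi.single k.castSucc 1 : Fin 4 → ℂ) ⬝ᵥ S.f (j r) = 0 :=
      fun k hk => by
        rw [hfj, dotProduct_single_one, Pi.single_apply, if_neg (by simpa using hk.symm)]
    exact S.exchange_mem ha (hj r) hsep' hne hex (h3 k) (h3 l) (hjr k hk) (hjr l hl) (hHhom r)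
      (hHz r) (hE k r) (hE l r) (by rw [hEΨ, lin_single]) (by rw [hEΨ, lin_single])
  have r0 : F' 0 - (E 1 2 - E 2 1) ∈ S.J := hex _
    (sub_mem (hF' 0) (sub_mem (hE _ _) (hE _ _))) (by simp [hEΨ, hH0])
  have r1 : F' 1 - (E 2 0 - E 0 2) ∈ S.J := hex _
    (sub_mem (hF' 1) (sub_mem (hE _ _) (hE _ _))) (by simp [hEΨ, hH1])
  have r2 : F' 2 - (E 0 1 - E 1 0) ∈ S.J := hex _
    (sub_mem (hF' 2) (sub_mem (hE _ _) (hE _ _))) (by simp [hEΨ, hH2])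
  have t0 := S.J.mul_mem_left (S.P a (Pi.single (0 : Fin 3).castSucc 1)) r0
  have t1 := S.J.mul_mem_left (S.P a (Pi.single (1 : Fin 3).castSucc 1)) r1
  have t2 := S.J.mul_mem_left (S.P a (Pi.single (2 : Fin 3).castSucc 1)) r2
  have s0 := hexch 1 2 0 (by decide) (by decide)
  have s1 := hexch 2 0 1 (by decide) (by decide)
  have s2 := hexch 0 1 2 (by decide) (by decide)
  have := add_mem (add_mem (add_mem t0 t1) t2) (add_mem (add_mem s0 s1) s2)
  convert this using 1
  rw [Fin.sum_univ_three]
  ring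

end PointSystem

/-! ### Four cameras with independent foci -/

/-- A choice of one coordinate form for each of four cameras. -/
abbrev Word : Type := Fin 4 × Fin 4 × Fin 4 × Fin 4

namespace Word

/-- No letter equals its position: the coordinate forms vanish at the respective foci. -/
def Valid : Word → Prop
  | (a, b, c, d) => a ≠ 0 ∧ b ≠ 1 ∧ c ≠ 2 ∧ d ≠ 3

instance : DecidablePred Valid := fun (a, b, c, d) => by unfold Valid; infer_instance

/-- The exchange of letters between two positions is permitted. -/
abbrev Exch (i j a b : Fin 4) : Prop := a ≠ i ∧ a ≠ j ∧ b ≠ i ∧ b ≠ j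

/-- In each of these six maps the position named first receives the smaller letter, provided that
the exchange is permitted. The pairs (2, 0) and (3, 1) are therefore sorted towards the later
position. -/
def sort01 : Word → Word
  | (a, b, c, d) => if b < a ∧ Exch 0 1 a b then (b, a, c, d) else (a, b, c, d)

def sort23 : Word → Word
  | (a, b, c, d) => if d < c ∧ Exch 2 3 c d then (a, b, d, c) else (a, b, c, d)

def sort03 : Word → Word
  | (a, b, c, d) => if d < a ∧ Exch 0 3 a d then (d, b, c, a) else (a, b, c, d)

def sort12 : Word → Word
  | (a, b, c, d) => if c < b ∧ Exch 1 2 b c then (a, c, b, d) else (a, b, c, d)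

def sort20 : Word → Word
  | (a, b, c, d) => if a < c ∧ Exch 0 2 a c then (c, b, a, d) else (a, b, c, d)

def sort31 : Word → Word
  | (a, b, c, d) => if b < d ∧ Exch 1 3 b d then (a, d, c, b) else (a, b, c, d)

/-- A network of permitted exchanges that brings words to a normal form. -/
def normalize (x : Word) : Word :=
  sort12 (sort03 (sort23 (sort01 (sort31 (sort20 (sort12 (sort03 (sort23 (sort01 x)))))))))

/-- The letters of a word, counted with multiplicity. -/
def content : Word → Fin 4 →₀ ℕ
  | (a, b, c, d) => Finsupp.single a 1 + Finsupp.single b 1 + Finsupp.single c 1 +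
      Finsupp.single d 1

/-- A numerical code of the content. -/
def code : Word → ℕ
  | (a, b, c, d) => 5 ^ (a : ℕ) + 5 ^ (b : ℕ) + 5 ^ (c : ℕ) + 5 ^ (d : ℕ)

/-- The code depends on the content only. Multiplicities are at most four, so they are the base 5
digits of the code. -/
lemma code_eq (x : Word) : x.code = x.content.sum fun k m => m * 5 ^ (k : ℕ) := by
  obtain ⟨a, b, c, d⟩ := x
  simp only [code, content]
  rw [Finsupp.sum_add_index' (by simp) (by intros; ring),
    Finsupp.sum_add_index' (by simp) (by intros; ring),
    Finsupp.sum_add_index' (by simp) (by intros; ring)]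
  simp

/-- The normal forms of the valid words. -/
def normalForms : List Word :=
  [(1, 0, 0, 0), (1, 0, 0, 1), (1, 0, 1, 1), (1, 0, 3, 2), (1, 2, 0, 0), (1, 2, 0, 1),
    (1, 2, 0, 2), (1, 2, 1, 1), (1, 2, 1, 2), (1, 3, 1, 1), (1, 3, 1, 2), (2, 0, 0, 0),
    (2, 0, 3, 0), (2, 2, 0, 0), (2, 2, 0, 2), (2, 2, 1, 2), (2, 2, 3, 0), (2, 2, 3, 2),
    (2, 3, 1, 2), (2, 3, 3, 0), (2, 3, 3, 2), (3, 0, 0, 0), (3, 0, 0, 1), (3, 0, 1, 1),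
    (3, 0, 3, 0), (3, 0, 3, 1), (3, 3, 1, 1), (3, 3, 1, 2), (3, 3, 3, 0), (3, 3, 3, 1),
    (3, 3, 3, 2)]

/-- The normal form of a valid word is determined by its code. -/
lemma find_normalForms : ∀ a b c d : Fin 4, Valid (a, b, c, d) →
    normalForms.find? (fun y => y.code == code (a, b, c, d)) = some (normalize (a, b, c, d)) := by
  -- A check of the 81 valid words. The 31 normal forms correspond to the quartic monomials in four
  -- variables other than the four fourth powers.
  decide +kernel

/-- The combinatorial heart of the four-camera case: permitted exchanges connect all valid words
with the same letters. -/
lemma normalize_eq {x y : Word} (hx : x.Valid) (hy : y.Valid) (h : x.content = y.content) :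
    x.normalize = y.normalize := by
  obtain ⟨a, b, c, d⟩ := x
  obtain ⟨a', b', c', d'⟩ := y
  rw [← Option.some_inj, ← find_normalForms a b c d hx, ← find_normalForms a' b' c' d' hy,
    code_eq, code_eq, h]

end Word

/-! ### Words as products of coordinate forms, and exactness for coordinate foci. -/

namespace PointSystem

variable {ι R : Type*} [CommRing R] [Algebra ℂ R]

/-- The product of the coordinate forms of a word. -/
def word (S : PointSystem ι R) (κ : Fin 4 → ι) : Word → R
  | (a, b, c, d) => S.P (κ 0) (Pi.single a 1) * S.P (κ 1) (Pi.single b 1) *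
      S.P (κ 2) (Pi.single c 1) * S.P (κ 3) (Pi.single d 1)

lemma coord_dotProduct {S : PointSystem ι R} {κ : Fin 4 → ι}
    (hκ : ∀ k, S.f (κ k) = Pi.single k 1) {a k : Fin 4} (h : a ≠ k) :
    (Pi.single a 1 : Fin 4 → ℂ) ⬝ᵥ S.f (κ k) = 0 := by
  rw [hκ, dotProduct_single_one, Pi.single_apply, if_neg h.symm]

/-- `Word.Exch` says precisely that both coordinate forms vanish at both coordinate points, which is
what `swap` requires. -/
lemma exch_mem {S : PointSystem ι R} {κ : Fin 4 → ι} (hinj : Function.Injective κ)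
    (hκ : ∀ k, S.f (κ k) = Pi.single k 1) {i j a b : Fin 4} (hij : i ≠ j)
    (h : Word.Exch i j a b) :
    S.P (κ i) (Pi.single b 1) * S.P (κ j) (Pi.single a 1) -
      S.P (κ i) (Pi.single a 1) * S.P (κ j) (Pi.single b 1) ∈ S.J :=
  S.swap _ _ (hinj.ne hij) _ _ (coord_dotProduct hκ h.2.2.1) (coord_dotProduct hκ h.2.2.2)
    (coord_dotProduct hκ h.1) (coord_dotProduct hκ h.2.1)

lemma word_normalize {S : PointSystem ι R} {κ : Fin 4 → ι} (hinj : Function.Injective κ)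
    (hκ : ∀ k, S.f (κ k) = Pi.single k 1) (x : Word) :
    Ideal.Quotient.mk S.J (S.word κ x.normalize) = Ideal.Quotient.mk S.J (S.word κ x) := by
  have key : ∀ (i j a b : Fin 4) (r : R) (y z : Word), i ≠ j → Word.Exch i j a b →
      S.word κ y = S.P (κ i) (Pi.single b 1) * S.P (κ j) (Pi.single a 1) * r →
      S.word κ z = S.P (κ i) (Pi.single a 1) * S.P (κ j) (Pi.single b 1) * r →
      Ideal.Quotient.mk S.J (S.word κ y) = Ideal.Quotient.mk S.J (S.word κ z) := by
    intro i j a b r y z hij h hy hz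
    rw [Ideal.Quotient.eq, hy, hz, ← sub_mul]
    exact Ideal.mul_mem_right _ _ (exch_mem hinj hκ hij h)
  have h01 : ∀ x, Ideal.Quotient.mk S.J (S.word κ (Word.sort01 x)) =
      Ideal.Quotient.mk S.J (S.word κ x) := by
    rintro ⟨a, b, c, d⟩
    unfold Word.sort01
    dsimp only
    split_ifs with h
    · exact key 0 1 a b (S.P (κ 2) (Pi.single c 1) * S.P (κ 3) (Pi.single d 1)) _ _ (by decide)
        h.2 (by simp only [word]; ring) (by simp only [word]; ring)
    · rfl
  have h23 : ∀ x, Ideal.Quotient.mk S.J (S.word κ (Word.sort23 x)) =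
      Ideal.Quotient.mk S.J (S.word κ x) := by
    rintro ⟨a, b, c, d⟩
    unfold Word.sort23
    dsimp only
    split_ifs with h
    · exact key 2 3 c d (S.P (κ 0) (Pi.single a 1) * S.P (κ 1) (Pi.single b 1)) _ _ (by decide)
        h.2 (by simp only [word]; ring) (by simp only [word]; ring)
    · rfl
  have h03 : ∀ x, Ideal.Quotient.mk S.J (S.word κ (Word.sort03 x)) =
      Ideal.Quotient.mk S.J (S.word κ x) := by
    rintro ⟨a, b, c, d⟩
    unfold Word.sort03
    dsimp only
    split_ifs with h
    · exact key 0 3 a d (S.P (κ 1) (Pi.single b 1) * S.P (κ 2) (Pi.single c 1)) _ _ (by decide)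
        h.2 (by simp only [word]; ring) (by simp only [word]; ring)
    · rfl
  have h12 : ∀ x, Ideal.Quotient.mk S.J (S.word κ (Word.sort12 x)) =
      Ideal.Quotient.mk S.J (S.word κ x) := by
    rintro ⟨a, b, c, d⟩
    unfold Word.sort12
    dsimp only
    split_ifs with h
    · exact key 1 2 b c (S.P (κ 0) (Pi.single a 1) * S.P (κ 3) (Pi.single d 1)) _ _ (by decide)
        h.2 (by simp only [word]; ring) (by simp only [word]; ring)
    · rfl
  have h20 : ∀ x, Ideal.Quotient.mk S.J (S.word κ (Word.sort20 x)) =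
      Ideal.Quotient.mk S.J (S.word κ x) := by
    rintro ⟨a, b, c, d⟩
    unfold Word.sort20
    dsimp only
    split_ifs with h
    · exact key 0 2 a c (S.P (κ 1) (Pi.single b 1) * S.P (κ 3) (Pi.single d 1)) _ _ (by decide)
        h.2 (by simp only [word]; ring) (by simp only [word]; ring)
    · rfl
  have h31 : ∀ x, Ideal.Quotient.mk S.J (S.word κ (Word.sort31 x)) =
      Ideal.Quotient.mk S.J (S.word κ x) := by
    rintro ⟨a, b, c, d⟩
    unfold Word.sort31
    dsimp only
    split_ifs with h
    · exact key 1 3 b d (S.P (κ 0) (Pi.single a 1) * S.P (κ 2) (Pi.single c 1)) _ _ (by decide)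
        h.2 (by simp only [word]; ring) (by simp only [word]; ring)
    · rfl
  simp only [Word.normalize, h01, h23, h03, h12, h20, h31]

lemma Ψ_word {S : PointSystem ι R} {κ : Fin 4 → ι} (hκ : ∀ k, S.f (κ k) = Pi.single k 1)
    {x : Word} (hx : x.Valid) : S.Ψ (S.word κ x) = monomial x.content 1 := by
  obtain ⟨a, b, c, d⟩ := x
  obtain ⟨ha, hb, hc, hd⟩ := hx
  simp only [word, Word.content, map_mul, S.Ψ_P _ _ (coord_dotProduct hκ ha),
    S.Ψ_P _ _ (coord_dotProduct hκ hb), S.Ψ_P _ _ (coord_dotProduct hκ hc),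
    S.Ψ_P _ _ (coord_dotProduct hκ hd), lin_single, X, monomial_mul, mul_one]

lemma eq_sum_single {S : PointSystem ι R} {κ : Fin 4 → ι} {k : Fin 4}
    (hκ : S.f (κ k) = Pi.single k 1) {w : Fin 4 → ℂ} (hw : w ⬝ᵥ S.f (κ k) = 0) :
    S.P (κ k) w = ∑ a ∈ Finset.univ.erase k, w a • S.P (κ k) (Pi.single a 1) := by
  rw [hκ, dotProduct_single_one] at hw
  have : w = ∑ a ∈ Finset.univ.erase k, w a • (Pi.single a 1 : Fin 4 → ℂ) := by
    ext b
    by_cases hb : b = k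
    · subst hb
      rw [hw, Finset.sum_apply]
      refine (Finset.sum_eq_zero fun a ha => ?_).symm
      simp [(Finset.ne_of_mem_erase ha).symm]
    · rw [Finset.sum_apply, Finset.sum_eq_single b]
      · simp
      · intro c _ hc; simp [hc.symm]
      · intro h; simp [hb] at h
  conv_lhs => rw [this, map_sum]
  simp only [map_smul]

lemma ML_le_span_word [DecidableEq ι] {S : PointSystem ι R} {κ : Fin 4 → ι}
    (hinj : Function.Injective κ) (hκ : ∀ k, S.f (κ k) = Pi.single k 1) :
    S.ML (Finset.univ.image κ) ≤ Submodule.span ℂ {y | ∃ x : Word, x.Valid ∧ y = S.word κ x} := by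
  refine Submodule.span_le.2 ?_
  rintro _ ⟨w, hw, rfl⟩
  have hw' : ∀ k, w (κ k) ⬝ᵥ S.f (κ k) = 0 := fun k => hw _ (Finset.mem_image_of_mem _ (by simp))
  rw [Finset.prod_image (fun _ _ _ _ h => hinj h), Fin.prod_univ_four,
    eq_sum_single (hκ 0) (hw' 0), eq_sum_single (hκ 1) (hw' 1), eq_sum_single (hκ 2) (hw' 2),
    eq_sum_single (hκ 3) (hw' 3)]
  simp only [Finset.sum_mul, Finset.mul_sum]
  refine Submodule.sum_mem _ fun d hd => Submodule.sum_mem _ fun c hc =>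
    Submodule.sum_mem _ fun b hb => Submodule.sum_mem _ fun a ha => ?_
  simp only [smul_mul_assoc, mul_smul_comm]
  refine Submodule.smul_mem _ _ (Submodule.smul_mem _ _ (Submodule.smul_mem _ _
    (Submodule.smul_mem _ _ (Submodule.subset_span ⟨(a, b, c, d), ?_, rfl⟩))))
  exact ⟨Finset.ne_of_mem_erase ‹_›, Finset.ne_of_mem_erase ‹_›, Finset.ne_of_mem_erase ‹_›,
    Finset.ne_of_mem_erase ‹_›⟩

/-- Send a monomial to the class modulo `J` of any valid word with that content. The class is
independent of the choice by the normal forms, so this linear map composed with `Ψ` is the quotient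
map on multilinear elements; an element killed by `Ψ` therefore has class zero. -/
theorem exact_of_coordinate_foci [DecidableEq ι] {S : PointSystem ι R} {κ : Fin 4 → ι}
    (hinj : Function.Injective κ) (hκ : ∀ k, S.f (κ k) = Pi.single k 1) :
    S.Exact (Finset.univ.image κ) := by
  classical
  let W : (Fin 4 →₀ ℕ) → R ⧸ S.J := fun μ =>
    if h : ∃ x : Word, x.Valid ∧ x.content = μ then Ideal.Quotient.mk S.J (S.word κ h.choose) else 0
  let Λ : MvPolynomial (Fin 4) ℂ →ₗ[ℂ] R ⧸ S.J := (basisMonomials (Fin 4) ℂ).constr ℂ W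
  have hΛ : ∀ F ∈ S.ML (Finset.univ.image κ), Λ (S.Ψ F) = Ideal.Quotient.mk S.J F := by
    intro F hF
    replace hF := ML_le_span_word hinj hκ hF
    induction hF using Submodule.span_induction with
    | mem y hy =>
      obtain ⟨x, hx, rfl⟩ := hy
      have hex : ∃ y : Word, y.Valid ∧ y.content = x.content := ⟨x, hx, rfl⟩
      have h1 : Λ (monomial x.content 1) = W x.content := by
        have := (basisMonomials (Fin 4) ℂ).constr_basis ℂ W x.content
        rwa [coe_basisMonomials] at this
      rw [Ψ_word hκ hx, h1]
      change dite _ _ _ = _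
      rw [dif_pos hex, ← word_normalize hinj hκ, ← word_normalize hinj hκ x,
        Word.normalize_eq hex.choose_spec.1 hx hex.choose_spec.2]
    | zero => simp
    | add x y _ _ hx hy => rw [map_add, map_add, map_add, hx, hy]
    | smul c x _ hx => rw [map_smul, map_smul, hx]; rfl
  intro F hF h0
  rw [← Ideal.Quotient.eq_zero_iff_mem, ← hΛ F hF, h0, map_zero]

end PointSystem

/-! ### Exactness from four independent foci. -/

namespace PointSystem

variable {ι R : Type*} [CommRing R] [Algebra ℂ R]

/-- The matrix whose columns are the foci of four cameras. -/
def fociMatrix (S : PointSystem ι R) (κ : Fin 4 → ι) : Matrix (Fin 4) (Fin 4) ℂ :=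
  Matrix.of fun r k => S.f (κ k) r

/-- Coordinates in which four independent foci are the coordinate points. -/
lemma exists_change (S : PointSystem ι R) {κ : Fin 4 → ι} (h : (S.fociMatrix κ).det ≠ 0) :
    ∃ (G H : Matrix (Fin 4) (Fin 4) ℂ) (hGH : G * H = 1),
      ∀ k, (S.change G H hGH).f (κ k) = Pi.single k 1 := by
  have hu : IsUnit (S.fociMatrix κ).det := isUnit_iff_ne_zero.2 h
  refine ⟨(S.fociMatrix κ)⁻¹, S.fociMatrix κ, nonsing_inv_mul _ hu, fun k => ?_⟩
  change (S.fociMatrix κ)⁻¹ *ᵥ S.f (κ k) = _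
  have : S.f (κ k) = S.fociMatrix κ *ᵥ Pi.single k 1 := by
    ext r; simp [fociMatrix]
  rw [this, mulVec_mulVec, nonsing_inv_mul _ hu, one_mulVec]

lemma injective_of_det_ne_zero {S : PointSystem ι R} {κ : Fin 4 → ι}
    (h : (S.fociMatrix κ).det ≠ 0) : Function.Injective κ := by
  intro k l hkl
  by_contra hne
  exact h (det_zero_of_column_eq hne fun r => by simp [fociMatrix, hkl])

lemma exact_image [DecidableEq ι] {S : PointSystem ι R} {κ : Fin 4 → ι} (h : (S.fociMatrix κ).det ≠ 0) :
    S.Exact (Finset.univ.image κ) := by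
  obtain ⟨G, H, hGH, hf⟩ := S.exists_change h
  exact (exact_of_coordinate_foci (S := S.change G H hGH) (injective_of_det_ne_zero h) hf).of_change

/-- Exchange of a basis vector: a further focus completes three of four independent foci. -/
lemma exists_foci_exchange {S : PointSystem ι R} {κ : Fin 4 → ι}
    (h : (S.fociMatrix κ).det ≠ 0) {a : ι} (ha : S.f a ≠ 0) :
    ∃ κ' : Fin 4 → ι, (S.fociMatrix κ').det ≠ 0 ∧ κ' 3 = a ∧
      ∀ k : Fin 3, ∃ l, κ' k.castSucc = κ l := by
  obtain ⟨m, hm⟩ : ∃ m, cramer (S.fociMatrix κ) (S.f a) m ≠ 0 := by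
    by_contra hcon
    push Not at hcon
    have h1 := mulVec_cramer (S.fociMatrix κ) (S.f a)
    rw [show cramer (S.fociMatrix κ) (S.f a) = 0 from funext hcon, mulVec_zero] at h1
    exact (smul_ne_zero h ha) h1.symm
  rw [cramer_apply] at hm
  refine ⟨fun k => Function.update κ m a (Equiv.swap m 3 k), ?_, by simp, fun k => ?_⟩
  · have : S.fociMatrix (fun k => Function.update κ m a (Equiv.swap m 3 k)) =
        ((S.fociMatrix κ).updateCol m (S.f a)).submatrix id (Equiv.swap m 3) := by
      ext r k
      simp only [fociMatrix, of_apply, submatrix_apply, id, updateCol_apply,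
        Function.update_apply]
      split_ifs <;> rfl
    rw [this, det_permute']
    exact mul_ne_zero (by exact_mod_cast (Equiv.Perm.sign _).ne_zero) hm
  · refine ⟨Equiv.swap m 3 k.castSucc, Function.update_of_ne ?_ _ _⟩
    rw [Ne, Equiv.swap_apply_eq_iff, Equiv.swap_apply_left]
    fin_cases k <;> simp

/-- If four of the foci are independent, then the multilinear relations are generated by the
two-view relations. -/
theorem exact_of_det_ne_zero [DecidableEq ι] {S : PointSystem ι R} {κ : Fin 4 → ι}
    (h : (S.fociMatrix κ).det ≠ 0) {σ : Finset ι} (hκ : ∀ k, κ k ∈ σ) (hsep : S.Sep σ) :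
    S.Exact σ := by
  obtain ⟨τ, rfl⟩ : ∃ τ, σ = Finset.univ.image κ ∪ τ := ⟨σ, by
    rw [eq_comm, Finset.union_eq_right]
    intro i hi
    obtain ⟨k, -, rfl⟩ := Finset.mem_image.1 hi
    exact hκ k⟩
  clear hκ
  induction τ using Finset.induction_on with
  | empty => rw [Finset.union_empty]; exact exact_image h
  | insert a τ _ ih =>
    rw [Finset.union_insert] at hsep ⊢
    set ρ := Finset.univ.image κ ∪ τ with hρ
    have ih' := ih (hsep.mono (Finset.subset_insert _ _))
    by_cases ha : a ∈ ρ
    · rwa [Finset.insert_eq_of_mem ha]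
    have hκρ : ∀ k, κ k ∈ ρ := fun k =>
      Finset.mem_union_left _ (Finset.mem_image_of_mem _ (Finset.mem_univ _))
    have hfa : S.f a ≠ 0 := fun h0 => by
      obtain ⟨w, -, hw⟩ := hsep a (Finset.mem_insert_self _ _) (κ 0)
        (Finset.mem_insert_of_mem (hκρ 0)) (fun h => ha (h ▸ hκρ 0))
      exact hw (by rw [h0, dotProduct_zero])
    -- The new camera must itself be one of the four coordinate cameras, and the other three must
    -- stay among the old ones.
    obtain ⟨κ', hdet, h3, hκ'⟩ := exists_foci_exchange h hfa
    obtain ⟨G, H, hGH, hf⟩ := S.exists_change hdet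
    refine Exact.of_change (hGH := hGH) (Exact.insert_of_normalized ha (hsep.change hGH)
      (ih'.change hGH) (by rw [← h3, hf]) (j := fun k => κ' k.castSucc) (fun k => ?_)
      fun k => hf _)
    obtain ⟨l, hl⟩ := hκ' k
    rw [hl]
    exact hκρ l

end PointSystem

/-! ### Independence of standard monomials -/

section Standard

variable {ι : Type*}

/-- The largest index `k` such that the variable `(i, k)` divides the monomial `m`. -/
def top (m : ι × Fin 3 →₀ ℕ) (i : ι) : ℕ :=
  -- The value is also 0 when no variable of camera `i` occurs, so multiplying by a variable `(i,
  -- 0)` never changes it.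
  Finset.univ.sup fun k : Fin 3 => if m (i, k) ≠ 0 then (k : ℕ) else 0

lemma le_top {m : ι × Fin 3 →₀ ℕ} {i : ι} {k : Fin 3} (h : m (i, k) ≠ 0) : (k : ℕ) ≤ top m i := by
  have := Finset.le_sup (f := fun k : Fin 3 => if m (i, k) ≠ 0 then (k : ℕ) else 0)
    (Finset.mem_univ k)
  rwa [if_pos h] at this

lemma top_le {m : ι × Fin 3 →₀ ℕ} {i : ι} {c : ℕ} (h : ∀ k, m (i, k) ≠ 0 → (k : ℕ) ≤ c) :
    top m i ≤ c := by
  refine Finset.sup_le fun k _ => ?_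
  split_ifs with hk
  · exact h k hk
  · exact Nat.zero_le _

lemma top_mono {m m' : ι × Fin 3 →₀ ℕ} (h : m ≤ m') (i : ι) : top m i ≤ top m' i :=
  top_le fun k hk => le_top (by have := h (i, k); omega)

lemma top_lt_three (m : ι × Fin 3 →₀ ℕ) (i : ι) : top m i < 3 := by
  have : top m i ≤ 2 := top_le fun k _ => by omega
  omega

lemma top_ne_zero {m : ι × Fin 3 →₀ ℕ} {i : ι} (h : top m i ≠ 0) :
    m (i, ⟨top m i, top_lt_three m i⟩) ≠ 0 := by
  intro h0
  have : top m i ≤ top m i - 1 := top_le fun k hk => by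
    have h1 := le_top hk
    have h2 : (k : ℕ) ≠ top m i := fun h2 => hk (by
      rwa [show k = ⟨top m i, top_lt_three m i⟩ from Fin.ext h2])
    omega
  omega

/-- The multidegree of a monomial. -/
def mdeg (m : ι × Fin 3 →₀ ℕ) (i : ι) : ℕ := ∑ k, m (i, k)

variable [Fintype ι]

/-- The linear forms `L i 0, L i 1, L i 2` are in general position: for every `c` of total weight
four, the forms `L i k` with `k < c i` have no common zero. -/
def InGeneralPosition (L : ι → Fin 3 → Fin 4 → ℂ) : Prop :=
  ∀ c : ι → ℕ, (∀ i, c i ≤ 3) → ∑ i, c i = 4 →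
    ∀ u, (∀ j (l : Fin 3), (l : ℕ) < c j → L j l ⬝ᵥ u = 0) → u = 0

lemma exists_between_sum_eq {s b : ι → ℕ} (hsb : s ≤ b) {N : ℕ} (h1 : ∑ i, s i ≤ N)
    (h2 : N ≤ ∑ i, b i) : ∃ c, s ≤ c ∧ c ≤ b ∧ ∑ i, c i = N := by
  classical
  induction N, h1 using Nat.le_induction with
  | base => exact ⟨s, le_rfl, hsb, rfl⟩
  | succ N _ ih =>
    obtain ⟨c, hsc, hcb, hc⟩ := ih (by omega)
    obtain ⟨i, hi⟩ : ∃ i, c i < b i := by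
      by_contra hcon
      push Not at hcon
      have := Finset.sum_le_sum fun i (_ : i ∈ Finset.univ) => hcon i
      omega
    refine ⟨c + Pi.single i 1, hsc.trans (by simp), fun j => ?_, ?_⟩
    · by_cases hj : j = i
      · subst hj; simpa using hi
      · simpa [hj] using hcb j
    · simp [Finset.sum_add_distrib, hc]

lemma card_staircase {c : ι → ℕ} (hc : ∀ i, c i ≤ 3) :
    Fintype.card {x : ι × Fin 3 // (x.2 : ℕ) < c x.1} = ∑ i, c i := by
  rw [Fintype.card_subtype, Finset.card_filter, Fintype.sum_prod_type]
  refine Finset.sum_congr rfl fun i _ => ?_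
  have := hc i
  change (∑ k : Fin 3, if (k : ℕ) < c i then 1 else 0) = c i
  generalize c i = a at this
  revert a
  decide

/-- In general position, the forms selected by a staircase of weight four are coordinates. -/
lemma InGeneralPosition.exists_dual {L : ι → Fin 3 → Fin 4 → ℂ} (hL : InGeneralPosition L)
    {c : ι → ℕ} (hc : ∀ i, c i ≤ 3) (hsum : ∑ i, c i = 4) :
    ∃ u : ι → Fin 3 → Fin 4 → ℂ,
      (∀ i (k : Fin 3), (k : ℕ) < c i → L i k ⬝ᵥ u i k = 1) ∧
      (∀ i (k : Fin 3), (k : ℕ) < c i → ∀ j (l : Fin 3), (l : ℕ) < c j → (j, l) ≠ (i, k) → L j l ⬝ᵥ u i k = 0) ∧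
      ∀ w q : Fin 4 → ℂ, w ⬝ᵥ q =
        ∑ i, ∑ k : Fin 3, if (k : ℕ) < c i then (w ⬝ᵥ u i k) * (L i k ⬝ᵥ q) else 0 := by
  classical
  let T : (Fin 4 → ℂ) →ₗ[ℂ] ({x : ι × Fin 3 // (x.2 : ℕ) < c x.1} → ℂ) :=
    (Matrix.of fun x k => L x.1.1 x.1.2 k).mulVecLin
  have hT : ∀ q x, T q x = L x.1.1 x.1.2 ⬝ᵥ q := fun q x => rfl
  have hinj : Function.Injective T := by
    rw [← LinearMap.ker_eq_bot, LinearMap.ker_eq_bot']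
    intro q hq
    refine hL c hc hsum q fun j l hl => ?_
    have := congrFun hq ⟨(j, l), hl⟩
    rwa [hT] at this
  have hsurj : Function.Surjective T :=
    (LinearMap.injective_iff_surjective_of_finrank_eq_finrank (by
      rw [Module.finrank_fin_fun, Module.finrank_fintype_fun_eq_card, card_staircase hc,
        hsum])).1 hinj
  choose v hv using fun x => hsurj (Pi.single x 1)
  refine ⟨fun i k => if h : (k : ℕ) < c i then v ⟨(i, k), h⟩ else 0, fun i k h => ?_,
    fun i k h j l hl hne => ?_, fun w q => ?_⟩
  · have := congrFun (hv ⟨(i, k), h⟩) ⟨(i, k), h⟩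
    rw [hT] at this
    simpa [h] using this
  · have := congrFun (hv ⟨(i, k), h⟩) ⟨(j, l), hl⟩
    rw [hT, Pi.single_apply, if_neg (by simpa using hne)] at this
    simpa [h] using this
  · have hq : q = ∑ x : {x : ι × Fin 3 // (x.2 : ℕ) < c x.1}, (T q x) • v x := hinj (by
      rw [map_sum]
      simp only [map_smul, hv]
      ext x
      simp [Finset.sum_apply, Pi.single_apply])
    conv_lhs => rw [hq]
    rw [← Fintype.sum_prod_type' (f := fun i (k : Fin 3) => if (k : ℕ) < c i then
      (w ⬝ᵥ (if h : (k : ℕ) < c i then v ⟨(i, k), h⟩ else 0)) * (L i k ⬝ᵥ q) else 0),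
      ← Finset.sum_filter, dotProduct_sum,
      Finset.sum_subtype (p := fun x : ι × Fin 3 => (x.2 : ℕ) < c x.1) _ (by simp)]
    refine Finset.sum_congr rfl fun x _ => ?_
    rw [dotProduct_smul, hT, smul_eq_mul, mul_comm]
    simp [x.2]

/-- Add the cell `(i, k)` to the staircase `s`, enlarge to weight four, and take the dual basis
vector of that cell. Two cameras are needed, since one camera has only three cells. -/
lemma InGeneralPosition.exists_ne_zero {L : ι → Fin 3 → Fin 4 → ℂ} (hL : InGeneralPosition L)
    (hι : 2 ≤ Fintype.card ι) {s : ι → ℕ} (hs : ∑ i, s i ≤ 3) {i : ι} {k : Fin 3}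
    (hk : (k : ℕ) = s i) :
    ∃ u, (∀ j (l : Fin 3), (l : ℕ) < s j → L j l ⬝ᵥ u = 0) ∧ L i k ⬝ᵥ u ≠ 0 := by
  classical
  have hs3 : ∀ j, s j ≤ 3 := fun j =>
    (Finset.single_le_sum (f := s) (fun _ _ => Nat.zero_le _) (Finset.mem_univ j)).trans hs
  obtain ⟨c, h1, h2, h3⟩ := exists_between_sum_eq (s := s + Pi.single i 1) (b := fun _ => 3)
    (N := 4) (fun j => by
      by_cases hj : j = i
      · subst hj; simp; omega
      · simpa [hj] using hs3 j)
    (by simp [Finset.sum_add_distrib]; omega) (by simp; omega)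
  obtain ⟨u, hu1, hu2, -⟩ := hL.exists_dual h2 h3
  have hki : (k : ℕ) < c i := by have := h1 i; simp at this; omega
  refine ⟨u i k, fun j l hl => hu2 i k hki j l ?_ ?_, by rw [hu1 i k hki]; exact one_ne_zero⟩
  · have := h1 j; simp at this; omega
  · rintro h
    obtain ⟨rfl, rfl⟩ := Prod.mk.inj h
    omega

/-- The cut-off `s` defines a linear subspace of world points and removes the variables that vanish
on it. For the lowest remaining variable `x` of a camera of positive degree, write p = X x * g + r
with `r` free of `x`. Where the form of `x` vanishes, `p` restricts to `r`, so `r = 0` by induction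
with the cut-off raised. Then `g` vanishes where that form is nonzero, and by continuity on the
whole subspace, so `g = 0` by induction on the degree. The bound 3 on the indices keeps the form of
`x` from vanishing identically on the subspace. -/
theorem eq_zero_of_standard {L : ι → Fin 3 → Fin 4 → ℂ} (hL : InGeneralPosition L)
    (hι : 2 ≤ Fintype.card ι) (N : ℕ) (s d : ι → ℕ) (hN : ∑ i, d i + ∑ i, (3 - s i) < N)
    (p : MvPolynomial (ι × Fin 3) ℂ)
    (hd : ∀ m ∈ p.support, mdeg m = d)
    (hs : ∀ m ∈ p.support, ∀ i k, m (i, k) ≠ 0 → s i ≤ (k : ℕ))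
    (hst : ∀ m ∈ p.support, ∑ i, max (top m i) (s i) ≤ 3)
    (h0 : ∀ q, (∀ j (l : Fin 3), (l : ℕ) < s j → L j l ⬝ᵥ q = 0) →
      eval (fun x => L x.1 x.2 ⬝ᵥ q) p = 0) : p = 0 := by
  classical
  induction N generalizing s d p with
  | zero => exact absurd hN (Nat.not_lt_zero _)
  | succ N ih =>
    by_contra hp
    obtain ⟨m₀, hm₀⟩ := (support_nonempty).2 hp
    have hs3 : ∑ i, s i ≤ 3 := le_trans (Finset.sum_le_sum fun i _ => le_max_right _ _) (hst m₀ hm₀)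
    by_cases hd0 : d = 0
    · have hm : ∀ m ∈ p.support, m = 0 := fun m hm => by
        have := hd m hm
        rw [hd0] at this
        ext ⟨i, k⟩
        have h1 := congrFun this i
        exact (Finset.sum_eq_zero_iff.1 h1) k (Finset.mem_univ _)
      have hC : p = C (coeff 0 p) := by
        ext m
        rw [coeff_C]
        split_ifs with h
        · rw [h]
        · by_contra hne
          exact h (hm m (mem_support_iff.2 hne)).symm
      have := h0 0 (by simp)
      rw [hC, eval_C] at this
      exact hp (by rw [hC, this, C_0])
    obtain ⟨i, hi⟩ := Function.ne_iff.1 hd0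
    have hex : ∀ m ∈ p.support, ∃ k, m (i, k) ≠ 0 := fun m hm => by
      by_contra hcon
      push Not at hcon
      have := congrFun (hd m hm) i
      rw [mdeg, Finset.sum_eq_zero fun k _ => hcon k] at this
      exact hi this.symm
    obtain ⟨k', hk'⟩ := hex m₀ hm₀
    have hsi : s i < 3 := lt_of_le_of_lt (hs m₀ hm₀ i k' hk') k'.2
    set x : ι × Fin 3 := (i, ⟨s i, hsi⟩) with hx
    set g := p.divMonomial (Finsupp.single x 1) with hg
    set r := p.modMonomial (Finsupp.single x 1) with hr
    have hpgr : X x * g + r = p := divMonomial_add_modMonomial_single p x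
    have hrsupp : ∀ m ∈ r.support, m ∈ p.support ∧ m x = 0 := fun m hm => by
      rw [mem_support_iff] at hm
      have hle : ¬ Finsupp.single x 1 ≤ m := fun hle => hm (coeff_modMonomial_of_le _ hle)
      rw [hr, coeff_modMonomial_of_not_le _ hle] at hm
      refine ⟨mem_support_iff.2 hm, ?_⟩
      rw [Finsupp.single_le_iff] at hle
      omega
    have hr0 : r = 0 := by
      have hrk : ∀ m ∈ r.support, ∀ k, m (i, k) ≠ 0 → s i + 1 ≤ k := fun m hm k hk => by
        have h1 := hs m (hrsupp m hm).1 i k hk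
        have h2 : (k : ℕ) ≠ s i := fun h => hk (by
          rw [← (hrsupp m hm).2, hx]; congr 2; exact Fin.ext h)
        omega
      refine ih (Function.update s i (s i + 1)) d ?_ r (fun m hm => hd m (hrsupp m hm).1)
        (fun m hm j k hk => ?_) (fun m hm => ?_) fun q hq => ?_
      · have : ∑ j, (3 - Function.update s i (s i + 1) j) < ∑ j, (3 - s j) := by
          refine Finset.sum_lt_sum (fun j _ => ?_) ⟨i, Finset.mem_univ _, ?_⟩
          · by_cases hj : j = i
            · subst hj; simp; omega
            · simp [hj]
          · simp; omega
        omega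
      · by_cases hj : j = i
        · subst hj; simpa using hrk m hm k hk
        · simpa [hj] using hs m (hrsupp m hm).1 j k hk
      -- Each monomial of `r` contains a variable of camera `i` with index above `s i`, so raising
      -- the cut-off leaves the maximum unchanged.
      · refine le_trans (le_of_eq (Finset.sum_congr rfl fun j _ => ?_)) (hst m (hrsupp m hm).1)
        by_cases hj : j = i
        · subst hj
          obtain ⟨k, hk⟩ := hex m (hrsupp m hm).1
          have h1 := hrk m hm k hk
          have h2 := le_top hk
          simp; omega
        · simp [hj]
      · have h1 := h0 q fun j l hl => hq j l (by
          by_cases hj : j = i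
          · subst hj; simp; omega
          · simpa [hj] using hl)
        have h2 : L i ⟨s i, hsi⟩ ⬝ᵥ q = 0 := hq i ⟨s i, hsi⟩ (by simp)
        rw [← hpgr, map_add, map_mul, eval_X, h2, zero_mul, zero_add] at h1
        exact h1
    rw [hr0, add_zero] at hpgr
    have hgsupp : ∀ m ∈ g.support, Finsupp.single x 1 + m ∈ p.support := fun m hm => by
      rw [mem_support_iff] at hm ⊢
      rwa [hg, coeff_divMonomial] at hm
    have hg0 : g = 0 := by
      refine ih s (Function.update d i (d i - 1)) ?_ g (fun m hm => ?_) (fun m hm j k hk => ?_)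
        (fun m hm => ?_) fun q hq => ?_
      · have : ∑ j, Function.update d i (d i - 1) j < ∑ j, d j := by
          refine Finset.sum_lt_sum (fun j _ => ?_) ⟨i, Finset.mem_univ _, ?_⟩
          · by_cases hj : j = i
            · subst hj; simp
            · simp [hj]
          · have : d i ≠ 0 := hi
            simp; omega
        omega
      · have h1 := hd _ (hgsupp m hm)
        ext j
        have h2 := congrFun h1 j
        simp only [mdeg, Finsupp.add_apply, Finset.sum_add_distrib] at h2 ⊢
        by_cases hj : j = i
        · subst hj
          have : ∑ k, (Finsupp.single x 1 : ι × Fin 3 →₀ ℕ) (j, k) = 1 := by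
            rw [Finset.sum_eq_single ⟨s j, hsi⟩]
            · rw [hx]; simp
            · intro k _ hk
              rw [hx, Finsupp.single_apply, if_neg]
              rintro h
              exact hk (Prod.mk.inj h).2.symm
            · simp
          simp; omega
        · have : ∑ k, (Finsupp.single x 1 : ι × Fin 3 →₀ ℕ) (j, k) = 0 := by
            refine Finset.sum_eq_zero fun k _ => ?_
            rw [hx, Finsupp.single_apply, if_neg]
            rintro h
            exact hj (Prod.mk.inj h).1.symm
          simp [hj]; omega
      · refine hs _ (hgsupp m hm) j k ?_
        rw [Finsupp.add_apply]; omega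
      · refine le_trans (Finset.sum_le_sum fun j _ => ?_) (hst _ (hgsupp m hm))
        exact max_le_max (top_mono (by simp) j) le_rfl
      · obtain ⟨u, hu, hu'⟩ := hL.exists_ne_zero hι hs3 (i := i) (k := ⟨s i, hsi⟩) rfl
        have hcont : Continuous fun t : ℂ => eval (fun y => L y.1 y.2 ⬝ᵥ (q + t • u)) g := by
          refine (MvPolynomial.continuous_eval g).comp (continuous_pi fun y => ?_)
          simp only [dotProduct_add, dotProduct_smul, smul_eq_mul]
          fun_prop
        have hz : ∀ t : ℂ, t ≠ 0 → L i ⟨s i, hsi⟩ ⬝ᵥ q = 0 →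
            eval (fun y => L y.1 y.2 ⬝ᵥ (q + t • u)) g = 0 := fun t ht hq0 => by
          have h1 := h0 (q + t • u) fun j l hl => by
            rw [dotProduct_add, dotProduct_smul, hq j l hl, hu j l hl, smul_zero, add_zero]
          rw [← hpgr, map_mul, eval_X, mul_eq_zero] at h1
          refine h1.resolve_left ?_
          simp only [hx, dotProduct_add, dotProduct_smul, hq0, zero_add, smul_eq_mul]
          exact mul_ne_zero ht hu'
        by_cases hq0 : L i ⟨s i, hsi⟩ ⬝ᵥ q = 0
        · have := Continuous.ext_on (dense_compl_singleton (0 : ℂ)) hcont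
            (continuous_const (y := (0 : ℂ))) fun t ht => hz t ht hq0
          have := congrFun this 0
          simpa using this
        · have h1 := h0 q hq
          rw [← hpgr, map_mul, eval_X, mul_eq_zero] at h1
          exact h1.resolve_left hq0
    exact hp (by rw [← hpgr, hg0, mul_zero])

end Standard

/-! ### Separation by multidegree, and expansion of determinants. -/

section Standard

variable {ι : Type*} [Fintype ι]

/-- Standard monomials: the indices of the leading variables add up to at most three. -/
def IsStandard (m : ι × Fin 3 →₀ ℕ) : Prop := ∑ i, top m i ≤ 3

lemma eval_scaled_monomial (L : ι → Fin 3 → Fin 4 → ℂ) (t : ι → ℂ) (q : Fin 4 → ℂ)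
    (m : ι × Fin 3 →₀ ℕ) :
    ∏ x, (t x.1 * (L x.1 x.2 ⬝ᵥ q)) ^ m x =
      (∏ i, t i ^ mdeg m i) * ∏ x, (L x.1 x.2 ⬝ᵥ q) ^ m x := by
  simp only [mul_pow, Finset.prod_mul_distrib]
  congr 1
  rw [Fintype.prod_prod_type]
  simp [mdeg, Finset.prod_pow_eq_pow_sum]

/-- The independent scalings separate the multihomogeneous components, and each component falls
under `eq_zero_of_standard` with cut-off zero. -/
lemma eq_zero_of_isStandard {L : ι → Fin 3 → Fin 4 → ℂ} (hL : InGeneralPosition L)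
    (hι : 2 ≤ Fintype.card ι) {g : MvPolynomial (ι × Fin 3) ℂ}
    (hst : ∀ m ∈ g.support, IsStandard m)
    (h0 : ∀ (t : ι → ℂ) (q : Fin 4 → ℂ), eval (fun x => t x.1 * (L x.1 x.2 ⬝ᵥ q)) g = 0) :
    g = 0 := by
  classical
  have hcomp : ∀ d : ι → ℕ, ∑ m ∈ g.support with mdeg m = d, monomial m (coeff m g) = 0 := by
    intro d
    have hsupp : ∀ m ∈ (∑ m ∈ g.support with mdeg m = d, monomial m (coeff m g)).support,
        m ∈ g.support ∧ mdeg m = d := fun m hm => by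
      rw [mem_support_iff, coeff_sum] at hm
      obtain ⟨m', hm', hne⟩ := Finset.exists_ne_zero_of_sum_ne_zero hm
      rw [coeff_monomial] at hne
      split_ifs at hne with h
      · subst h; exact Finset.mem_filter.1 hm'
      · exact absurd rfl hne
    refine eq_zero_of_standard hL hι _ 0 d (Nat.lt_succ_self _) _ (fun m hm => (hsupp m hm).2)
      (fun m hm i k _ => Nat.zero_le _) (fun m hm => ?_) fun q _ => ?_
    · simpa [IsStandard] using hst m (hsupp m hm).1
    -- For fixed `q`, the evaluation is read as a polynomial in the scalings `t`; its coefficient at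
    -- `d` is the value at `q` of the component of multidegree `d`.
    · let H : MvPolynomial ι ℂ := ∑ m ∈ g.support, monomial (Finsupp.equivFunOnFinite.symm (mdeg m))
        (coeff m g * ∏ x, (L x.1 x.2 ⬝ᵥ q) ^ m x)
      have hH : H = 0 := MvPolynomial.funext fun t => by
        rw [map_zero, ← h0 t q, eval_eq' _ g]
        change eval t (∑ m ∈ g.support, _) = _
        rw [map_sum]
        refine Finset.sum_congr rfl fun m _ => ?_
        rw [eval_monomial, eval_scaled_monomial, Finsupp.prod_fintype _ _ (by simp)]
        simp only [Finsupp.coe_equivFunOnFinite_symm]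
        ring
      have hc := congrArg (coeff (Finsupp.equivFunOnFinite.symm d)) hH
      rw [coeff_zero, coeff_sum] at hc
      rw [← hc, map_sum, Finset.sum_filter]
      refine Finset.sum_congr rfl fun m _ => ?_
      rw [coeff_monomial, eval_monomial, Finsupp.prod_fintype _ _ (by simp)]
      simp only [EmbeddingLike.apply_eq_iff_eq]
  ext m
  have h := congrArg (coeff m) (hcomp (mdeg m))
  simp only [coeff_sum, coeff_monomial, Finset.sum_ite_eq', Finset.mem_filter, coeff_zero,
    and_true, mem_support_iff] at h
  rw [coeff_zero]
  by_contra hne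
  rw [if_pos hne] at h
  exact hne h

/-- Expansion of a determinant whose columns are linear combinations. -/
lemma det_sum_smul {R : Type*} [CommRing R] [Algebra ℂ R] [DecidableEq ι]
    (B : ι → ι → Fin 3 → ℂ) (x : ι → Fin 3 → R) :
    (Matrix.of fun i j => ∑ k, B i j k • x j k).det =
      ∑ k : ι → Fin 3, (Matrix.of fun i j => B i j (k j)).det • ∏ j, x j (k j) := by
  simp only [det_apply', of_apply, Finset.prod_univ_sum, Fintype.piFinset_univ, Finset.mul_sum,
    Finset.sum_smul]
  rw [Finset.sum_comm]
  refine Finset.sum_congr rfl fun k _ => Finset.sum_congr rfl fun π _ => ?_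
  rw [Finset.prod_smul, mul_smul_comm, ← zsmul_eq_mul, ← Int.cast_smul_eq_zsmul ℂ, smul_smul,
    mul_comm]

end Standard

/-! ### Reduction to standard monomials. -/

namespace PointSystem

variable {ι R : Type*} [Fintype ι] [DecidableEq ι] [CommRing R] [Algebra ℂ R]

/-- A multilinear relation with prescribed leading term. -/
lemma exists_relation {S : PointSystem ι R} (hex : S.Exact Finset.univ)
    {L : ι → Fin 3 → Fin 4 → ℂ} (hL : InGeneralPosition L) (hLf : ∀ i k, L i k ⬝ᵥ S.f i = 0)
    (e : ι → Fin 3) (he : 4 ≤ ∑ i, (e i : ℕ)) :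
    ∃ c : (ι → Fin 3) → ℂ, c e = 1 ∧ (∀ k, c k ≠ 0 → k ≤ e) ∧
      ∑ k, c k • ∏ j, S.P j (L j (k j)) ∈ S.J := by
  obtain ⟨b, -, hbe, hb⟩ := exists_between_sum_eq (s := 0) (b := fun i => (e i : ℕ))
    (fun i => Nat.zero_le _) (N := 4) (by simp) he
  have hb3 : ∀ i, b i ≤ 3 := fun i => (hbe i).trans (e i).2.le
  obtain ⟨u, -, -, hu⟩ := hL.exists_dual hb3 hb
  -- Row `i` encodes the expansion of `L i (e i)` in the basis selected by `b`: the form itself on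
  -- the diagonal, minus the basis terms. On world points every row sums to zero, so the determinant
  -- vanishes. Since `b ≤ e`, column `j` uses no index above `e j`, and the coefficient matrix at
  -- `e` is the identity.
  let B : ι → ι → Fin 3 → ℂ := fun i j k =>
    (if i = j ∧ k = e j then 1 else 0) - if (k : ℕ) < b j then L i (e i) ⬝ᵥ u j k else 0
  refine ⟨fun k => (Matrix.of fun i j => B i j (k j)).det, ?_, fun k hk j => ?_, ?_⟩
  · have : (Matrix.of fun i j => B i j (e j)) = 1 := by
      ext i j
      have : ¬ ((e j : ℕ) < b j) := not_lt.2 (hbe j)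
      simp [B, this, Matrix.one_apply]
    beta_reduce
    rw [this, det_one]
  · by_contra hlt
    rw [not_le, Fin.lt_def] at hlt
    refine hk (det_eq_zero_of_column_eq_zero j fun i => ?_)
    have h1 : ¬ ((k j : ℕ) < b j) := not_lt.2 ((hbe j).trans hlt.le)
    have h2 : k j ≠ e j := fun h => by rw [h] at hlt; exact lt_irrefl _ hlt
    simp [B, h1, h2]
  · refine hex _ (Submodule.sum_mem _ fun k _ => Submodule.smul_mem _ _
      (Submodule.subset_span ⟨fun j => L j (k j), fun j _ => hLf _ _, rfl⟩)) ?_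
    rw [map_sum]
    simp only [map_smul, map_prod, S.Ψ_P _ _ (hLf _ _)]
    rw [← det_sum_smul B fun j k => lin (L j k)]
    have hrow : ∀ i, ∑ j, ∑ k, B i j k • L j k = 0 := fun i => by
      refine dotProduct_eq_zero _ fun q => ?_
      have h1 := hu (L i (e i)) q
      simp only [sum_dotProduct, smul_dotProduct]
      simp only [B, smul_eq_mul, sub_mul, Finset.sum_sub_distrib]
      rw [sub_eq_zero]
      trans L i (e i) ⬝ᵥ q
      · rw [Finset.sum_eq_single i, Finset.sum_eq_single (e i)]
        · simp
        · intro k _ hk; simp [hk]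
        · simp
        · intro j _ hj; simp [hj.symm]
        · simp
      · rw [h1]
        simp only [ite_mul, zero_mul]
    refine exists_mulVec_eq_zero_iff.1 ⟨fun _ => 1, ?_, ?_⟩
    · intro h
      obtain ⟨i⟩ : Nonempty ι := by
        by_contra hne
        rw [not_nonempty_iff] at hne
        simp at he
      exact one_ne_zero (congrFun h i)
    · ext1 i
      simp only [mulVec, dotProduct, of_apply, mul_one, Pi.zero_apply]
      have := congrArg lin (hrow i)
      simpa only [map_sum, map_smul, map_zero] using this

end PointSystem

namespace PointSystem

variable {ι R : Type*} [Fintype ι] [CommRing R] [Algebra ℂ R]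

/-- The weight of a monomial: the variable `(i, k)` has weight `k`. -/
def wt (m : ι × Fin 3 →₀ ℕ) : ℕ := ∑ x, m x * (x.2 : ℕ)

lemma wt_add (m m' : ι × Fin 3 →₀ ℕ) : wt (m + m') = wt m + wt m' := by
  simp [wt, add_mul, Finset.sum_add_distrib]

lemma wt_single (x : ι × Fin 3) : wt (Finsupp.single x 1) = (x.2 : ℕ) := by
  rw [wt, Finset.sum_eq_single x]
  · simp
  · intro y _ hy; simp [hy.symm]
  · simp

variable [DecidableEq ι]

lemma wt_sum (s : Finset ι) (k : ι → Fin 3) :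
    wt (∑ i ∈ s, Finsupp.single (i, k i) 1) = ∑ i ∈ s, (k i : ℕ) := by
  induction s using Finset.induction_on with
  | empty => simp [wt]
  | insert a s ha ih => rw [Finset.sum_insert ha, Finset.sum_insert ha, wt_add, wt_single, ih]

/-- Multiplied by `∏ i, P i (L i 0)`, every monomial in the forms `P i (L i k)` reduces to
standard ones. -/
lemma exists_standard_monomial {S : PointSystem ι R} (hex : S.Exact Finset.univ)
    {L : ι → Fin 3 → Fin 4 → ℂ} (hL : InGeneralPosition L) (hLf : ∀ i k, L i k ⬝ᵥ S.f i = 0)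
    (N : ℕ) (m : ι × Fin 3 →₀ ℕ) (hN : wt m < N) :
    ∃ g : MvPolynomial (ι × Fin 3) ℂ, (∀ m ∈ g.support, IsStandard m) ∧
      (∏ i, S.P i (L i 0)) * (aeval (fun x : ι × Fin 3 => S.P x.1 (L x.1 x.2)) (monomial m 1 - g))
        ∈ S.J := by
  induction N generalizing m with
  | zero => exact absurd hN (Nat.not_lt_zero _)
  | succ N ih =>
    by_cases hm : IsStandard m
    · refine ⟨monomial m 1, fun m' hm' => ?_, by simp⟩
      rw [Finset.mem_singleton.1 (support_monomial_subset hm')]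
      exact hm
    set ξ : ι × Fin 3 → R := fun x => S.P x.1 (L x.1 x.2) with hξ
    set z := ∏ i, S.P i (L i 0) with hz
    let e : ι → Fin 3 := fun i => ⟨top m i, top_lt_three m i⟩
    obtain ⟨c, hce, hc, hrel⟩ := exists_relation hex hL hLf e (by
      rw [IsStandard, not_le] at hm; exact hm)
    -- Only for these cameras is the leading variable split off from `m`. For the others `e i = 0`,
    -- and the factor `P i (L i 0)` of `z` takes its place.
    set A : Finset ι := Finset.univ.filter fun i => top m i ≠ 0 with hA
    let u : (ι → Fin 3) → (ι × Fin 3 →₀ ℕ) := fun k => ∑ i ∈ A, Finsupp.single (i, k i) 1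
    have hum : u e ≤ m := by
      rintro ⟨i, k⟩
      simp only [u, Finsupp.finsetSum_apply, Finsupp.single_apply, Prod.mk.injEq]
      by_cases hi : i ∈ A ∧ e i = k
      · rw [Finset.sum_eq_single i]
        · rw [if_pos ⟨rfl, hi.2⟩, ← hi.2]
          exact Nat.one_le_iff_ne_zero.2 (top_ne_zero (Finset.mem_filter.1 hi.1).2)
        · intro j _ hj; rw [if_neg (fun h => hj h.1)]
        · intro h; exact absurd hi.1 h
      · rw [Finset.sum_eq_zero]
        · exact Nat.zero_le _
        · intro j hj
          rw [if_neg]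
          rintro ⟨rfl, h⟩
          exact hi ⟨hj, h⟩
    set m₀ := m - u e with hm₀
    have hm0 : m = m₀ + u e := (tsub_add_cancel_of_le hum).symm
    -- The relation contains only terms `k ≤ e`, so every replacement lowers some index.
    have hwt : ∀ k, c k ≠ 0 → k ≠ e → wt (m₀ + u k) < N := fun k hk hke => by
      have h1 : wt (m₀ + u k) < wt m := by
        conv_rhs => rw [hm0]
        rw [wt_add, wt_add, wt_sum, wt_sum]
        refine Nat.add_lt_add_left (Finset.sum_lt_sum (fun i _ => hc k hk i) ?_) _
        by_contra hcon
        push Not at hcon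
        refine hke (funext fun i => le_antisymm (hc k hk i) ?_)
        by_cases hi : i ∈ A
        · exact hcon i hi
        · have : top m i = 0 := by simpa [hA] using hi
          exact Fin.le_def.2 (by simp [e, this])
      omega
    -- Outside `A` the bound forces `k i = 0`, so the factors of `z` there complete the full product
    -- of the relation. The remaining cofactor does not depend on `k`.
    have hprod : ∀ k, k ≤ e → z * aeval ξ (monomial (m₀ + u k) (1 : ℂ)) =
        (∏ j, S.P j (L j (k j))) * ((∏ i ∈ A, S.P i (L i 0)) * aeval ξ (monomial m₀ (1 : ℂ))) := by
      intro k hk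
      have hu : aeval ξ (monomial (u k) (1 : ℂ)) = ∏ i ∈ A, S.P i (L i (k i)) := by
        simp only [u, monomial_sum_one, map_prod]
        refine Finset.prod_congr rfl fun i _ => ?_
        change aeval ξ (X (i, k i)) = _
        rw [aeval_X]
      have h0 : ∀ i ∈ Aᶜ, S.P i (L i (k i)) = S.P i (L i 0) := fun i hi => by
        have h1 : top m i = 0 := by simpa [hA] using hi
        have h2 : (k i : ℕ) ≤ top m i := hk i
        rw [show k i = 0 from Fin.ext (by simpa using h2.trans h1.le)]
      rw [← mul_one (1 : ℂ), ← monomial_mul, map_mul, mul_one, hu, hz,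
        ← Finset.prod_mul_prod_compl A, ← Finset.prod_mul_prod_compl A fun j => S.P j (L j (k j)),
        Finset.prod_congr rfl h0]
      ring
    have hJ : ∑ k, c k • (z * aeval ξ (monomial (m₀ + u k) (1 : ℂ))) ∈ S.J := by
      have := S.J.mul_mem_right ((∏ i ∈ A, S.P i (L i 0)) * aeval ξ (monomial m₀ (1 : ℂ))) hrel
      rw [Finset.sum_mul] at this
      convert this using 1
      refine Finset.sum_congr rfl fun k _ => ?_
      by_cases hk : c k = 0
      · simp [hk]
      · rw [hprod k (hc k hk), smul_mul_assoc]
    have hex' : ∀ k, ∃ g : MvPolynomial (ι × Fin 3) ℂ, (∀ m ∈ g.support, IsStandard m) ∧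
        (c k ≠ 0 → k ≠ e → z * aeval ξ (monomial (m₀ + u k) 1 - g) ∈ S.J) := fun k => by
      by_cases hk : c k ≠ 0 ∧ k ≠ e
      · obtain ⟨g, hg, hg'⟩ := ih (m₀ + u k) (hwt k hk.1 hk.2)
        exact ⟨g, hg, fun _ _ => hg'⟩
      · exact ⟨0, by simp, fun h1 h2 => absurd ⟨h1, h2⟩ hk⟩
    choose g hg hgJ using hex'
    refine ⟨-∑ k ∈ Finset.univ.erase e, c k • g k, fun m' hm' => ?_, ?_⟩
    · rw [support_neg] at hm'
      obtain ⟨k, -, hk⟩ := Finset.mem_biUnion.1 (support_sum hm')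
      exact hg k m' (support_smul hk)
    · rw [← Finset.add_sum_erase _ _ (Finset.mem_univ e), hce, one_smul, ← hm0] at hJ
      have h2 : ∑ k ∈ Finset.univ.erase e, c k • (z * aeval ξ (monomial (m₀ + u k) 1 - g k))
          ∈ S.J := S.J.sum_mem fun k hk => by
        by_cases hk0 : c k = 0
        · simp [hk0]
        · rw [Algebra.smul_def]
          exact S.J.mul_mem_left _ (hgJ k hk0 (Finset.ne_of_mem_erase hk))
      have := S.J.sub_mem hJ h2
      convert this using 1
      rw [sub_neg_eq_add, map_add, mul_add, add_sub_assoc, ← Finset.sum_sub_distrib, map_sum,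
        Finset.mul_sum]
      congr 1
      refine Finset.sum_congr rfl fun k _ => ?_
      rw [map_smul, map_sub, mul_sub, smul_sub, sub_sub_cancel, mul_smul_comm]

lemma exists_standard {S : PointSystem ι R} (hex : S.Exact Finset.univ)
    {L : ι → Fin 3 → Fin 4 → ℂ} (hL : InGeneralPosition L) (hLf : ∀ i k, L i k ⬝ᵥ S.f i = 0)
    (p : MvPolynomial (ι × Fin 3) ℂ) :
    ∃ g : MvPolynomial (ι × Fin 3) ℂ, (∀ m ∈ g.support, IsStandard m) ∧
      (∏ i, S.P i (L i 0)) * (aeval (fun x : ι × Fin 3 => S.P x.1 (L x.1 x.2)) (p - g)) ∈ S.J := by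
  choose g hg hgJ using fun m => exists_standard_monomial hex hL hLf _ m (Nat.lt_succ_self _)
  refine ⟨∑ m ∈ p.support, coeff m p • g m, fun m' hm' => ?_, ?_⟩
  · obtain ⟨m, -, hm⟩ := Finset.mem_biUnion.1 (support_sum hm')
    exact hg m m' (support_smul hm)
  · have hp : p - ∑ m ∈ p.support, coeff m p • g m =
        ∑ m ∈ p.support, coeff m p • (monomial m 1 - g m) := by
      simp only [smul_sub, Finset.sum_sub_distrib]
      congr 1
      conv_lhs => rw [p.as_sum]
      refine Finset.sum_congr rfl fun m _ => ?_
      rw [smul_monomial, smul_eq_mul, mul_one]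
    rw [hp, map_sum, Finset.mul_sum]
    refine S.J.sum_mem fun m _ => ?_
    rw [map_smul, mul_smul_comm, Algebra.smul_def]
    exact S.J.mul_mem_left _ (hgJ m)

/-- Elements vanishing at the images of all world points are multiplied into `J` by a general
product of linear forms. -/
theorem prod_mul_mem {S : PointSystem ι R} (hex : S.Exact Finset.univ)
    (hι : 2 ≤ Fintype.card ι)
    {L : ι → Fin 3 → Fin 4 → ℂ} (hL : InGeneralPosition L) (hLf : ∀ i k, L i k ⬝ᵥ S.f i = 0)
    (hsurj : Function.Surjective
      (aeval (fun x : ι × Fin 3 => S.P x.1 (L x.1 x.2)) : MvPolynomial (ι × Fin 3) ℂ →ₐ[ℂ] R))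
    (ev : (ι → ℂ) → (Fin 4 → ℂ) → R →ₐ[ℂ] ℂ)
    (hev : ∀ t q i w, w ⬝ᵥ S.f i = 0 → ev t q (S.P i w) = t i * (w ⬝ᵥ q))
    (hJ : ∀ t q, ∀ x ∈ S.J, ev t q x = 0) {F : R} (hF : ∀ t q, ev t q F = 0) :
    (∏ i, S.P i (L i 0)) * F ∈ S.J := by
  obtain ⟨p, rfl⟩ := hsurj F
  obtain ⟨g, hg, hgJ⟩ := exists_standard hex hL hLf p
  have hX : aeval (fun x : ι × Fin 3 => S.P x.1 (L x.1 x.2))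
      (∏ i, X (i, 0) : MvPolynomial (ι × Fin 3) ℂ) = ∏ i, S.P i (L i 0) := by
    simp [map_prod]
  -- Evaluation of the reduction gives the vanishing of `z` times `g` only, so the independence
  -- result is applied to this product; the variables `(i, 0)` keep monomials standard.
  have hg' : (∏ i, X (i, 0)) * g = 0 := by
    refine eq_zero_of_isStandard hL hι (fun m hm => ?_) fun t q => ?_
    · have hX' : (∏ i, X (i, 0) : MvPolynomial (ι × Fin 3) ℂ) =
          monomial (∑ i, Finsupp.single (i, 0) 1) 1 := by
        rw [monomial_sum_one]; rfl
      rw [hX'] at hm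
      obtain ⟨a, ha, b, hb, rfl⟩ := Finset.mem_add.1 (support_mul _ _ hm)
      rw [Finset.mem_singleton.1 (support_monomial_subset ha)]
      refine le_trans (Finset.sum_le_sum fun i _ => top_le fun k hk => ?_) (hg b hb)
      by_cases hk0 : k = 0
      · simp [hk0]
      · refine le_top fun h0 => hk ?_
        rw [Finsupp.add_apply, h0, Finsupp.finsetSum_apply, Finset.sum_eq_zero]
        intro j _
        rw [Finsupp.single_apply, if_neg]
        rintro h
        exact hk0 (Prod.mk.inj h).2.symm
    · have hcomp : ∀ y : MvPolynomial (ι × Fin 3) ℂ,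
          ev t q (aeval (fun x : ι × Fin 3 => S.P x.1 (L x.1 x.2)) y) =
          eval (fun x => t x.1 * (L x.1 x.2 ⬝ᵥ q)) y := fun y => by
        rw [← AlgHom.comp_apply, ← coe_aeval_eq_eval]
        change _ = aeval _ y
        congr 1
        refine MvPolynomial.algHom_ext fun x => ?_
        simp [hev _ _ _ _ (hLf x.1 x.2)]
      rw [← hcomp, map_mul, hX]
      have := hJ t q _ hgJ
      rw [map_sub, mul_sub, map_sub, map_mul _ _ (aeval _ p), hF, mul_zero, zero_sub,
        neg_eq_zero] at this
      exact this
  have : (∏ i, S.P i (L i 0)) * aeval (fun x : ι × Fin 3 => S.P x.1 (L x.1 x.2)) g = 0 := by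
    rw [← hX, ← map_mul, hg', map_zero]
  rwa [map_sub, mul_sub, this, sub_zero] at hgJ

end PointSystem

/-! ### Existence of linear forms in general position -/

/-- Evaluation of linear forms at the point `v`. -/
def evalAt (v : Fin 4 → ℂ) : Module.Dual ℂ (Fin 4 → ℂ) where
  toFun w := w ⬝ᵥ v
  map_add' w w' := add_dotProduct w w' v
  map_smul' c w := smul_dotProduct c w v

/-- The linear forms vanishing at `v`. -/
def formsAt (v : Fin 4 → ℂ) : Submodule ℂ (Fin 4 → ℂ) := LinearMap.ker (evalAt v)

lemma mem_formsAt {v w : Fin 4 → ℂ} : w ∈ formsAt v ↔ w ⬝ᵥ v = 0 := Iff.rfl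

lemma finrank_formsAt {v : Fin 4 → ℂ} (hv : v ≠ 0) : Module.finrank ℂ (formsAt v) = 3 := by
  have h : evalAt v ≠ 0 := fun h => hv (dotProduct_eq_zero v fun w => by
    rw [dotProduct_comm]; exact LinearMap.congr_fun h w)
  have := Module.Dual.finrank_ker_add_one_of_ne_zero h
  rw [Module.finrank_fin_fun] at this
  exact Nat.succ_injective this

/-- A subspace contains vectors outside finitely many subspaces not containing it. -/
lemma exists_mem_forall_notMem {K M : Type*} [Field K] [Infinite K] [AddCommGroup M] [Module K M]
    (V : Submodule K M) (𝒩 : Set (Submodule K M)) (hfin : 𝒩.Finite) (h : ∀ N ∈ 𝒩, ¬ V ≤ N) :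
    ∃ v ∈ V, ∀ N ∈ 𝒩, v ∉ N := by
  classical
  have key := Subspace.biUnion_ne_univ_of_top_notMem (k := K) (E := V)
    (s := hfin.toFinset.image fun N => N.comap V.subtype) (by
      intro hmem
      obtain ⟨N, hN, hNt⟩ := Finset.mem_image.1 hmem
      exact h N (hfin.mem_toFinset.1 hN) (Submodule.comap_subtype_eq_top.1 hNt))
  obtain ⟨v, hv⟩ := (Set.ne_univ_iff_exists_notMem _).1 key
  refine ⟨v, v.2, fun N hN hvN => hv ?_⟩
  simp only [Set.mem_iUnion]
  exact ⟨N.comap V.subtype, Finset.mem_image_of_mem _ (hfin.mem_toFinset.2 hN), hvN⟩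

section GeneralPosition

variable {n : ℕ}

/-- The order in which the forms are chosen. -/
def rank (x : Fin n × Fin 3) : ℕ := (x.2 : ℕ) * n + x.1

lemma rank_injective : Function.Injective (rank (n := n)) := by
  rintro ⟨i, k⟩ ⟨j, l⟩ h
  simp only [rank] at h
  have hkl : (k : ℕ) = l := by
    rcases lt_trichotomy (k : ℕ) l with h' | h' | h'
    · have := Nat.mul_le_mul_right n h'
      rw [Nat.succ_mul] at this
      omega
    · exact h'
    · have := Nat.mul_le_mul_right n h'
      rw [Nat.succ_mul] at this
      omega
  rw [hkl] at h
  exact Prod.ext (Fin.ext (Nat.add_left_cancel h)) (Fin.ext hkl)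

lemma rank_lt (x : Fin n × Fin 3) : rank x < 3 * n := by
  have h1 := x.1.2
  have h2 := Nat.mul_le_mul_right n (Nat.lt_succ_iff.1 x.2.2)
  simp only [rank]
  omega

lemma exists_rank_eq {N : ℕ} (hN : N < 3 * n) : ∃ x : Fin n × Fin 3, rank x = N := by
  have hn : 0 < n := by omega
  refine ⟨(⟨N % n, Nat.mod_lt _ hn⟩, ⟨N / n, Nat.div_lt_of_lt_mul (by rwa [mul_comm])⟩), ?_⟩
  simp only [rank]
  rw [mul_comm]
  exact Nat.div_add_mod N n

/-- The forms of rank below `N` vanish at the respective points and are otherwise general. -/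
def Good (f : Fin n → Fin 4 → ℂ) (N : ℕ) (L : Fin n × Fin 3 → Fin 4 → ℂ) : Prop :=
  ∀ x, rank x < N → L x ∈ formsAt (f x.1) ∧ (x.2 = 0 → ∀ j, j ≠ x.1 → L x ∉ formsAt (f j)) ∧
    ∀ A : Finset (Fin n × Fin 3), (∀ y ∈ A, rank y < rank x) →
      ¬ formsAt (f x.1) ≤ Submodule.span ℂ (L '' A) → L x ∉ Submodule.span ℂ (L '' A)

lemma Good.extend {f : Fin n → Fin 4 → ℂ} {N : ℕ} {L : Fin n × Fin 3 → Fin 4 → ℂ}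
    (hL : Good f N L) (hsep : ∀ i j, i ≠ j → ¬ formsAt (f i) ≤ formsAt (f j))
    {x : Fin n × Fin 3} (hx : rank x = N) :
    ∃ 𝒩 : Set (Submodule ℂ (Fin 4 → ℂ)), 𝒩.Finite ∧ (∀ V ∈ 𝒩, ¬ formsAt (f x.1) ≤ V) ∧
      ∀ w ∈ formsAt (f x.1), (∀ V ∈ 𝒩, w ∉ V) → Good f (N + 1) (Function.update L x w) := by
  refine ⟨((fun j => formsAt (f j)) '' {j | j ≠ x.1}) ∪
    ((fun A : Finset (Fin n × Fin 3) => Submodule.span ℂ (L '' A)) '' Set.univ ∩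
      {V | ¬ formsAt (f x.1) ≤ V}), ?_, ?_, fun w hw hw𝒩 y hy => ?_⟩
  · exact (Set.toFinite _).union ((Set.toFinite _).subset Set.inter_subset_left)
  · rintro V (⟨j, hj, rfl⟩ | ⟨-, hV⟩)
    · exact hsep _ _ (Ne.symm hj)
    · exact hV
  · have himage : ∀ A : Finset (Fin n × Fin 3), (∀ z ∈ A, rank z < N) →
        Function.update L x w '' A = L '' A := fun A hA => Set.image_congr fun z hz => by
      rw [Function.update_of_ne]
      rintro rfl
      exact absurd (hA z hz) (by omega)
    rcases Nat.lt_succ_iff_lt_or_eq.1 hy with hy | hy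
    · have hne : y ≠ x := by rintro rfl; omega
      rw [Function.update_of_ne hne]
      obtain ⟨h1, h2, h3⟩ := hL y hy
      refine ⟨h1, h2, fun A hA => ?_⟩
      rw [himage A fun z hz => (hA z hz).trans hy]
      exact h3 A hA
    · obtain rfl : y = x := rank_injective (hy.trans hx.symm)
      rw [Function.update_self]
      refine ⟨hw, fun _ j hj => hw𝒩 _ (Or.inl ⟨j, hj, rfl⟩), fun A hA hV => ?_⟩
      rw [himage A fun z hz => (hA z hz).trans_eq hx] at hV ⊢
      exact hw𝒩 _ (Or.inr ⟨⟨A, trivial, rfl⟩, hV⟩)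

/-- A good choice of the first forms extends to a good choice of all of them. -/
lemma Good.exists_extension {f : Fin n → Fin 4 → ℂ} {N : ℕ} {L : Fin n × Fin 3 → Fin 4 → ℂ}
    (hL : Good f N L) (hsep : ∀ i j, i ≠ j → ¬ formsAt (f i) ≤ formsAt (f j)) (hN : N ≤ 3 * n) :
    ∃ L', Good f (3 * n) L' ∧ ∀ x, rank x < N → L' x = L x := by
  suffices ∀ M, N ≤ M → M ≤ 3 * n → ∃ L', Good f M L' ∧ ∀ x, rank x < N → L' x = L x from
    this _ hN le_rfl
  intro M hM
  induction M, hM using Nat.le_induction with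
  | base => exact fun _ => ⟨L, hL, fun _ _ => rfl⟩
  | succ M hM ih =>
    intro hMn
    obtain ⟨L', hL', hLL'⟩ := ih (by omega)
    obtain ⟨x, hx⟩ := exists_rank_eq (n := n) (N := M) (by omega)
    obtain ⟨𝒩, hfin, h𝒩, hext⟩ := hL'.extend hsep hx
    obtain ⟨w, hw, hw'⟩ := exists_mem_forall_notMem _ 𝒩 hfin h𝒩
    refine ⟨_, hext w hw hw', fun y hy => ?_⟩
    rw [Function.update_of_ne (by rintro rfl; omega)]
    exact hLL' y hy

/-- The four selected forms are independent, as is seen by adding them in order of rank. A new form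
of camera `i` could be dependent only if the earlier ones span all forms at `f i`. Being at most
three, they then span exactly these, and at least one belongs to another camera, since camera `i`
has only three cells. The first form of that other camera comes earlier too, but it was chosen not
to vanish at `f i`. -/
lemma Good.inGeneralPosition {f : Fin n → Fin 4 → ℂ} {L : Fin n × Fin 3 → Fin 4 → ℂ}
    (hL : Good f (3 * n) L) (hf : ∀ i, f i ≠ 0) : InGeneralPosition fun i k => L (i, k) := by
  intro c hc hsum u hu
  have hcard := card_staircase hc
  rw [hsum, Fintype.card_subtype] at hcard
  set T : Finset (Fin n × Fin 3) := Finset.univ.filter fun x => (x.2 : ℕ) < c x.1 with hT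
  have hind : ∀ N, LinearIndepOn ℂ L (T.filter fun x => rank x < N : Finset (Fin n × Fin 3)) := by
    intro N
    induction N with
    | zero => simp
    | succ N ih =>
      by_cases hex : ∃ x ∈ T, rank x = N
      · obtain ⟨x, hxT, hx⟩ := hex
        have hins : (T.filter fun x => rank x < N + 1) = insert x (T.filter fun x => rank x < N) := by
          ext y
          simp only [Finset.mem_filter, Finset.mem_insert, Nat.lt_succ_iff_lt_or_eq]
          constructor
          · rintro ⟨h1, h2 | h2⟩
            · exact Or.inr ⟨h1, h2⟩
            · exact Or.inl (rank_injective (h2.trans hx.symm))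
          · rintro (rfl | h)
            · exact ⟨hxT, Or.inr hx⟩
            · exact ⟨h.1, Or.inl h.2⟩
        set A := T.filter fun x => rank x < N with hA
        rw [hins, Finset.coe_insert]
        refine ih.insert ((hL x (rank_lt x)).2.2 A (fun y hy => ?_) ?_)
        · rw [hx]; exact (Finset.mem_filter.1 hy).2
        intro hle
        have hxA : x ∉ A := fun h => by
          have := (Finset.mem_filter.1 h).2
          omega
        have hA3 : A.card ≤ 3 := by
          have : (insert x A).card ≤ T.card := Finset.card_le_card (by
            rw [Finset.insert_subset_iff]
            exact ⟨hxT, Finset.filter_subset _ _⟩)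
          rw [Finset.card_insert_of_notMem hxA] at this
          omega
        have hrank : Module.finrank ℂ (Submodule.span ℂ (L '' A)) ≤ A.card := by
          classical
          rw [← Finset.coe_image]
          exact (finrank_span_finset_le_card _).trans Finset.card_image_le
        have h3 := Submodule.finrank_mono hle
        rw [finrank_formsAt (hf _)] at h3
        have heq : formsAt (f x.1) = Submodule.span ℂ (L '' A) :=
          Submodule.eq_of_le_of_finrank_le hle (by rw [finrank_formsAt (hf _)]; omega)
        obtain ⟨y, hyA, hyx⟩ : ∃ y ∈ A, y.1 ≠ x.1 := by
          by_contra hcon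
          push Not at hcon
          have hsub : (insert x A).image Prod.snd ⊆ Finset.univ := Finset.subset_univ _
          have hcard' : ((insert x A).image Prod.snd).card = (insert x A).card := by
            refine Finset.card_image_of_injOn fun y hy z hz hyz => ?_
            have hrow : ∀ y ∈ insert x A, y.1 = x.1 := fun y hy => by
              rcases Finset.mem_insert.1 hy with rfl | hy
              · rfl
              · exact hcon y hy
            exact Prod.ext ((hrow y hy).trans (hrow z hz).symm) hyz
          have := Finset.card_le_card hsub
          rw [hcard', Finset.card_insert_of_notMem hxA] at this
          simp at this
          omega
        have hy0 : (y.1, 0) ∈ A := by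
          have h1 := Finset.mem_filter.1 hyA
          have h2 := (Finset.mem_filter.1 h1.1).2
          refine Finset.mem_filter.2 ⟨Finset.mem_filter.2 ⟨Finset.mem_univ _, ?_⟩, ?_⟩
          · exact (Nat.zero_le _).trans_lt h2
          · refine lt_of_le_of_lt ?_ h1.2
            simp [rank]
        refine (hL (y.1, 0) (rank_lt _)).2.1 rfl x.1 hyx.symm ?_
        rw [heq]
        exact Submodule.subset_span ⟨_, hy0, rfl⟩
      · have : (T.filter fun x => rank x < N + 1) = T.filter fun x => rank x < N := by
          refine Finset.filter_congr fun y hy => ?_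
          have : rank y ≠ N := fun h => hex ⟨y, hy, h⟩
          omega
        rw [this]
        exact ih
  have hT' : (T.filter fun x => rank x < 3 * n) = T :=
    Finset.filter_true_of_mem fun x _ => rank_lt x
  have hindT := hind (3 * n)
  rw [hT'] at hindT
  have hspan := LinearIndependent.span_eq_top_of_card_eq_finrank' hindT (by simp [hcard])
  have hle : Submodule.span ℂ (Set.range fun x : (T : Set (Fin n × Fin 3)) => L x) ≤ formsAt u := by
    rw [Submodule.span_le]
    rintro _ ⟨x, rfl⟩
    exact hu _ _ (Finset.mem_filter.1 x.2).2
  have htop : ∀ w, w ⬝ᵥ u = 0 := fun w => hle (by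
    have : w ∈ (⊤ : Submodule ℂ (Fin 4 → ℂ)) := trivial
    rwa [← hspan] at this)
  exact dotProduct_eq_zero u fun w => by rw [dotProduct_comm]; exact htop w

end GeneralPosition

/-! ### From general to arbitrary products of linear forms. -/

namespace PointSystem

variable {n : ℕ} {R : Type*} [CommRing R] [Algebra ℂ R]

/-- Elements vanishing at the images of all world points are multiplied into `J` by all products
of linear forms. -/
theorem prod_mul_mem_of_sep {S : PointSystem (Fin n) R} (hn : 2 ≤ n)
    (hex : S.Exact Finset.univ) (hsep : S.Sep Finset.univ)
    (hgen : Algebra.adjoin ℂ {x | ∃ i w, w ⬝ᵥ S.f i = 0 ∧ x = S.P i w} = ⊤)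
    (ev : (Fin n → ℂ) → (Fin 4 → ℂ) → R →ₐ[ℂ] ℂ)
    (hev : ∀ t q i w, w ⬝ᵥ S.f i = 0 → ev t q (S.P i w) = t i * (w ⬝ᵥ q))
    (hJ : ∀ t q, ∀ x ∈ S.J, ev t q x = 0) {F : R} (hF : ∀ t q, ev t q F = 0)
    (w : Fin n → Fin 4 → ℂ) (hw : ∀ i, w i ⬝ᵥ S.f i = 0) :
    (∏ i, S.P i (w i)) * F ∈ S.J := by
  have hsep' : ∀ i j, i ≠ j → ¬ formsAt (S.f i) ≤ formsAt (S.f j) := fun i j hij hle => by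
    obtain ⟨w, h1, h2⟩ := hsep j (Finset.mem_univ _) i (Finset.mem_univ _) hij.symm
    exact h2 (hle h1)
  have hother : ∀ i : Fin n, ∃ j, j ≠ i := fun i => by
    have : Nontrivial (Fin n) := Fin.nontrivial_iff_two_le.2 hn
    exact exists_ne i
  have hf : ∀ i, S.f i ≠ 0 := fun i h => by
    obtain ⟨j, hj⟩ := hother i
    obtain ⟨w, -, h2⟩ := hsep i (Finset.mem_univ _) j (Finset.mem_univ _) hj.symm
    exact h2 (by rw [h, dotProduct_zero])
  have hmain : ∀ L, Good S.f n L → (∏ i, S.P i (L (i, 0))) * F ∈ S.J := by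
    intro L₀ hL₀
    obtain ⟨L, hL, hLL⟩ := hL₀.exists_extension hsep' (by omega)
    have hgp := hL.inGeneralPosition hf
    have hLf : ∀ i k, L (i, k) ⬝ᵥ S.f i = 0 := fun i k => (hL (i, k) (rank_lt _)).1
    have hz : ∏ i, S.P i (L₀ (i, 0)) = ∏ i, S.P i (L (i, 0)) :=
      Finset.prod_congr rfl fun i _ => by rw [hLL (i, 0) (by simp [rank])]
    rw [hz]
    refine prod_mul_mem hex (by simpa using hn) (L := fun i k => L (i, k)) hgp hLf ?_ ev hev hJ hF
    rw [← AlgHom.range_eq_top, eq_top_iff, ← hgen, Algebra.adjoin_le_iff]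
    rintro _ ⟨i, v, hv, rfl⟩
    obtain ⟨j, hj⟩ := hother i
    -- The three forms of camera `i` and the first form of `j` are a basis. The latter does not
    -- vanish at `f i`, so a form that does vanish there involves only the forms of camera `i`.
    obtain ⟨u, -, -, hu⟩ := hgp.exists_dual (c := Pi.single i 3 + Pi.single j 1) (fun l => by
        by_cases hl : l = i
        · subst hl; simp [hj.symm]
        · by_cases hl' : l = j
          · subst hl'; simp [hl]
          · simp [hl, hl'])
      (by simp [Finset.sum_add_distrib])
    have hexp : ∀ q, v ⬝ᵥ q = (∑ k : Fin 3, (v ⬝ᵥ u i k) * (L (i, k) ⬝ᵥ q)) +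
        (v ⬝ᵥ u j 0) * (L (j, 0) ⬝ᵥ q) := fun q => by
      rw [hu v q, ← Finset.add_sum_erase _ _ (Finset.mem_univ i),
        ← Finset.add_sum_erase _ _ (Finset.mem_erase.2 ⟨hj, Finset.mem_univ j⟩),
        Finset.sum_eq_zero (s := (Finset.univ.erase i).erase j), add_zero]
      · congr 1
        · refine Finset.sum_congr rfl fun k _ => if_pos ?_
          simp [hj.symm]
        · rw [Fin.sum_univ_three]
          simp [hj]
      · intro l hl
        simp only [Finset.mem_erase] at hl
        simp [hl.1, hl.2.1]
    have hj0 : v ⬝ᵥ u j 0 = 0 := by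
      have := hexp (S.f i)
      simp only [hv, hLf, mul_zero, Finset.sum_const_zero, zero_add] at this
      rcases mul_eq_zero.1 this.symm with h | h
      · exact h
      · exact absurd h ((hL (j, 0) (rank_lt _)).2.1 rfl i hj.symm)
    have hv' : v = ∑ k : Fin 3, (v ⬝ᵥ u i k) • L (i, k) := by
      rw [← sub_eq_zero]
      refine dotProduct_eq_zero _ fun q => ?_
      rw [sub_dotProduct, hexp q, hj0, zero_mul, add_zero, sum_dotProduct]
      simp [smul_dotProduct]
    rw [hv', map_sum]
    refine Subalgebra.sum_mem _ fun k _ => ?_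
    rw [map_smul]
    exact Subalgebra.smul_mem _ (AlgHom.mem_range _ |>.2 ⟨X (i, k), by simp⟩) _
  -- linear extension in one factor after the other
  have hstep : ∀ k, k ≤ n → ∀ L : Fin n × Fin 3 → Fin 4 → ℂ, Good S.f (n - k) L →
      (∀ i, L (i, 0) ⬝ᵥ S.f i = 0) → (∏ i, S.P i (L (i, 0))) * F ∈ S.J := by
    intro k
    induction k with
    | zero => exact fun _ L hL _ => hmain L hL
    | succ k ih =>
      intro hk L hL hLf
      let a : Fin n := ⟨n - (k + 1), by omega⟩
      have hra : rank (a, (0 : Fin 3)) = n - (k + 1) := by simp [rank, a]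
      obtain ⟨𝒩, hfin, h𝒩, hext⟩ := hL.extend hsep' hra
      rw [show n - (k + 1) + 1 = n - k by omega] at hext
      -- The admissible choices for the factor of camera `a` form a subspace. By induction it
      -- contains every form at the focus of `a` outside finitely many proper subspaces, hence all
      -- forms there.
      let W : Submodule ℂ (Fin 4 → ℂ) := (S.J.restrictScalars ℂ).comap
        (LinearMap.mulRight ℂ ((∏ i ∈ Finset.univ.erase a, S.P i (L (i, 0))) * F) ∘ₗ S.P a)
      have hW : ∀ v, v ∈ W ↔ (∏ i, S.P i (Function.update L (a, 0) v (i, 0))) * F ∈ S.J := by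
        intro v
        rw [← Finset.mul_prod_erase _ _ (Finset.mem_univ a), Function.update_self, mul_assoc,
          Finset.prod_congr rfl fun i hi => by
            rw [Function.update_of_ne (by simpa using Finset.ne_of_mem_erase hi)]]
        rfl
      by_contra hcon
      have hWV : ¬ formsAt (S.f a) ≤ W := fun hle => hcon (by
        have := (hW _).1 (hle (hLf a))
        rwa [Function.update_eq_self] at this)
      obtain ⟨v, hv, hv'⟩ := exists_mem_forall_notMem (formsAt (S.f a)) (insert W 𝒩)
        (hfin.insert W) (by rintro N (rfl | hN); exacts [hWV, h𝒩 N hN])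
      refine hv' W (Set.mem_insert _ _) ((hW v).2 (ih (by omega) _
        (hext v hv fun N hN => hv' N (Set.mem_insert_of_mem _ hN)) fun i => ?_))
      by_cases hi : i = a
      · subst hi; rw [Function.update_self]; exact hv
      · rw [Function.update_of_ne (by simpa using hi)]; exact hLf i
  -- Goodness below rank 0 is vacuous, so the factors are arbitrary.
  exact hstep n le_rfl (fun x => w x.1) (by rw [Nat.sub_self]; intro x hx; omega) hw

end PointSystem

/-! ### Cameras and their foci -/

/-- Vectors with trivial annihilator contain a basis, witnessed by a determinant. -/
lemma exists_det_ne_zero {K X Y : Type*} [Field K] [Fintype Y] [DecidableEq Y]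
    (v : X → Y → K) (h : ∀ u, (∀ x, v x ⬝ᵥ u = 0) → u = 0) :
    ∃ κ : Y → X, Function.Injective κ ∧ (Matrix.of fun y => v (κ y)).det ≠ 0 := by
  have hspan : Submodule.span K (Set.range v) = ⊤ := by
    by_contra hne
    obtain ⟨φ, hφ, hle⟩ := Submodule.exists_le_ker_of_lt_top _ (lt_top_iff_ne_top.2 hne)
    have hφu : ∀ w, w ⬝ᵥ (fun y => φ (Pi.single y 1)) = φ w := fun w => by
      conv_rhs => rw [pi_eq_sum_univ' w, map_sum]
      rw [dotProduct]
      refine Finset.sum_congr rfl fun y _ => ?_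
      rw [map_smul, smul_eq_mul]
    have := h (fun y => φ (Pi.single y 1)) fun x => by
      rw [hφu]; exact hle (Submodule.subset_span ⟨x, rfl⟩)
    refine hφ (LinearMap.ext fun w => ?_)
    rw [← hφu, this, dotProduct_zero, LinearMap.zero_apply]
  obtain ⟨κ, a, ha, hsp, hli⟩ := exists_linearIndependent' K v
  rw [hspan] at hsp
  let b := Module.Basis.mk hli hsp.ge
  have : Fintype κ := FiniteDimensional.fintypeBasisIndex b
  have hcard : Fintype.card Y = Fintype.card κ := by
    rw [← Module.finrank_eq_card_basis b, Module.finrank_fintype_fun_eq_card]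
  let e : Y ≃ κ := Fintype.equivOfCardEq hcard
  refine ⟨a ∘ e, ha.comp e.injective, ?_⟩
  have hli' : LinearIndependent K (Matrix.of fun y => v ((a ∘ e) y)).row :=
    hli.comp e e.injective
  rw [linearIndependent_rows_iff_isUnit, isUnit_iff_isUnit_det] at hli'
  exact hli'.ne_zero

namespace Camera

variable (A : Camera)

/-- A real vector spanning the kernel. -/
def center : Fin 4 → ℝ := A.focus.rep

lemma center_ne_zero : A.center ≠ 0 := A.focus.rep_nonzero

lemma ker_eq : LinearMap.ker A.mat.mulVecLin = Submodule.span ℝ {A.center} := by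
  rw [center, ← Projectivization.submodule_eq, focus, Projectivization.submodule_mk'']

lemma mulVec_eq_zero_iff {q : Fin 4 → ℝ} : A.mat *ᵥ q = 0 ↔ ∃ c : ℝ, c • A.center = q := by
  rw [← Submodule.mem_span_singleton, ← A.ker_eq, LinearMap.mem_ker, mulVecLin_apply]

lemma mulVec_center : A.mat *ᵥ A.center = 0 := A.mulVec_eq_zero_iff.2 ⟨1, one_smul _ _⟩

lemma mk_center : Projectivization.mk ℝ A.center A.center_ne_zero = A.focus :=
  Projectivization.mk_rep _

lemma smul_center_ne {A A' : Camera} (h : A.focus ≠ A'.focus) (c : ℝ) :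
    c • A'.center ≠ A.center := fun hc => h (by
  rw [← A.mk_center, ← A'.mk_center, Projectivization.mk_eq_mk_iff']
  exact ⟨c, hc⟩)

lemma mulVec_center_ne_zero {A A' : Camera} (h : A.focus ≠ A'.focus) :
    A'.mat *ᵥ A.center ≠ 0 := fun h0 => by
  obtain ⟨c, hc⟩ := A'.mulVec_eq_zero_iff.1 h0
  exact smul_center_ne h c hc

/-- The camera matrix over the complex numbers. -/
def cmat : Matrix (Fin 3) (Fin 4) ℂ := A.mat.map (algebraMap ℝ ℂ)

/-- The focus as a complex vector. -/
def ccenter : Fin 4 → ℂ := fun k => (A.center k : ℂ)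

lemma cmat_mulVec (q : Fin 4 → ℝ) (k : Fin 3) :
    (A.cmat *ᵥ fun j => (q j : ℂ)) k = ((A.mat *ᵥ q) k : ℂ) := by
  simp [cmat, mulVec, dotProduct]

lemma ccenter_ne_zero : A.ccenter ≠ 0 := fun h => A.center_ne_zero (by
  ext k
  have := congrFun h k
  simpa [ccenter] using this)

lemma cmat_row_dotProduct (k : Fin 3) : A.cmat k ⬝ᵥ A.ccenter = 0 := by
  have := A.cmat_mulVec A.center k
  rw [A.mulVec_center] at this
  exact this.trans (by simp)

lemma vecMul_injective : Function.Injective fun u : Fin 3 → ℝ => u ᵥ* A.mat := by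
  rw [← Matrix.coe_vecMulLinear]
  rw [← LinearMap.ker_eq_bot, ← Submodule.finrank_eq_zero]
  have h1 := LinearMap.finrank_range_add_finrank_ker A.mat.vecMulLinear
  have h2 : Module.finrank ℝ (LinearMap.range A.mat.vecMulLinear) = 3 := by
    have h3 := A.mat.rank_transpose
    rw [A.rank_mat, Matrix.rank, mulVecLin_transpose] at h3
    exact h3
  rw [h2, Module.finrank_fin_fun] at h1
  omega

lemma cmat_vecMul_injective : Function.Injective A.cmat.vecMulLinear := by
  rw [← LinearMap.ker_eq_bot, LinearMap.ker_eq_bot']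
  intro u hu
  rw [vecMulLinear_apply] at hu
  have hre : (fun k => (u k).re) = 0 := A.vecMul_injective (by
    ext j
    have := congrArg Complex.re (congrFun hu j)
    simpa [cmat, vecMul, dotProduct] using this)
  have him : (fun k => (u k).im) = 0 := A.vecMul_injective (by
    ext j
    have := congrArg Complex.im (congrFun hu j)
    simpa [cmat, vecMul, dotProduct] using this)
  ext k
  exact Complex.ext (congrFun hre k) (congrFun him k)

/-- The rows of the camera matrix are independent and annihilate the focus, so by dimension they
span all forms vanishing there. Such world forms thus correspond to linear forms in the image
coordinates. -/
lemma exists_section : ∃ s : (Fin 4 → ℂ) →ₗ[ℂ] (Fin 3 → ℂ),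
    (∀ u, s (u ᵥ* A.cmat) = u) ∧ ∀ w, w ⬝ᵥ A.ccenter = 0 → s w ᵥ* A.cmat = w := by
  obtain ⟨s, hs⟩ := A.cmat.vecMulLinear.exists_leftInverse_of_injective
    (LinearMap.ker_eq_bot.2 A.cmat_vecMul_injective)
  have hs' : ∀ u, s (u ᵥ* A.cmat) = u := fun u => LinearMap.congr_fun hs u
  refine ⟨s, hs', fun w hw => ?_⟩
  have hle : LinearMap.range A.cmat.vecMulLinear ≤ formsAt A.ccenter := by
    rintro _ ⟨u, rfl⟩
    rw [mem_formsAt, vecMulLinear_apply, ← dotProduct_mulVec]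
    rw [show A.cmat *ᵥ A.ccenter = 0 from funext A.cmat_row_dotProduct, dotProduct_zero]
  have heq := Submodule.eq_of_le_of_finrank_le hle (by
    rw [finrank_formsAt A.ccenter_ne_zero, LinearMap.finrank_range_of_inj A.cmat_vecMul_injective,
      Module.finrank_fin_fun])
  have hw' : w ∈ LinearMap.range A.cmat.vecMulLinear := heq ▸ hw
  obtain ⟨u, rfl⟩ := hw'
  rw [vecMulLinear_apply, hs']

/-- The coefficients of a linear form vanishing at the focus with respect to the rows of the
camera matrix. -/
def sec : (Fin 4 → ℂ) →ₗ[ℂ] (Fin 3 → ℂ) := A.exists_section.choose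

lemma sec_vecMul (u : Fin 3 → ℂ) : A.sec (u ᵥ* A.cmat) = u := A.exists_section.choose_spec.1 u

lemma vecMul_sec {w : Fin 4 → ℂ} (hw : w ⬝ᵥ A.ccenter = 0) : A.sec w ᵥ* A.cmat = w :=
  A.exists_section.choose_spec.2 w hw

lemma sec_row (k : Fin 3) : A.sec (A.cmat k) = Pi.single k 1 := by
  rw [← A.sec_vecMul (Pi.single k 1), single_one_vecMul]
  rfl

end Camera

/-! ### Symbolic matrices and their evaluation at images of world points. -/

section Arrangement

variable {n : ℕ} (A : Fin n → Camera)

/-- The form in the `i`-th image coordinates given by a linear form on the world. -/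
def imageForm (i : Fin n) : (Fin 4 → ℂ) →ₗ[ℂ] PolyRing n where
  toFun w := ∑ k, C ((A i).sec w k) * X (i, k)
  map_add' w w' := by simp [add_mul, Finset.sum_add_distrib]
  map_smul' c w := by simp [Finset.mul_sum, mul_assoc, smul_eq_C_mul]

lemma imageForm_apply (i : Fin n) (w : Fin 4 → ℂ) :
    imageForm A i w = ∑ k, C ((A i).sec w k) * X (i, k) := rfl

lemma imageForm_row (i : Fin n) (k : Fin 3) : imageForm A i ((A i).cmat k) = X (i, k) := by
  rw [imageForm_apply, (A i).sec_row, Finset.sum_eq_single k]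
  · simp
  · intro l _ hl; simp [hl]
  · simp

lemma symbolicMatrix_inl (σ : Finset (Fin n)) (r : σ × Fin 3) (j : Fin 4) :
    symbolicMatrix A σ r (Sum.inl j) = C ((A r.1).cmat r.2 j) := rfl

lemma symbolicMatrix_inr (σ : Finset (Fin n)) (r : σ × Fin 3) (i : σ) :
    symbolicMatrix A σ r (Sum.inr i) = if i = r.1 then X ((r.1 : Fin n), r.2) else 0 := rfl

lemma card_columns {σ : Finset (Fin n)} {k : ℕ} (hσ : σ.card = k) :
    Fintype.card (Fin (4 + k)) = Fintype.card (Fin 4 ⊕ σ) := by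
  simp [hσ]

/-- Maximal minors vanish where the matrix has a kernel. -/
lemma minors_le_ker {D : Type*} [CommRing D] [IsDomain D] (ψ : PolyRing n →+* D)
    {σ : Finset (Fin n)} {k : ℕ} (hσ : σ.card = k) (q : Fin 4 → D) (τ : Fin n → D)
    (hne : q ≠ 0 ∨ ∃ i ∈ σ, τ i ≠ 0)
    (h : ∀ i ∈ σ, ∀ l, ∑ j, ψ (C ((A i).cmat l j)) * q j = τ i * ψ (X (i, l))) :
    minors (4 + k) (symbolicMatrix A σ) ≤ RingHom.ker ψ := by
  classical
  refine Ideal.span_le.2 ?_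
  rintro _ ⟨r, c, rfl⟩
  let c' : Fin (4 + k) ≃ Fin 4 ⊕ σ := Equiv.ofBijective c
    ((Fintype.bijective_iff_injective_and_card c).2 ⟨c.injective, card_columns hσ⟩)
  let v : Fin 4 ⊕ σ → D := Sum.elim q fun i => -τ i
  have hker : (symbolicMatrix A σ).map ψ *ᵥ v = 0 := by
    ext x
    have := h x.1 x.1.2 x.2
    simp only [mulVec, dotProduct, Fintype.sum_sum_type, map_apply, symbolicMatrix_inl,
      symbolicMatrix_inr, v, Sum.elim_inl, Sum.elim_inr, Pi.zero_apply, this]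
    rw [Finset.sum_eq_single x.1]
    · simp; ring
    · intro i _ hi; simp [hi]
    · simp
  change ψ _ = 0
  rw [RingHom.map_det]
  refine exists_mulVec_eq_zero_iff.1 ⟨v ∘ c', ?_, ?_⟩
  · intro hv
    have hv' : v = 0 := by
      ext y
      have := congrFun hv (c'.symm y)
      simpa using this
    rcases hne with hne | ⟨i, hi, hne⟩
    · exact hne (funext fun j => congrFun hv' (Sum.inl j))
    · have := congrFun hv' (Sum.inr ⟨i, hi⟩)
      simp only [v, Sum.elim_inr, Pi.zero_apply, neg_eq_zero] at this
      exact hne this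
  · have : (RingHom.mapMatrix ψ) ((symbolicMatrix A σ).submatrix r c) =
        ((symbolicMatrix A σ).map ψ).submatrix r c' := rfl
    rw [this, submatrix_mulVec_equiv]
    ext x
    simp [Function.comp_assoc, hker]

lemma focalIdeal_le {k : ℕ} {I : Ideal (PolyRing n)}
    (h : ∀ σ : Finset (Fin n), σ.card = k → minors (4 + k) (symbolicMatrix A σ) ≤ I) :
    focalIdeal A k ≤ I :=
  iSup₂_le fun σ hσ => h σ (Finset.mem_powersetCard.1 hσ).2

lemma minors_le_focalIdeal {k : ℕ} {σ : Finset (Fin n)} (hσ : σ.card = k) :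
    minors (4 + k) (symbolicMatrix A σ) ≤ focalIdeal A k :=
  le_iSup₂_of_le σ (Finset.mem_powersetCard.2 ⟨Finset.subset_univ _, hσ⟩) le_rfl

/-- Evaluation at the images of the world point `q`, scaled by `t`. -/
def evalImage (t : Fin n → ℂ) (q : Fin 4 → ℂ) : PolyRing n →ₐ[ℂ] ℂ :=
  aeval fun x => t x.1 * ((A x.1).cmat x.2 ⬝ᵥ q)

lemma evalImage_imageForm (t : Fin n → ℂ) (q : Fin 4 → ℂ) (i : Fin n) {w : Fin 4 → ℂ}
    (hw : w ⬝ᵥ (A i).ccenter = 0) : evalImage A t q (imageForm A i w) = t i * (w ⬝ᵥ q) := by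
  conv_rhs => rw [← (A i).vecMul_sec hw, ← dotProduct_mulVec, dotProduct, Finset.mul_sum]
  rw [imageForm_apply, map_sum]
  refine Finset.sum_congr rfl fun k _ => ?_
  simp only [evalImage, map_mul, aeval_X, algHom_C, Algebra.algebraMap_self, RingHom.id_apply]
  simp only [mulVec]
  ring

/-- The world point with the inverse scalings, negated, is a kernel vector of the symbolic matrix.
If some scaling or the world point is zero, the matrix has a zero column instead. -/
lemma evalImage_focalIdeal {k : ℕ} (hk : 0 < k) (t : Fin n → ℂ) (q : Fin 4 → ℂ) {x : PolyRing n}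
    (hx : x ∈ focalIdeal A k) : evalImage A t q x = 0 := by
  classical
  have hX : ∀ i l, evalImage A t q (X (i, l)) = t i * ((A i).cmat l ⬝ᵥ q) := fun i l => by
    simp [evalImage]
  refine focalIdeal_le A (I := RingHom.ker (evalImage A t q).toRingHom) (fun σ hσ => ?_) hx
  obtain ⟨i₀, hi₀⟩ : σ.Nonempty := Finset.card_pos.1 (by omega)
  by_cases ht : ∃ i ∈ σ, t i = 0
  · obtain ⟨i, hi, hti⟩ := ht
    refine minors_le_ker A _ hσ 0 (Pi.single i 1) (Or.inr ⟨i, hi, by simp⟩) fun j hj l => ?_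
    by_cases hji : j = i
    · subst hji
      change _ = _ * evalImage A t q _
      simp [hX, hti]
    · simp [hji]
  by_cases hq : q = 0
  · refine minors_le_ker A _ hσ 0 1 (Or.inr ⟨i₀, hi₀, by simp⟩) fun j hj l => ?_
    change _ = _ * evalImage A t q _
    rw [hX, hq]
    simp
  push Not at ht
  refine minors_le_ker A _ hσ q (fun i => (t i)⁻¹) (Or.inl hq) fun j hj l => ?_
  change ∑ _, evalImage A t q _ * _ = _ * evalImage A t q _
  rw [hX, inv_mul_cancel_left₀ (ht j hj)]
  simp [evalImage, dotProduct]

/-- Evaluation at the images of the generic world point. -/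
def genericImage : PolyRing n →ₐ[ℂ] MvPolynomial (Fin 4) ℂ :=
  aeval fun x => lin ((A x.1).cmat x.2)

lemma genericImage_imageForm (i : Fin n) {w : Fin 4 → ℂ} (hw : w ⬝ᵥ (A i).ccenter = 0) :
    genericImage A (imageForm A i w) = lin w := by
  conv_rhs => rw [← (A i).vecMul_sec hw, vecMul_eq_sum, map_sum]
  rw [imageForm_apply, map_sum]
  refine Finset.sum_congr rfl fun k _ => ?_
  simp only [genericImage, map_mul, aeval_X, algHom_C, map_smul, smul_eq_C_mul, algebraMap_eq]

lemma genericImage_focalIdeal {k : ℕ} {x : PolyRing n} (hx : x ∈ focalIdeal A k) :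
    genericImage A x = 0 := by
  refine focalIdeal_le A (I := RingHom.ker (genericImage A).toRingHom) (fun σ hσ => ?_) hx
  refine minors_le_ker A _ hσ X 1 (Or.inl fun h => X_ne_zero (R := ℂ) (0 : Fin 4)
    (congrFun h 0)) fun j hj l => ?_
  change ∑ _, genericImage A _ * _ = _ * genericImage A _
  simp [genericImage, lin_apply]

/-- Camera `j` sees the focus of `i`, so one of its rows does not vanish there. -/
lemma sep_centers (hfoci : ∀ i j, i ≠ j → (A i).focus ≠ (A j).focus) {i j : Fin n} (hij : i ≠ j) :
    ∃ w, w ⬝ᵥ (A j).ccenter = 0 ∧ w ⬝ᵥ (A i).ccenter ≠ 0 := by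
  obtain ⟨k, hk⟩ := Function.ne_iff.1 (Camera.mulVec_center_ne_zero (hfoci i j hij))
  refine ⟨(A j).cmat k, (A j).cmat_row_dotProduct k, ?_⟩
  have := (A j).cmat_mulVec (A i).center k
  intro h0
  refine hk ?_
  have h1 : (((A j).mat *ᵥ (A i).center) k : ℂ) = 0 := this.symm.trans h0
  exact_mod_cast h1

end Arrangement

/-! ### The bifocal ideal as a point system. -/

section Arrangement

variable {n : ℕ} (A : Fin n → Camera)

/-- The two-view relations lie in the bifocal ideal. -/
lemma swap_mem_focalIdeal (hfoci : ∀ i j, i ≠ j → (A i).focus ≠ (A j).focus) {i j : Fin n}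
    (hij : i ≠ j) {w w' : Fin 4 → ℂ} (hwi : w ⬝ᵥ (A i).ccenter = 0) (hwj : w ⬝ᵥ (A j).ccenter = 0)
    (hwi' : w' ⬝ᵥ (A i).ccenter = 0) (hwj' : w' ⬝ᵥ (A j).ccenter = 0) :
    imageForm A i w * imageForm A j w' - imageForm A i w' * imageForm A j w ∈ focalIdeal A 2 := by
  classical
  set σ : Finset (Fin n) := {i, j} with hσ
  have hcard : σ.card = 2 := Finset.card_pair hij
  let ε : Fin 2 → σ := ![⟨i, by simp [hσ]⟩, ⟨j, by simp [hσ]⟩]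
  have hε : Function.Bijective ε := by
    rw [Fintype.bijective_iff_injective_and_card]
    refine ⟨fun a b hab => ?_, by simp [hcard]⟩
    have h' := congrArg Subtype.val hab
    fin_cases a <;> fin_cases b <;> simp_all [ε]
  let e : Fin 2 ≃ σ := Equiv.ofBijective ε hε
  have he0 : (e 0 : Fin n) = i := rfl
  have he1 : (e 1 : Fin n) = j := rfl
  -- every linear form is a sum of forms through the two foci
  obtain ⟨w₀, hw₀j, hw₀i⟩ := sep_centers A hfoci hij
  let y : Fin 4 → Fin 4 → ℂ := fun a => ((A i).ccenter a / (w₀ ⬝ᵥ (A i).ccenter)) • w₀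
  have hyj : ∀ a, y a ⬝ᵥ (A j).ccenter = 0 := fun a => by
    simp only [y, smul_dotProduct, hw₀j, smul_zero]
  have hyi : ∀ a, (Pi.single a 1 - y a) ⬝ᵥ (A i).ccenter = 0 := fun a => by
    simp only [y, sub_dotProduct, smul_dotProduct, single_one_dotProduct, smul_eq_mul]
    rw [div_mul_cancel₀ _ hw₀i, sub_self]
  -- Constant row combinations of the 6 × 6 symbolic matrix. The first four produce the coordinate
  -- vectors in the camera columns. The last two write `w` and `w'` in the rows of either camera and
  -- subtract, so the camera columns cancel and only image forms remain. The product is block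
  -- triangular, with the exchange relation up to sign as its determinant.
  let c : Fin 4 ⊕ Fin 2 → Fin 2 → Fin 3 → ℂ := Sum.elim
    (fun a => ![(A i).sec (Pi.single a 1 - y a), (A j).sec (y a)])
    ![![(A i).sec w, -(A j).sec w], ![(A i).sec w', -(A j).sec w']]
  let Cm : Matrix (Fin 4 ⊕ Fin 2) (Fin 2 × Fin 3) (PolyRing n) := Matrix.of fun a x => C (c a x.1 x.2)
  let N : Matrix (Fin 2 × Fin 3) (Fin 4 ⊕ Fin 2) (PolyRing n) :=
    (symbolicMatrix A σ).submatrix (Prod.map e id) (Sum.map id e)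
  have hcols : ∀ (a : Fin 4 ⊕ Fin 2) (b : Fin 4), (Cm * N) a (Sum.inl b) =
      C ((c a 0 ᵥ* (A i).cmat + c a 1 ᵥ* (A j).cmat) b) := fun a b => by
    simp only [mul_apply, Fintype.sum_prod_type, Fin.sum_univ_two, Cm, N, of_apply,
      submatrix_apply, Sum.map_inl, id, symbolicMatrix_inl, Prod.map_apply, he0, he1,
      Pi.add_apply, vecMul, dotProduct, map_add, map_sum, map_mul]
  have hcolr : ∀ (a : Fin 4 ⊕ Fin 2) (b : Fin 2), (Cm * N) a (Sum.inr b) =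
      ∑ k, C (c a b k) * X ((e b : Fin n), k) := fun a b => by
    simp only [mul_apply, Fintype.sum_prod_type, Cm, N, of_apply, submatrix_apply, Sum.map_inr,
      id, symbolicMatrix_inr, Prod.map_apply, e.injective.eq_iff]
    rw [Finset.sum_eq_single b]
    · simp
    · intro b' _ hb'; simp [hb'.symm]
    · simp
  let Dm : Matrix (Fin 2) (Fin 2) (PolyRing n) :=
    !![imageForm A i w, -imageForm A j w; imageForm A i w', -imageForm A j w']
  have hblock : Cm * N = fromBlocks 1 ((Cm * N).submatrix Sum.inl Sum.inr) 0 Dm := by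
    ext a b : 2
    rcases a with a | a <;> rcases b with b | b
    · rw [hcols, fromBlocks_apply₁₁]
      simp only [c, Sum.elim_inl, Matrix.cons_val_zero, Matrix.cons_val_one]
      rw [(A i).vecMul_sec (hyi a), (A j).vecMul_sec (hyj a), sub_add_cancel, Pi.single_apply,
        Matrix.one_apply]
      by_cases hab : a = b
      · simp [hab]
      · simp [hab, Ne.symm hab]
    · rfl
    · rw [hcols, fromBlocks_apply₂₁]
      fin_cases a
      · simp [c, neg_vecMul, (A i).vecMul_sec hwi, (A j).vecMul_sec hwj]
      · simp [c, neg_vecMul, (A i).vecMul_sec hwi', (A j).vecMul_sec hwj']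
    · rw [hcolr, fromBlocks_apply₂₂]
      fin_cases a <;> fin_cases b <;> simp [c, Dm, he0, he1, imageForm_apply]
  have hdet : (Cm * N).det = Dm.det := by
    rw [hblock, det_fromBlocks_zero₂₁, det_one, one_mul]
  obtain ⟨ρ⟩ : Nonempty ((Fin 4 ⊕ Fin 2) ≃ (Fin 2 × Fin 3)) :=
    ⟨Fintype.equivOfCardEq (by simp)⟩
  have hmul : (Cm * N).det = (Cm.submatrix id ρ).det * (N.submatrix ρ id).det := by
    rw [← det_mul, submatrix_mul_equiv, submatrix_id_id]
  have hmem : (N.submatrix ρ id).det ∈ focalIdeal A 2 := by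
    refine minors_le_focalIdeal A hcard (Ideal.subset_span ?_)
    let g : Fin (4 + 2) ≃ Fin 4 ⊕ Fin 2 := finSumFinEquiv.symm
    refine ⟨(g.trans (ρ.trans (e.prodCongr (Equiv.refl (Fin 3))))).toEmbedding,
      (g.trans ((Equiv.refl (Fin 4)).sumCongr e)).toEmbedding, ?_⟩
    rw [← det_submatrix_equiv_self g]
    rfl
  have := (focalIdeal A 2).mul_mem_left (Cm.submatrix id ρ).det hmem
  rw [← hmul, hdet, det_fin_two_of] at this
  convert neg_mem this using 1
  ring

/-- The bifocal ideal of an arrangement with distinct foci as an abstract system. -/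
def system (hfoci : ∀ i j, i ≠ j → (A i).focus ≠ (A j).focus) :
    PointSystem (Fin n) (PolyRing n) where
  f i := (A i).ccenter
  J := focalIdeal A 2
  P := imageForm A
  Ψ := genericImage A
  Ψ_P i _ hw := genericImage_imageForm A i hw
  swap _ _ hij _ _ h1 h2 h3 h4 := swap_mem_focalIdeal A hfoci hij h1 h2 h3 h4

variable (hfoci : ∀ i j, i ≠ j → (A i).focus ≠ (A j).focus)

lemma system_sep (σ : Finset (Fin n)) : (system A hfoci).Sep σ :=
  fun _ _ _ _ hij => sep_centers A hfoci hij

lemma prod_X_mem_ML (k : Fin n → Fin 3) : ∏ i, X (i, k i) ∈ (system A hfoci).ML Finset.univ :=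
  Submodule.subset_span ⟨fun i => (A i).cmat (k i), fun i _ => (A i).cmat_row_dotProduct _,
    Finset.prod_congr rfl fun i _ => (imageForm_row A i (k i)).symm⟩

/-- Maximal minors of the full symbolic matrix are multilinear. -/
lemma det_mem_ML (r : Fin (4 + n) ↪ ↥(Finset.univ : Finset (Fin n)) × Fin 3)
    (c : Fin (4 + n) ↪ Fin 4 ⊕ (Finset.univ : Finset (Fin n))) :
    ((symbolicMatrix A Finset.univ).submatrix r c).det ∈ (system A hfoci).ML Finset.univ := by
  let c' : Fin (4 + n) ≃ Fin 4 ⊕ (Finset.univ : Finset (Fin n)) := Equiv.ofBijective c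
    ((Fintype.bijective_iff_injective_and_card c).2 ⟨c.injective, card_columns (by simp)⟩)
  rw [det_apply]
  refine Submodule.sum_mem _ fun π _ => ?_
  rw [Units.smul_def, ← Int.cast_smul_eq_zsmul ℂ]
  refine Submodule.smul_mem _ _ ?_
  let ρ : Fin 4 ⊕ (Finset.univ : Finset (Fin n)) → ↥(Finset.univ : Finset (Fin n)) × Fin 3 :=
    fun y => r (π (c'.symm y))
  have hprod : ∏ x, (symbolicMatrix A Finset.univ).submatrix r c (π x) x =
      ∏ y, symbolicMatrix A Finset.univ (ρ y) y := by
    rw [← c'.prod_comp]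
    refine Finset.prod_congr rfl fun x _ => ?_
    simp only [ρ, Equiv.symm_apply_apply]
    rfl
  rw [hprod, Fintype.prod_sum_type]
  simp only [symbolicMatrix_inl, symbolicMatrix_inr]
  rw [← map_prod, ← smul_eq_C_mul]
  refine Submodule.smul_mem _ _ ?_
  -- A term of the expansion survives only if the column of each camera takes its entry from that
  -- camera's own block, and then it contains one variable of each camera.
  by_cases hall : ∀ i : (Finset.univ : Finset (Fin n)), i = (ρ (Sum.inr i)).1
  · have : (∏ i : (Finset.univ : Finset (Fin n)), if i = (ρ (Sum.inr i)).1 then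
        (X (((ρ (Sum.inr i)).1 : Fin n), (ρ (Sum.inr i)).2) : PolyRing n) else 0) =
        ∏ i, X (i, (ρ (Sum.inr ⟨i, Finset.mem_univ i⟩)).2) := by
      rw [← Finset.prod_coe_sort Finset.univ fun i =>
        (X (i, (ρ (Sum.inr ⟨i, Finset.mem_univ i⟩)).2) : PolyRing n)]
      refine Finset.prod_congr rfl fun i _ => ?_
      rw [if_pos (hall i), ← hall i]
    rw [this]
    exact prod_X_mem_ML A hfoci _
  · push Not at hall
    obtain ⟨i, hi⟩ := hall
    rw [Finset.prod_eq_zero (Finset.mem_univ i) (if_neg hi)]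
    exact zero_mem _

/-- If the multilinear relations are generated by the two-view relations, then the `n`-focal ideal
is contained in the bifocal ideal. -/
lemma focalIdeal_le_of_exact (hex : (system A hfoci).Exact Finset.univ) :
    focalIdeal A n ≤ focalIdeal A 2 := by
  refine focalIdeal_le A fun σ hσ => ?_
  obtain rfl : σ = Finset.univ := Finset.eq_univ_of_card _ (by simpa using hσ)
  refine Ideal.span_le.2 ?_
  rintro _ ⟨r, c, rfl⟩
  refine hex _ (det_mem_ML A hfoci r c) (genericImage_focalIdeal A (k := n) ?_)
  exact minors_le_focalIdeal A hσ (Ideal.subset_span ⟨r, c, rfl⟩)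

lemma isCoplanar_iff : IsCoplanar A ↔ ∃ v : Fin 4 → ℝ, v ≠ 0 ∧ ∀ i, v ⬝ᵥ (A i).center = 0 := by
  constructor
  · rintro ⟨v, hv⟩
    refine ⟨v.rep, v.rep_nonzero, fun i => ?_⟩
    have := hv i
    rwa [← v.mk_rep, ← (A i).mk_center, Projectivization.orthogonal_mk] at this
  · rintro ⟨v, hv, h⟩
    refine ⟨Projectivization.mk ℝ v hv, fun i => ?_⟩
    rw [← (A i).mk_center, Projectivization.orthogonal_mk]
    exact h i

/-- Noncoplanar foci span world space, so four of them are independent. -/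
lemma exact_of_not_isCoplanar (h : ¬ IsCoplanar A) : (system A hfoci).Exact Finset.univ := by
  rw [isCoplanar_iff] at h
  push Not at h
  obtain ⟨κ, -, hdet⟩ := exists_det_ne_zero (fun i => (A i).center) fun u hu => by
    by_contra hne
    obtain ⟨i, hi⟩ := h u hne
    exact hi (by rw [dotProduct_comm]; exact hu i)
  refine PointSystem.exact_of_det_ne_zero (κ := κ) ?_ (fun _ => Finset.mem_univ _)
    (system_sep A hfoci _)
  have : (system A hfoci).fociMatrix κ =
      ((algebraMap ℝ ℂ).mapMatrix (Matrix.of fun y => (A (κ y)).center))ᵀ := rfl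
  rw [this, det_transpose, ← RingHom.map_det]
  exact (map_ne_zero _).2 hdet

lemma adjoin_imageForm :
    Algebra.adjoin ℂ {x | ∃ i w, w ⬝ᵥ (A i).ccenter = 0 ∧ x = imageForm A i w} = ⊤ := by
  rw [eq_top_iff, ← MvPolynomial.adjoin_range_X]
  refine Algebra.adjoin_mono ?_
  rintro _ ⟨⟨i, k⟩, rfl⟩
  exact ⟨i, (A i).cmat k, (A i).cmat_row_dotProduct k, (imageForm_row A i k).symm⟩

end Arrangement

section Arrangement

variable {n : ℕ} (A : Fin n → Camera)

/-! ### The multiview ideal -/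

lemma image_eq (i : Fin n) (q : Fin 4 → ℝ) (k : Fin 3) :
    (A i).image q k = (A i).cmat k ⬝ᵥ fun j => (q j : ℂ) :=
  ((A i).cmat_mulVec q k).symm

/-- A polynomial vanishing at all scaled images of world points lies in the multiview ideal. -/
lemma mem_multiviewIdeal_of_evalImage {F : PolyRing n} (hF : ∀ t q, evalImage A t q F = 0) :
    F ∈ multiviewIdeal A := by
  rintro P ⟨q, -, hP⟩ u hu
  choose h hPi using hP
  choose hu' hui using hu
  have hscale : ∀ i, ∃ a : ℂ, a • (A i).image q = u i := fun i => by
    have := (hui i).trans (hPi i)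
    rwa [Projectivization.mk_eq_mk_iff'] at this
  choose t ht using hscale
  have := hF t fun j => (q j : ℂ)
  rw [evalImage] at this
  rw [← this, ← coe_aeval_eq_eval]
  change aeval _ F = _
  congr 2
  ext x
  rw [← ht, ← image_eq]
  rfl

/-- A polynomial in the multiview ideal vanishes at the images of all complex world points. -/
lemma evalImage_of_mem_multiviewIdeal (hn : 2 ≤ n)
    (hfoci : ∀ i j, i ≠ j → (A i).focus ≠ (A j).focus) {F : PolyRing n}
    (hF : F ∈ multiviewIdeal A) (t : Fin n → ℂ) (q : Fin 4 → ℂ) : evalImage A t q F = 0 := by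
  let ℓ : Fin n → Fin 3 → MvPolynomial (Fin n ⊕ Fin 4) ℂ := fun i k =>
    ∑ j, C ((A i).cmat k j) * X (Sum.inr j)
  let G : MvPolynomial (Fin n ⊕ Fin 4) ℂ := aeval (fun x => X (Sum.inl x.1) * ℓ x.1 x.2) F
  -- A guard: at a real point where `K` is nonzero, all scalings and all images are nonzero, so the
  -- hypothesis on `F` applies. Hence `G * K` vanishes at all real points and is therefore the zero
  -- polynomial.
  let K : MvPolynomial (Fin n ⊕ Fin 4) ℂ := ∏ i, (X (Sum.inl i) * ∑ k, ℓ i k ^ 2)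
  have hℓ : ∀ i k (z : Fin n ⊕ Fin 4 → ℂ), eval z (ℓ i k) = (A i).cmat k ⬝ᵥ fun j => z (Sum.inr j) :=
    fun i k z => by simp [ℓ, dotProduct]
  have hG : ∀ z : Fin n ⊕ Fin 4 → ℂ, eval z G =
      evalImage A (fun i => z (Sum.inl i)) (fun j => z (Sum.inr j)) F := fun z => by
    have : (aeval z).comp (aeval fun x : Fin n × Fin 3 => X (Sum.inl x.1) * ℓ x.1 x.2) =
        evalImage A (fun i => z (Sum.inl i)) (fun j => z (Sum.inr j)) := by
      refine MvPolynomial.algHom_ext fun x => ?_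
      rw [AlgHom.comp_apply, aeval_X, evalImage, aeval_X, map_mul, aeval_X, ← hℓ,
        ← coe_aeval_eq_eval]
      rfl
    rw [← this, AlgHom.comp_apply, ← coe_aeval_eq_eval]
    rfl
  have hK : K ≠ 0 := by
    refine Finset.prod_ne_zero_iff.2 fun i _ => mul_ne_zero (X_ne_zero _) fun h0 => ?_
    have : Nontrivial (Fin n) := Fin.nontrivial_iff_two_le.2 hn
    obtain ⟨j, hj⟩ := exists_ne i
    have hne := Camera.mulVec_center_ne_zero (hfoci j i hj)
    -- The focus of another camera is real with nonzero image in camera `i`, so the sum of squares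
    -- is positive there.
    have h1 := congrArg (eval (Sum.elim 0 (A j).ccenter)) h0
    simp only [map_sum, map_pow, hℓ, Sum.elim_inr, map_zero] at h1
    have h2 : ∀ k, (A i).cmat k ⬝ᵥ (A j).ccenter = (((A i).mat *ᵥ (A j).center) k : ℂ) :=
      fun k => (A i).cmat_mulVec (A j).center k
    simp only [h2] at h1
    have h3 : ∑ k, (((A i).mat *ᵥ (A j).center) k) ^ 2 = 0 := by exact_mod_cast h1
    refine hne (funext fun k => ?_)
    have h4 := (Finset.sum_eq_zero_iff_of_nonneg fun k _ => sq_nonneg _).1 h3 k (Finset.mem_univ _)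
    exact pow_eq_zero_iff (two_ne_zero) |>.1 h4
  have hGK : G * K = 0 := by
    refine MvPolynomial.funext_set (fun _ => Set.range (algebraMap ℝ ℂ))
      (fun _ => Set.infinite_range_of_injective (algebraMap ℝ ℂ).injective) fun z hz => ?_
    choose y hy using fun x => hz x (Set.mem_univ x)
    have hz' : z = fun x => ((y x : ℝ) : ℂ) := funext fun x => (hy x).symm
    rw [map_zero, map_mul, mul_eq_zero, or_iff_not_imp_right]
    intro hKz
    rw [map_prod] at hKz
    have hKz' : ∀ i, z (Sum.inl i) ≠ 0 ∧ ∑ k, eval z (ℓ i k) ^ 2 ≠ 0 := fun i => by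
      simpa using Finset.prod_ne_zero_iff.1 hKz i (Finset.mem_univ i)
    set q' : Fin 4 → ℝ := fun j => y (Sum.inr j) with hq'
    have himg : ∀ i, (A i).image q' ≠ 0 := fun i h0 => by
      refine (hKz' i).2 ?_
      refine Finset.sum_eq_zero fun k _ => ?_
      have := congrFun h0 k
      rw [image_eq] at this
      simp only [hℓ, hz']
      rw [this]
      simp
    have ht : ∀ i, z (Sum.inl i) ≠ 0 := fun i => (hKz' i).1
    have hsm : ∀ i, z (Sum.inl i) • (A i).image q' ≠ 0 := fun i => smul_ne_zero (ht i) (himg i)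
    have h1 := hF (fun i => Projectivization.mk ℂ ((A i).image q') (himg i))
      ⟨q', fun h0 => himg ⟨0, by omega⟩ (by ext k; simp [h0, Camera.image]),
        fun i => ⟨himg i, rfl⟩⟩ (fun i => z (Sum.inl i) • (A i).image q')
      fun i => ⟨hsm i, (Projectivization.mk_eq_mk_iff' _ _ _ _ _).2 ⟨_, rfl⟩⟩
    rw [hG, evalImage, ← h1, ← coe_aeval_eq_eval]
    change _ = aeval _ F
    congr 2
    ext x
    rw [Pi.smul_apply, image_eq, smul_eq_mul, hz']
  have hG0 : G = 0 := (mul_eq_zero.1 hGK).resolve_right hK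
  have := hG (Sum.elim t q)
  rw [hG0, map_zero] at this
  exact this.symm

lemma prod_X_mem_irrelevantIdeal (k : Fin n → Fin 3) :
    ∏ i, X (i, k i) ∈ irrelevantIdeal n := by
  rw [irrelevantIdeal, Ideal.mem_iInf]
  intro i
  rw [← Finset.mul_prod_erase _ _ (Finset.mem_univ i)]
  exact Ideal.mul_mem_right _ _ (Ideal.subset_span ⟨k i, rfl⟩)

/-- The irrelevant ideal is generated by products with one variable for each camera. -/
lemma irrelevantIdeal_le {I : Ideal (PolyRing n)} (F : PolyRing n)
    (h : ∀ k : Fin n → Fin 3, (∏ i, X (i, k i)) * F ∈ I) {g : PolyRing n}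
    (hg : g ∈ irrelevantIdeal n) : g * F ∈ I := by
  rw [irrelevantIdeal, Ideal.mem_iInf] at hg
  have hsupp : ∀ m ∈ g.support, ∀ i, ∃ k : Fin 3, m (i, k) ≠ 0 := fun m hm i => by
    have h1 : g ∈ Ideal.span (X '' Set.range fun k : Fin 3 => (i, k)) := by
      have := hg i
      rwa [← Set.range_comp]
    obtain ⟨x, ⟨k, rfl⟩, hk⟩ := mem_ideal_span_X_image.1 h1 m hm
    exact ⟨k, hk⟩
  rw [g.as_sum, Finset.sum_mul]
  refine I.sum_mem fun m hm => ?_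
  choose k hk using hsupp m hm
  have hle : ∑ i, Finsupp.single (i, k i) 1 ≤ m := by
    rintro ⟨i, l⟩
    rw [Finsupp.finsetSum_apply]
    by_cases hl : k i = l
    · rw [Finset.sum_eq_single i]
      · rw [← hl, Finsupp.single_eq_same]
        exact Nat.one_le_iff_ne_zero.2 (hk i)
      · intro j _ hj
        rw [Finsupp.single_apply, if_neg fun h => hj (Prod.mk.inj h).1]
      · simp
    · rw [Finset.sum_eq_zero]
      · exact Nat.zero_le _
      · intro j _
        rw [Finsupp.single_apply, if_neg]
        rintro h
        obtain ⟨rfl, h'⟩ := Prod.mk.inj h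
        exact hl h'
  have hX : monomial (∑ i, Finsupp.single (i, k i) 1) (1 : ℂ) = ∏ i, X (i, k i) := by
    rw [monomial_sum_one]; rfl
  rw [← tsub_add_cancel_of_le hle, ← mul_one (coeff _ g), ← monomial_mul, hX, mul_assoc]
  exact I.mul_mem_left _ (h k)

lemma focalIdeal_le_multiviewIdeal {k : ℕ} (hk : 0 < k) : focalIdeal A k ≤ multiviewIdeal A :=
  fun _ hx => mem_multiviewIdeal_of_evalImage A fun t q => evalImage_focalIdeal A hk t q hx

/-- At any choice of homogeneous coordinates some product with one variable per camera is nonzero;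
it lies in the irrelevant ideal and can be cancelled. -/
lemma colon_le_multiviewIdeal :
    (focalIdeal A 2).colon (irrelevantIdeal n : Set (PolyRing n)) ≤ multiviewIdeal A := by
  intro F hF P hP u hu
  have hne : ∀ i, ∃ k, u i k ≠ 0 := fun i => Function.ne_iff.1 (hu i).choose
  choose k hk using hne
  have h1 := Submodule.mem_colon.1 hF _ (prod_X_mem_irrelevantIdeal k)
  have h2 := focalIdeal_le_multiviewIdeal A two_pos h1 P hP u hu
  rw [smul_eq_mul, map_mul, map_prod] at h2
  refine (mul_eq_zero.1 h2).resolve_right (Finset.prod_ne_zero_iff.2 fun i _ => ?_)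
  simpa using hk i

lemma multiviewIdeal_eq_of_exact (hn : 2 ≤ n)
    (hfoci : ∀ i j, i ≠ j → (A i).focus ≠ (A j).focus)
    (hex : (system A hfoci).Exact Finset.univ) :
    multiviewIdeal A = (focalIdeal A 2).colon (irrelevantIdeal n : Set (PolyRing n)) := by
  refine le_antisymm (fun F hF => ?_) (colon_le_multiviewIdeal A)
  refine Submodule.mem_colon.2 fun g hg => ?_
  rw [smul_eq_mul, mul_comm]
  refine irrelevantIdeal_le F (fun k => ?_) hg
  have := PointSystem.prod_mul_mem_of_sep (S := system A hfoci) hn hex (system_sep A hfoci _)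
    (adjoin_imageForm A) (evalImage A) (fun t q i w hw => evalImage_imageForm A t q i hw)
    (fun t q x hx => evalImage_focalIdeal A two_pos t q hx)
    (fun t q => evalImage_of_mem_multiviewIdeal A hn hfoci hF t q)
    (fun i => (A i).cmat (k i)) (fun i => (A i).cmat_row_dotProduct (k i))
  have hX : ∏ i, (system A hfoci).P i ((A i).cmat (k i)) = ∏ i, X (i, k i) :=
    Finset.prod_congr rfl fun i _ => imageForm_row A i (k i)
  rwa [hX] at this

end Arrangement

section Arrangement

variable {n : ℕ} (A : Fin n → Camera)

/-! ### Coplanar foci -/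

/-- The tuple of images of world points, one for each camera. -/
def imagePoint (ω : Fin n → Fin 4 → ℝ) : Fin n × Fin 3 → ℂ :=
  fun x => (((A x.1).mat *ᵥ ω x.1) x.2 : ℂ)

/-- The bifocals vanish at images of world points in a plane through all the foci. -/
lemma eval_focalIdeal_two {v : Fin 4 → ℝ} (hv : v ≠ 0) (hc : ∀ i, v ⬝ᵥ (A i).center = 0)
    {ω : Fin n → Fin 4 → ℝ} (hω : ∀ i, v ⬝ᵥ ω i = 0) {x : PolyRing n} (hx : x ∈ focalIdeal A 2) :
    eval (imagePoint A ω) x = 0 := by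
  classical
  refine focalIdeal_le A (I := RingHom.ker (eval (imagePoint A ω))) (fun σ hσ => ?_) hx
  obtain ⟨i, j, hij, rfl⟩ := Finset.card_eq_two.1 hσ
  -- Two lines in a plane meet: the four vectors are orthogonal to `v`, hence dependent, and the
  -- dependence provides a world vector `q` on both rays.
  let M : Matrix (Fin 4) (Fin 4) ℝ := Matrix.of ![(A i).center, ω i, (A j).center, ω j]
  have hM : M.det = 0 := exists_mulVec_eq_zero_iff.1 ⟨v, hv, funext fun k => by
    change M k ⬝ᵥ v = 0
    rw [dotProduct_comm]
    fin_cases k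
    exacts [hc i, hω i, hc j, hω j]⟩
  obtain ⟨c, hc0, hcM⟩ := exists_vecMul_eq_zero_iff.2 hM
  have hsum : c 0 • (A i).center + c 1 • ω i = -(c 2 • (A j).center + c 3 • ω j) := by
    rw [vecMul_eq_sum, Fin.sum_univ_four] at hcM
    rw [eq_neg_iff_add_eq_zero, ← hcM, ← add_assoc]
    rfl
  set q : Fin 4 → ℝ := c 0 • (A i).center + c 1 • ω i with hq
  have hi : (A i).mat *ᵥ q = c 1 • ((A i).mat *ᵥ ω i) := by
    rw [hq, mulVec_add, mulVec_smul, mulVec_smul, (A i).mulVec_center, smul_zero, zero_add]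
  have hj : (A j).mat *ᵥ q = (-c 3) • ((A j).mat *ᵥ ω j) := by
    rw [hsum, mulVec_neg, mulVec_add, mulVec_smul, mulVec_smul, (A j).mulVec_center, smul_zero,
      zero_add, neg_smul]
  let τ : Fin n → ℝ := fun k => if k = i then c 1 else -c 3
  have hτi : τ i = c 1 := if_pos rfl
  have hτj : τ j = -c 3 := if_neg hij.symm
  refine minors_le_ker A _ hσ (fun k => (q k : ℂ)) (fun k => (τ k : ℂ)) ?_ fun k hk l => ?_
  · by_contra! hcon
    obtain ⟨hq0, hτ⟩ := hcon
    have h1 : c 1 = 0 := by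
      have := hτ i (by simp)
      rwa [hτi, Complex.ofReal_eq_zero] at this
    have h3 : c 3 = 0 := by
      have := hτ j (by simp)
      rwa [hτj, Complex.ofReal_eq_zero, neg_eq_zero] at this
    have hq0' : q = 0 := funext fun k => by
      have := congrFun hq0 k
      rwa [Pi.zero_apply, Complex.ofReal_eq_zero] at this
    have h0 : c 0 = 0 := by
      rw [hq, h1, zero_smul, add_zero] at hq0'
      exact (smul_eq_zero.1 hq0').resolve_right (A i).center_ne_zero
    have h2 : c 2 = 0 := by
      rw [hq0', h3, zero_smul, add_zero, eq_comm, neg_eq_zero] at hsum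
      exact (smul_eq_zero.1 hsum).resolve_right (A j).center_ne_zero
    refine hc0 (funext fun k => ?_)
    fin_cases k
    exacts [h0, h1, h2, h3]
  · have hk' : (A k).mat *ᵥ q = τ k • ((A k).mat *ᵥ ω k) := by
      rcases Finset.mem_insert.1 hk with rfl | hk
      · rw [hτi, hi]
      · rw [Finset.mem_singleton.1 hk, hτj, hj]
    simp only [eval_C, eval_X, imagePoint]
    refine ((A k).cmat_mulVec q l).trans ?_
    rw [hk', Pi.smul_apply, smul_eq_mul, Complex.ofReal_mul]

/-- Some maximal minor is nonzero at the images of world points with no common scene. -/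
lemma exists_mem_focalIdeal_eval_ne_zero {ω : Fin n → Fin 4 → ℝ}
    (hω : ∀ (q : Fin 4 → ℝ) (τ : Fin n → ℝ),
      (∀ i, (A i).mat *ᵥ q + τ i • ((A i).mat *ᵥ ω i) = 0) → q = 0 ∧ τ = 0) :
    ∃ g ∈ focalIdeal A n, eval (imagePoint A ω) g ≠ 0 := by
  classical
  let σ : Finset (Fin n) := Finset.univ
  have hσ : σ.card = n := Finset.card_fin n
  let N : σ × Fin 3 → Fin 4 ⊕ σ → ℝ := fun r => Sum.elim ((A r.1).mat r.2)
    fun i => if i = r.1 then ((A r.1).mat *ᵥ ω r.1) r.2 else 0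
  obtain ⟨κ, hκ, hdet⟩ := exists_det_ne_zero N fun u hu => by
    obtain ⟨hq, hτ⟩ := hω (fun j => u (Sum.inl j))
      (fun i => u (Sum.inr ⟨i, Finset.mem_univ i⟩)) fun i => funext fun k => by
        have := hu (⟨i, Finset.mem_univ i⟩, k)
        simp only [dotProduct, Fintype.sum_sum_type, N, Sum.elim_inl, Sum.elim_inr, ite_mul,
          zero_mul, Finset.sum_ite_eq', Finset.mem_univ, if_true] at this
        rw [Pi.add_apply, Pi.smul_apply, smul_eq_mul, mul_comm (u _)]
        exact this
    ext (j | i)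
    · exact congrFun hq j
    · exact congrFun hτ i
  let e : Fin (4 + n) ≃ Fin 4 ⊕ σ := Fintype.equivOfCardEq (card_columns hσ)
  refine ⟨((symbolicMatrix A σ).submatrix (κ ∘ e) e).det, minors_le_focalIdeal A hσ
    (Ideal.subset_span ⟨⟨κ ∘ e, hκ.comp e.injective⟩, e.toEmbedding, rfl⟩), ?_⟩
  have hmap : (RingHom.mapMatrix (eval (imagePoint A ω)))
      ((symbolicMatrix A σ).submatrix (κ ∘ e) e) =
        ((RingHom.mapMatrix (algebraMap ℝ ℂ)) (Matrix.of fun y => N (κ y))).submatrix e e := by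
    ext a b
    simp only [RingHom.mapMatrix_apply, map_apply, submatrix_apply, of_apply, Function.comp_apply]
    rcases e b with j | i
    · rw [symbolicMatrix_inl, eval_C]
      rfl
    · rw [symbolicMatrix_inr]
      simp only [N, Sum.elim_inr]
      split_ifs
      · rw [eval_X]
        rfl
      · simp
  rw [RingHom.map_det, hmap, det_submatrix_equiv_self, ← RingHom.map_det]
  exact (map_ne_zero _).2 hdet

/-- A plane is not covered by two lines. -/
lemma exists_plane_point {v a b c : Fin 4 → ℝ} :
    ∃ w, v ⬝ᵥ w = 0 ∧ w ∉ Submodule.span ℝ {a, b} ∧ w ∉ Submodule.span ℝ {a, c} := by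
  let φ : (Fin 4 → ℝ) →ₗ[ℝ] ℝ := dotProductBilin ℝ ℝ v
  have hφ : 3 ≤ Module.finrank ℝ (LinearMap.ker φ) := by
    have h1 := LinearMap.finrank_range_add_finrank_ker φ
    have h2 := Submodule.finrank_le (LinearMap.range φ)
    rw [Module.finrank_fin_fun] at h1
    rw [Module.finrank_self] at h2
    omega
  have hpair : ∀ x y : Fin 4 → ℝ, ¬ LinearMap.ker φ ≤ Submodule.span ℝ {x, y} := fun x y hle => by
    classical
    have h1 := Submodule.finrank_mono hle
    have h2 := finrank_span_finset_le_card (R := ℝ) ({x, y} : Finset (Fin 4 → ℝ))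
    have h3 := Finset.card_le_two (a := x) (b := y)
    rw [Set.finrank, Finset.coe_pair] at h2
    omega
  obtain ⟨w, hw, hN⟩ := exists_mem_forall_notMem (LinearMap.ker φ)
    {Submodule.span ℝ {a, b}, Submodule.span ℝ {a, c}} (Set.toFinite _) (by
      rintro N (rfl | rfl)
      exacts [hpair a b, hpair a c])
  exact ⟨w, hw, hN _ (Set.mem_insert _ _), hN _ (Set.mem_insert_of_mem _ rfl)⟩

/-- For coplanar foci, the bifocals have a common zero outside the `n`-focal variety. -/
lemma exists_zero_of_isCoplanar (hn : 3 ≤ n)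
    (hfoci : ∀ i j, i ≠ j → (A i).focus ≠ (A j).focus) (h : IsCoplanar A) :
    ∃ p : Fin n × Fin 3 → ℂ, (∀ i, ∃ k, p (i, k) ≠ 0) ∧ (∀ x ∈ focalIdeal A 2, eval p x = 0) ∧
      ∃ g ∈ focalIdeal A n, eval p g ≠ 0 := by
  obtain ⟨v, hv, hc⟩ := (isCoplanar_iff A).1 h
  let i₀ : Fin n := ⟨0, by omega⟩
  let i₁ : Fin n := ⟨1, by omega⟩
  let i₂ : Fin n := ⟨2, by omega⟩
  have h01 : i₀ ≠ i₁ := by simp [i₀, i₁]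
  have h02 : i₂ ≠ i₀ := by simp [i₀, i₂]
  have h12 : i₂ ≠ i₁ := by simp [i₁, i₂]
  obtain ⟨w, hvw, hw1, hw2⟩ := exists_plane_point (v := v) (a := (A i₀).center)
    (b := (A i₁).center) (c := (A i₂).center)
  rw [Submodule.mem_span_pair] at hw1 hw2
  push Not at hw1 hw2
  -- The rays of `i₀` and `i₁` meet only in `w`, while the ray of `i₂` joins its focus to that of
  -- `i₀` and misses `w`. The remaining cameras also look at the focus of `i₀`, which keeps their
  -- image points nonzero.
  let ω : Fin n → Fin 4 → ℝ := fun i => if i = i₀ ∨ i = i₁ then w else (A i₀).center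
  have hω0 : ω i₀ = w := if_pos (Or.inl rfl)
  have hω1 : ω i₁ = w := if_pos (Or.inr rfl)
  have hω' : ∀ i, i ≠ i₀ → i ≠ i₁ → ω i = (A i₀).center := fun i h0 h1 =>
    if_neg (not_or.2 ⟨h0, h1⟩)
  have hne : ∀ i, (A i).mat *ᵥ ω i ≠ 0 := fun i => by
    by_cases hi0 : i = i₀
    · rw [hi0, hω0]
      intro h0
      obtain ⟨c, hcw⟩ := (A i₀).mulVec_eq_zero_iff.1 h0
      exact hw1 c 0 (by rw [hcw, zero_smul, add_zero])
    by_cases hi1 : i = i₁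
    · rw [hi1, hω1]
      intro h0
      obtain ⟨c, hcw⟩ := (A i₁).mulVec_eq_zero_iff.1 h0
      exact hw1 0 c (by rw [hcw, zero_smul, zero_add])
    rw [hω' i hi0 hi1]
    exact Camera.mulVec_center_ne_zero (hfoci i₀ i (Ne.symm hi0))
  refine ⟨imagePoint A ω, fun i => ?_, fun x hx => eval_focalIdeal_two A hv hc (fun i => ?_) hx,
    exists_mem_focalIdeal_eval_ne_zero A fun q τ hq => ?_⟩
  · obtain ⟨k, hk⟩ := Function.ne_iff.1 (hne i)
    exact ⟨k, Complex.ofReal_ne_zero.2 hk⟩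
  · simp only [ω]
    split_ifs
    exacts [hvw, hc i₀]
  have hline : ∀ i, ∃ c : ℝ, c • (A i).center = q + τ i • ω i := fun i =>
    (A i).mulVec_eq_zero_iff.1 (by rw [mulVec_add, mulVec_smul, hq i])
  obtain ⟨a, ha⟩ := hline i₀
  obtain ⟨b, hb⟩ := hline i₁
  obtain ⟨c, hc'⟩ := hline i₂
  rw [hω0] at ha
  rw [hω1] at hb
  rw [hω' i₂ h02 h12] at hc'
  have hτ : τ i₀ = τ i₁ := by
    by_contra hτ
    have hτ' : τ i₀ - τ i₁ ≠ 0 := sub_ne_zero.2 hτ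
    refine hw1 (a / (τ i₀ - τ i₁)) (-b / (τ i₀ - τ i₁)) ?_
    have : (τ i₀ - τ i₁) • w = a • (A i₀).center - b • (A i₁).center := by
      rw [ha, hb]; module
    rw [← inv_smul_smul₀ hτ' w, this]
    module
  have ha0 : a = 0 := by
    by_contra ha0
    refine Camera.smul_center_ne (hfoci i₀ i₁ h01) (b / a) ?_
    have : a • (A i₀).center = b • (A i₁).center := by rw [ha, hb, hτ]
    rw [← inv_smul_smul₀ ha0 (A i₀).center, this]
    module
  have hqw : q = -(τ i₀ • w) := by
    rw [ha0, zero_smul] at ha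
    exact eq_neg_of_add_eq_zero_left ha.symm
  have hτ0 : τ i₀ = 0 := by
    by_contra hτ0
    refine hw2 (τ i₂ / τ i₀) (-c / τ i₀) ?_
    have : τ i₀ • w = τ i₂ • (A i₀).center - c • (A i₂).center := by
      rw [hc', hqw]; module
    rw [← inv_smul_smul₀ hτ0 w, this]
    module
  have hq0 : q = 0 := by rw [hqw, hτ0, zero_smul, neg_zero]
  refine ⟨hq0, funext fun i => ?_⟩
  have := hq i
  rw [hq0, mulVec_zero, zero_add] at this
  exact (smul_eq_zero.1 this).resolve_right (hne i)

end Arrangement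

end Multiview

end

/-! ### The equivalence. -/

theorem mainTheorem2 {n : ℕ} (hn : 4 ≤ n) (A : Fin n → Multiview.Camera)
    (hfoci : ∀ i j, i ≠ j → (A i).focus ≠ (A j).focus) :
    [¬ Multiview.IsCoplanar A,
      Multiview.focalIdeal A n ≤ Multiview.focalIdeal A 2,
      Multiview.multiviewIdeal A =
        (Multiview.focalIdeal A 2).colon
          (Multiview.irrelevantIdeal n : Set (Multiview.PolyRing n))].TFAE := by
  tfae_have 1 → 2 := fun h => Multiview.focalIdeal_le_of_exact A hfoci
    (Multiview.exact_of_not_isCoplanar A hfoci h)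
  tfae_have 1 → 3 := fun h => Multiview.multiviewIdeal_eq_of_exact A (by omega) hfoci
    (Multiview.exact_of_not_isCoplanar A hfoci h)
  tfae_have 2 → 1 := fun hle h => by
    obtain ⟨p, -, h2, g, hg, hg0⟩ := Multiview.exists_zero_of_isCoplanar A (by omega) hfoci h
    exact hg0 (h2 g (hle hg))
  tfae_have 3 → 1 := fun heq h => by
    obtain ⟨p, hp, h2, g, hg, hg0⟩ := Multiview.exists_zero_of_isCoplanar A (by omega) hfoci h
    choose k hk using hp
    -- The n-focal `g` lies in the multiview ideal, so under (c) its product with one coordinate per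
    -- camera is bifocal and vanishes at `p`; yet all its factors are nonzero there.
    have hg' := Multiview.focalIdeal_le_multiviewIdeal A (by omega) hg
    rw [heq] at hg'
    have hmul := h2 _ (Submodule.mem_colon.1 hg' _ (Multiview.prod_X_mem_irrelevantIdeal k))
    rw [smul_eq_mul, map_mul, map_prod] at hmul
    refine (mul_ne_zero hg0 (Finset.prod_ne_zero_iff.2 fun i _ => ?_)) hmul
    simpa using hk i
  tfae_finish
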